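/- **Formulas.** Let $F$ be a 3-CNF formula on $n$ variables $V$ (clauses of at most three literals on distinct variables) whose unique satisfying assignment is $\mathbf 1=(1,\dots,1)$. A clause is critical for $x$ if it contains the literal $x$ and all its other literals are negative literals of other variables. Fix for every variable $x$ a critical clause $C_x\in F$, its canonical critical clause. $\mathrm{TwoCC}$ is the set of variables that have at least two critical clauses among the clauses of at most three literals that belong to $F$ or are the resolvent of two clauses of $F$. **Trees.** The critical clause tree $T_x$ of height $h$ has a root with variable label $x$. For a node $v$, let $\alpha_v$ assign $0$ to the variable labels on the path from the root to $v$ (inclusive) and $1$ to all other variables. A node $v$ of depth less than $h$ has as clause label a clause of $F$ violated by $\alpha_v$: the canonical critical clause of the variable label of $v$ if $\alpha_v$ violates it, and an arbitrary violated clause otherwise. For each negative literal $\bar u$ of this clause, $v$ has a child with variable label $u$. The nodes of depth $h$ are the safe leaves. For $\pi\in[0,1]^V$, $\mathrm{Cut}(T_x)$ is the event that every path from the root to a safe leaf contains a non-root node with variable label $u$ such that $\pi(u)<\pi(x)$. A node is canonical if no variable label on its root path (inclusive) is in $\mathrm{TwoCC}$ and each of its proper ancestors has as clause label the canonical critical clause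 of its variable label. Let $$\mathrm{LabelDensity}(z,T_y)=\int_0^{1/2}\frac{(1-2r)^2}{(1-r)^3}\sum_{v}r^{d(v)+1}\,dr,$$ where $v$ ranges over the canonical nodes of $T_y$ with variable label $z$ and $d(v)$ is the depth of $v$. **Graphs.** Let $H$ be a simple graph on $V$ of maximum degree at most $2$, each edge of which is $\{y,z\}$ for some canonical critical clause $(x\vee\bar y\vee\bar z)$. Obtain $H_{\rm free}$ from $H$ by deleting, for each $x\in\mathrm{TwoCC}$, all edges at $x$ and the edge $\{y,z\}$ if $C_x=(x\vee\bar y\vee\bar z)$. Start with $G:=H_{\rm free}$ and $H_{\rm high}:=\emptyset$. In each step choose an edge $\{y,z\}$ of $H_{\rm free}$ with $\mathrm{LabelDensity}(z,T_y)\ge\mathrm{Thr}$, put it into $H_{\rm high}$, and delete all edges at $z$ from $G$. Stop at some moment when $\mathrm{LabelDensity}(b,T_a)\le\mathrm{Thr}$ and $\mathrm{LabelDensity}(a,T_b)\le\mathrm{Thr}$ for all edges $\{a,b\}$ of $G$. $H_{\rm low}$ is a subgraph of $G$ on the vertex set $V$ all of whose connected components have at most $22$ edges. **Distribution.** Let $\gamma(r)=r(1-2r)^{3/2}$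 and $\gamma_{\mathrm{TwoCC}}(r)=25r^3(1-2r)^2$ for $r\le 1/2$, let both be $0$ for $r>1/2$, and put $\phi=\gamma'$, $\phi_{\mathrm{TwoCC}}=\gamma_{\mathrm{TwoCC}}'$. Under $D=D_\varepsilon$, the placement $\pi\in[0,1]^V$ has density $$\prod_{C}\Bigl(1+\varepsilon\sum_{\{u,v\}\in E(C)}\phi(\pi(u))\phi(\pi(v))\Bigr)\prod_{v\in\mathrm{TwoCC}}\bigl(1+\varepsilon\,\phi_{\mathrm{TwoCC}}(\pi(v))\bigr),$$ where $C$ ranges over the connected components of $H_{\rm low}$. Let $s_3=\int_0^1Q_r\,dr=2-2\ln 2$, where $Q_r=(r/(1-r))^2$ for $r<1/2$ and $Q_r=1$ for $r\ge1/2$. **Lemma.** Let $0\le\varepsilon\le 0.1$ and $0<\mathrm{Thr}\le 1/1131$. Let $h(n)\to\infty$, and let $h'(n)$ be sufficiently large compared to $h(n)$, that is, $h'(n)\ge g(h(n))$ for all large $n$, where $g:\mathbb N\to\mathbb N$ depends only on $\varepsilon$ and $\mathrm{Thr}$. Then there is a sequence $o(1)$, depending only on $\varepsilon$, $\mathrm{Thr}$,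 $h$ and $h'$ and tending to $0$ as $n\to\infty$, such that the following holds for all $F$ on $n$ variables and all choices made above, where label densities are taken in trees of height $h(n)$. Suppose $x\notin\mathrm{TwoCC}$, the canonical critical clause of $x$ is $(x\vee\bar y\vee\bar z)$, and $\{y,z\}\in H_{\rm high}$. Then the critical clause tree $T_x$ of height $h'(n)$ satisfies $$\Pr_D[\mathrm{Cut}(T_x)]\ \ge\ s_3-o(1)-1.0302\,\varepsilon\cdot\mathrm{Thr}+0.9\,\mathrm{Thr}.$$ -/

import Mathlib

open Filter Topology MeasureTheory Set

namespace PPSZ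

/-! ### Formulas, critical clauses, resolvents -/

/-- A literal is a pair `(v, b)`: the positive literal of `v` if `b = true`, the negative one if
`b = false`. A clause is a finite set of literals, a formula a finite set of clauses. -/
abbrev Clause (V : Type) := Finset (V × Bool)

/-- The assignment `α` satisfies the clause `C`. -/
def Sat {V : Type} (α : V → Bool) (C : Clause V) : Prop := ∃ l ∈ C, α l.1 = l.2

/-- `F` is a 3-CNF formula (clauses of at most three literals on distinct variables) whose unique
satisfying assignment is the all-ones assignment. -/
structure IsUnique3CNF {V : Type} (F : Finset (Clause V)) : Prop where
  width : ∀ C ∈ F, C.card ≤ 3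
  distinct : ∀ C ∈ F, ∀ v, ¬ ((v, true) ∈ C ∧ (v, false) ∈ C)
  unique : ∀ α : V → Bool, (∀ C ∈ F, Sat α C) ↔ α = fun _ => true

/-- `C` is critical for `x`: under the all-ones assignment the literal `x` is the only satisfied
literal of `C`, and flipping `x` violates `C`. -/
def IsCritical {V : Type} (C : Clause V) (x : V) : Prop :=
  (x, true) ∈ C ∧ ∀ l ∈ C, l ≠ (x, true) → l.2 = false ∧ l.1 ≠ x

/-- `R` is the resolvent of `C₁` and `C₂` on some variable. -/
def IsResolvent {V : Type} [DecidableEq V] (C₁ C₂ R : Clause V) : Prop :=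
  ∃ w, (w, true) ∈ C₁ ∧ (w, false) ∈ C₂ ∧ R = C₁.erase (w, true) ∪ C₂.erase (w, false)

/-- Clauses of at most three literals that are in `F` or are a resolvent of two clauses of `F`. -/
def IsDerived {V : Type} [DecidableEq V] (F : Finset (Clause V)) (C : Clause V) : Prop :=
  C.card ≤ 3 ∧ (C ∈ F ∨ ∃ C₁ ∈ F, ∃ C₂ ∈ F, IsResolvent C₁ C₂ C)

open Classical in
/-- The variables that have at least two critical clauses, derived ones included. -/
noncomputable def twoCC {V : Type} [Fintype V] [DecidableEq V] (F : Finset (Clause V)) :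
    Finset V :=
  Finset.univ.filter fun x =>
    ∃ C C', C ≠ C' ∧ IsDerived F C ∧ IsDerived F C' ∧ IsCritical C x ∧ IsCritical C' x

/-- `canon` chooses one critical clause in `F`, the canonical one, for every variable. -/
def IsCanonicalChoice {V : Type} (F : Finset (Clause V)) (canon : V → Clause V) : Prop :=
  ∀ x, canon x ∈ F ∧ IsCritical (canon x) x

/-- The clause `(x ∨ ȳ ∨ z̄)`. -/
def critClause {V : Type} [DecidableEq V] (x y z : V) : Clause V :=
  {(x, true), (y, false), (z, false)}

theorem critClause_comm {V : Type} [DecidableEq V] (x y z : V) :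
    critClause x y z = critClause x z y := by
  unfold critClause
  rw [Finset.pair_comm]

/-! ### Critical clause trees

A node of the critical clause tree `T_x` is identified with the list of the variable labels on
the path that joins it to the root, its own label first and the root label `x` last (the children
of a node have distinct labels, so the list determines the node). -/

/-- The assignment label of a node: the variables on its root path are `0`, all others `1`. -/
def pathAssignment {V : Type} [DecidableEq V] (p : List V) : V → Bool := fun u => decide (u ∉ p)

/-- `sel` is a rule that provides clause labels of nodes: the clause label is a clause of `F`
violated by the assignment label, and it is the canonical critical clause of the variable label
whenever that clause is violated. Otherwise the choice is arbitrary. -/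
structure IsClauseLabelling {V : Type} [DecidableEq V] (F : Finset (Clause V))
    (canon : V → Clause V) (sel : List V → Clause V) : Prop where
  mem : ∀ p, p ≠ [] → sel p ∈ F
  violated : ∀ p, p ≠ [] → ¬ Sat (pathAssignment p) (sel p)
  canonical_first : ∀ a q, ¬ Sat (pathAssignment (a :: q)) (canon a) → sel (a :: q) = canon a

/-- The nodes of depth `d` of `T_x`; a node has one child for each negative literal of its clause
label. The tree `T_x` of height `h` consists of the levels `0, …, h`. Its safe leaves are the nodes
of depth `h`; a node of smaller depth without children is an unsafe leaf. -/
def level {V : Type} [Fintype V] [DecidableEq V] (sel : List V → Clause V) (x : V) :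
    ℕ → Finset (List V)
  | 0 => {[x]}
  | d + 1 => (level sel x d).biUnion fun p =>
      (Finset.univ.filter fun y => (y, false) ∈ sel p).image fun y => y :: p

/-- The event `Cut(T_x)` for the tree of height `h`: every path from the root to a safe leaf
contains a node whose label comes before `x` in the placement `π` (this cannot be the root). -/
def cut {V : Type} [Fintype V] [DecidableEq V] (sel : List V → Clause V) (x : V) (h : ℕ) :
    Set (V → ℝ) :=
  {π | ∀ p ∈ level sel x h, ∃ u ∈ p, π u < π x}

/-- A node is canonical if no label on its root path is in `two`, and the clause label of each of
its proper ancestors is the canonical critical clause of the label of that ancestor. -/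
def IsCanonicalNode {V : Type} (canon : V → Clause V) (sel : List V → Clause V)
    (two : Finset V) (p : List V) : Prop :=
  (∀ u ∈ p, u ∉ two) ∧ ∀ a q, (a :: q) <:+ p.tail → sel (a :: q) = canon a

open Classical in
/-- `LabelDensity(z, T_y, r)` for the tree of height `h`. -/
noncomputable def labelDensityAt {V : Type} [Fintype V] [DecidableEq V] (canon : V → Clause V)
    (sel : List V → Clause V) (two : Finset V) (h : ℕ) (y z : V) (r : ℝ) : ℝ :=
  (1 - 2 * r) ^ 2 / (1 - r) ^ 3 *
    ∑ d ∈ Finset.range (h + 1),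
      ∑ _p ∈ (level sel y d).filter
        (fun p => IsCanonicalNode canon sel two p ∧ p.head? = some z), r ^ (d + 1)

/-- `LabelDensity(z, T_y)` for the tree of height `h`. -/
noncomputable def labelDensity {V : Type} [Fintype V] [DecidableEq V] (canon : V → Clause V)
    (sel : List V → Clause V) (two : Finset V) (h : ℕ) (y z : V) : ℝ :=
  ∫ r in (0 : ℝ)..(1 / 2), labelDensityAt canon sel two h y z r

/-! ### The graphs -/

/-- The critical clause graph: an edge `{y, z}` for every canonical critical clause
`(x ∨ ȳ ∨ z̄)`. -/
def critGraph {V : Type} [DecidableEq V] (canon : V → Clause V) : SimpleGraph V where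
  Adj y z := y ≠ z ∧ ∃ x, canon x = critClause x y z
  symm := ⟨fun y z ⟨hne, x, hx⟩ => ⟨hne.symm, x, hx.trans (critClause_comm x y z)⟩⟩
  loopless := ⟨fun _ hy => hy.1 rfl⟩

/-- `H_free`: for every `x` in `two`, delete from `H` all edges at `x` and the edge `{y, z}` of the
canonical critical clause `(x ∨ ȳ ∨ z̄)`. -/
def freeGraph {V : Type} [DecidableEq V] (canon : V → Clause V) (two : Finset V)
    (H : SimpleGraph V) : SimpleGraph V where
  Adj y z := H.Adj y z ∧ y ∉ two ∧ z ∉ two ∧ ∀ x ∈ two, canon x ≠ critClause x y z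
  symm := ⟨fun y z ⟨hyz, hy, hz, hx⟩ =>
    ⟨hyz.symm, hz, hy, fun x hxt => critClause_comm x y z ▸ hx x hxt⟩⟩
  loopless := ⟨fun _ hy => H.irrefl hy.1⟩

/-- The process that separates the edges of `Hfree`. It starts with the pair `(Hfree, ∅)`. In a
step, an edge `{y, z}` of `Hfree` with `dens y z ≥ Thr` is put into the second graph, and all edges
at `z` are deleted from the first graph. -/
inductive Separates {V : Type} (Hfree : SimpleGraph V) (dens : V → V → ℝ) (Thr : ℝ) :
    SimpleGraph V → SimpleGraph V → Prop
  | start : Separates Hfree dens Thr Hfree ⊥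
  | step (low high : SimpleGraph V) (y z : V) : Separates Hfree dens Thr low high →
      Hfree.Adj y z → Thr ≤ dens y z →
      Separates Hfree dens Thr (low.deleteEdges (low.incidenceSet z))
        (high ⊔ SimpleGraph.fromEdgeSet {s(y, z)})

open Classical in
/-- The edges of a connected component. -/
noncomputable def componentEdges {V : Type} [Fintype V] {G : SimpleGraph V}
    (c : G.ConnectedComponent) : Finset (Sym2 V) :=
  Finset.univ.filter fun e => e ∈ G.edgeSet ∧ ∀ v ∈ e, v ∈ c.supp

/-- `HLow` and `HHigh` are a possible outcome of the construction of `H_low` and `H_high`: run the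
process until every remaining edge has density at most `Thr` in both directions; the second graph
is `H_high`. Then delete edges of the first graph so that the remaining connected components have
at most 22 edges each; this is `H_low`. -/
def IsLowHigh {V : Type} [Fintype V] (Hfree : SimpleGraph V) (dens : V → V → ℝ) (Thr : ℝ)
    (HLow HHigh : SimpleGraph V) : Prop :=
  ∃ low, Separates Hfree dens Thr low HHigh ∧ (∀ a b, low.Adj a b → dens a b ≤ Thr) ∧
    HLow ≤ low ∧ ∀ c : HLow.ConnectedComponent, (componentEdges c).card ≤ 22

/-! ### The distribution of the placement -/

/-- `γ(r) = r (1 - 2r)^{3/2}` on `[0, 1/2]`, and `0` beyond. -/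
noncomputable def gammaCorr (r : ℝ) : ℝ := if r < 1 / 2 then r * (1 - 2 * r) ^ (3 / 2 : ℝ) else 0

/-- `γ_TwoCC(r) = 25 r³ (1 - 2r)²` on `[0, 1/2]`, and `0` beyond. -/
noncomputable def gammaTwoCC (r : ℝ) : ℝ := if r < 1 / 2 then 25 * r ^ 3 * (1 - 2 * r) ^ 2 else 0

/-- `φ = γ'`. -/
noncomputable def phiCorr : ℝ → ℝ := deriv gammaCorr

/-- `φ_TwoCC = γ_TwoCC'`. -/
noncomputable def phiTwoCC : ℝ → ℝ := deriv gammaTwoCC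

open Classical in
/-- The density of `D` on `[0,1]^V`: each connected component `C` of `H_low` contributes
`1 + ε ∑_{uv ∈ E(C)} φ(π(u)) φ(π(v))`, each variable `v` in `two` contributes
`1 + ε φ_TwoCC(π(v))`. -/
noncomputable def densityD {V : Type} [Fintype V] (ε : ℝ) (HLow : SimpleGraph V)
    (two : Finset V) (π : V → ℝ) : ℝ :=
  (∏ c : HLow.ConnectedComponent,
    (1 + ε * ∑ e ∈ componentEdges c, (e.map fun v => phiCorr (π v)).mul)) *
  ∏ v ∈ two, (1 + ε * phiTwoCC (π v))

/-- The distribution `D` of the placement `π`. -/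
noncomputable def distD {V : Type} [Fintype V] (ε : ℝ) (HLow : SimpleGraph V)
    (two : Finset V) : Measure (V → ℝ) :=
  (Measure.pi fun _ : V => (volume : Measure ℝ).restrict (Icc 0 1)).withDensity
    fun π => ENNReal.ofReal (densityD ε HLow two π)

/-- `Q_r`, the probability that the infinite binary tree with distinct labels that are
independently less than `r` with probability `r` is cut, the root label being disregarded. -/
noncomputable def cutProbInf (r : ℝ) : ℝ := if r < 1 / 2 then (r / (1 - r)) ^ 2 else 1

/-- `s_3`, which is `2 - 2 ln 2`. -/
noncomputable def s3 : ℝ := ∫ r in (0 : ℝ)..1, cutProbInf r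

end PPSZ

set_option linter.unusedSectionVars false

/-! Condition on r = π(x). The cut depends only on the bits [π(u) < r]. In a component with m edges,
the factor 1 + ε Σ φφ is the average over its edges of 1 + εm φφ, so the density is an average over
matchings M that take one edge from every component with edges (`densityD_eq`). For fixed r and M
the bits are independent except for nonnegative correlations inside the pairs of M. Hence FKG
applies, and the cut probability is at least the value `treeVal` of a recursion in which nodes are
cut off independently, with probabilities that are conditional on all ancestors being late
(`IsBitSystem.mul_treeVal_le`). This value is built from early and late probabilities by sums and
products of nonnegative numbers. The geometric mean is multiplicative and superadditive, so the
average over M can be moved into the probabilities (`treeVal_gmean_le`,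
`IsCorrelation.treeVal_le_avg`). One tree remains, in which an ordinary label suffers a loss only if
one of its neighbours in H_low is on its path (`IsCorrelation.ordinary`).

For r ≥ 1/2 all correlations vanish and the cut probability tends to 1. For r < 1/2 the tree is
compared with the full binary tree, whose uncut probability tends to (1-2r)/(1-r)². A relative loss
at a node shrinks by the factor r with every level on the way to the root (`good_prod`), so the loss
at the root is at most a sum of discounted losses over canonical nodes, `lossSum`. The other nodes
need no further care. A label in TwoCC has a gain that pays for everything below it. At a canonical
node whose clause label is not canonical there is at most one child
(`CanonPath.card_childLabels_le_one`), and that surplus exceeds every possible loss. Charged to the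
upper label of each pair of neighbours on a path, the loss becomes a combination of label densities
of edges of H_low with total weight at most 1.0302 ε (`exists_lossSum_weights`). After integration
each density is at most Thr.

The gain comes from z, the end of the edge {y,z} at which all edges were deleted when the edge
entered H_high. Its bit is independent of the others. If z is early, the branch z of the root is
cut, and so is every node labelled z below y. The two branches at the root are therefore positively
correlated. `Good` tracks the pair of values for z early and z late: a bound q for the average and a
bound D for the difference. By `good_density` the difference at y is governed by Σ ρ^d over the
canonical nodes labelled z in T_y, where d is the depth, and `root_le` turns it into a gain that is
the label density with ρ in place of r. Here ρ is the late probability 1-r times a lower bound for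
the probability that a sibling is cut, and it is slightly smaller than r. Bernoulli's inequality and
an integration by parts with the potential `gainPot` show that the replacement costs at most a tenth
of the density, up to a vanishing error, which leaves 0.9 Thr. `le_distD_cut` integrates over r. -/

namespace PPSZ

/-! ### Combinatorics of critical clause trees -/

section Tree

variable {V : Type} [Fintype V] [DecidableEq V]

/-- The labels of the children of a node. -/
def childLabels (sel : List V → Clause V) (p : List V) : Finset V :=
  Finset.univ.filter fun y => (y, false) ∈ sel p

/-- The descendants of a node at relative depth `d`. -/
def descendants (sel : List V → Clause V) : ℕ → List V → Finset (List V)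
  | 0, p => {p}
  | d + 1, p => (childLabels sel p).biUnion fun c => descendants sel d (c :: p)

theorem descendants_succ' (sel : List V → Clause V) (d : ℕ) (p : List V) :
    descendants sel (d + 1) p =
      (descendants sel d p).biUnion fun q => (childLabels sel q).image fun y => y :: q := by
  induction d generalizing p with
  | zero =>
    ext q
    simp [descendants, eq_comm]
  | succ d ih =>
    have h : ∀ m q, descendants sel (m + 1) q =
        (childLabels sel q).biUnion fun c => descendants sel m (c :: q) := fun _ _ => rfl
    rw [h, h d, Finset.biUnion_biUnion]
    exact Finset.biUnion_congr rfl fun c _ => ih _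

theorem level_eq_descendants (sel : List V → Clause V) (x : V) (d : ℕ) :
    level sel x d = descendants sel d [x] := by
  induction d with
  | zero => rfl
  | succ d ih =>
    rw [descendants_succ', level, ih]
    rfl

theorem exists_append_of_mem_descendants {sel : List V → Clause V} {d : ℕ} {p q : List V}
    (h : q ∈ descendants sel d p) : ∃ l, l.length = d ∧ q = l ++ p := by
  induction d generalizing p with
  | zero => exact ⟨[], rfl, by simpa [descendants] using h⟩
  | succ d ih =>
    simp only [descendants, Finset.mem_biUnion] at h
    obtain ⟨c, -, hc⟩ := h
    obtain ⟨l, hl, rfl⟩ := ih hc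
    exact ⟨l ++ [c], by simp [hl], by simp⟩

theorem disjoint_descendants {sel : List V → Clause V} {d : ℕ} {p : List V} {c c' : V}
    (hcc : c ≠ c') :
    Disjoint (descendants sel d (c :: p)) (descendants sel d (c' :: p)) := by
  rw [Finset.disjoint_left]
  intro q h h'
  obtain ⟨l, hl, rfl⟩ := exists_append_of_mem_descendants h
  obtain ⟨l', hl', he⟩ := exists_append_of_mem_descendants h'
  have := (List.append_inj he (hl.trans hl'.symm)).2
  exact hcc (by simpa using this)

theorem isCanonicalNode_cons {canon : V → Clause V} {sel : List V → Clause V} {two : Finset V}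
    {c a : V} {q : List V} :
    IsCanonicalNode canon sel two (c :: a :: q) ↔
      IsCanonicalNode canon sel two (a :: q) ∧ c ∉ two ∧ sel (a :: q) = canon a := by
  unfold IsCanonicalNode
  simp only [List.tail_cons, List.mem_cons, forall_eq_or_imp]
  constructor
  · rintro ⟨⟨hc, ha, hq⟩, h⟩
    exact ⟨⟨⟨ha, hq⟩, fun b t hb => h b t (hb.trans (List.suffix_cons _ _))⟩, hc,
      h a q List.suffix_rfl⟩
  · rintro ⟨⟨⟨ha, hq⟩, h⟩, hc, hs⟩
    refine ⟨⟨hc, ha, hq⟩, fun b t hb => ?_⟩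
    rcases List.suffix_cons_iff.1 hb with hb | hb
    · obtain ⟨rfl, rfl⟩ := List.cons_eq_cons.1 hb
      exact hs
    · exact h b t hb

theorem IsCanonicalNode.of_append {canon : V → Clause V} {sel : List V → Clause V}
    {two : Finset V} {l p : List V} (hp : p ≠ [])
    (h : IsCanonicalNode canon sel two (l ++ p)) : IsCanonicalNode canon sel two p := by
  induction l with
  | nil => exact h
  | cons c l ih =>
    obtain ⟨a, q, hq⟩ := List.exists_cons_of_ne_nil (show l ++ p ≠ [] by simp [hp])
    rw [List.cons_append, hq, isCanonicalNode_cons] at h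
    exact ih (hq ▸ h.1)

/-- The number of canonical descendants with label `b` at relative depth `d`, provided that the
node itself is canonical. -/
def canonCount (canon : V → Clause V) (sel : List V → Clause V) (two : Finset V) (b : V) :
    ℕ → List V → ℕ
  | 0, p => if p.head? = some b then 1 else 0
  | _ + 1, [] => 0
  | d + 1, a :: q => if sel (a :: q) = canon a then
      ∑ c ∈ (childLabels sel (a :: q)).filter (· ∉ two), canonCount canon sel two b d (c :: a :: q)
      else 0

open Classical in
theorem card_filter_descendants {canon : V → Clause V} {sel : List V → Clause V}
    {two : Finset V} (b : V) (d : ℕ) (p : List V) (hp : p ≠ [])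
    (h : IsCanonicalNode canon sel two p) :
    ((descendants sel d p).filter
      fun q => IsCanonicalNode canon sel two q ∧ q.head? = some b).card =
      canonCount canon sel two b d p := by
  induction d generalizing p with
  | zero =>
    simp only [descendants, canonCount, Finset.filter_singleton, h, true_and]
    split_ifs <;> simp
  | succ d ih =>
    obtain ⟨a, q, rfl⟩ := List.exists_cons_of_ne_nil hp
    rw [descendants, Finset.filter_biUnion, Finset.card_biUnion]
    · rw [canonCount]
      split_ifs with hs
      · rw [Finset.sum_filter]
        refine Finset.sum_congr rfl fun c _ => ?_
        split_ifs with hc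
        · rw [Finset.card_eq_zero, Finset.filter_eq_empty_iff]
          rintro r hr ⟨hr', -⟩
          obtain ⟨l, -, rfl⟩ := exists_append_of_mem_descendants hr
          exact (isCanonicalNode_cons.1 (hr'.of_append (by simp))).2.1 hc
        · exact ih _ (by simp) (isCanonicalNode_cons.2 ⟨h, hc, hs⟩)
      · refine Finset.sum_eq_zero fun c _ => ?_
        rw [Finset.card_eq_zero, Finset.filter_eq_empty_iff]
        rintro r hr ⟨hr', -⟩
        obtain ⟨l, -, rfl⟩ := exists_append_of_mem_descendants hr
        exact hs (isCanonicalNode_cons.1 (hr'.of_append (by simp))).2.2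
    · intro c _ c' _ hcc
      exact Finset.disjoint_filter_filter (disjoint_descendants hcc)

theorem labelDensityAt_eq {canon : V → Clause V} {sel : List V → Clause V} {two : Finset V}
    (h : ℕ) {y : V} (hy : y ∉ two) (z : V) (r : ℝ) :
    labelDensityAt canon sel two h y z r = (1 - 2 * r) ^ 2 / (1 - r) ^ 3 *
      ∑ d ∈ Finset.range (h + 1), (canonCount canon sel two z d [y] : ℝ) * r ^ (d + 1) := by
  unfold labelDensityAt
  congr 1
  refine Finset.sum_congr rfl fun d _ => ?_
  rw [Finset.sum_const, nsmul_eq_mul, level_eq_descendants,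
    card_filter_descendants z d [y] (by simp)]
  refine ⟨by simpa using hy, ?_⟩
  intro a q ha
  simp at ha

/-! ### Consequences of unique satisfiability -/

section Formula

variable {F : Finset (Clause V)} {canon : V → Clause V} {sel : List V → Clause V}

theorem IsUnique3CNF.exists_pos (hF : IsUnique3CNF F) {C : Clause V} (hC : C ∈ F) :
    ∃ a, (a, true) ∈ C := by
  obtain ⟨⟨a, b⟩, hl, hb⟩ := (hF.unique fun _ => true).2 rfl C hC
  exact ⟨a, (show true = b from hb) ▸ hl⟩

theorem not_sat_pathAssignment {p : List V} {C : Clause V} :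
    ¬ Sat (pathAssignment p) C ↔
      ∀ u, ((u, true) ∈ C → u ∈ p) ∧ ((u, false) ∈ C → u ∉ p) := by
  unfold Sat pathAssignment
  push Not
  constructor
  · intro h u
    exact ⟨fun hu => by simpa using h _ hu, fun hu => by simpa using h _ hu⟩
  · rintro h ⟨u, b⟩ hu
    cases b
    · simpa using (h u).2 hu
    · simpa using (h u).1 hu

theorem mem_childLabels {p : List V} {c : V} : c ∈ childLabels sel p ↔ (c, false) ∈ sel p := by
  simp [childLabels]

theorem IsClauseLabelling.not_mem_of_mem_childLabels (hs : IsClauseLabelling F canon sel)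
    {p : List V} (hp : p ≠ []) {c : V} (hc : c ∈ childLabels sel p) : c ∉ p :=
  ((not_sat_pathAssignment.1 (hs.violated p hp)) c).2 (mem_childLabels.1 hc)

/-- A clause of at most three literals has at most two negative literals besides a positive one. -/
theorem card_childLabels_lt {p : List V} {a : V} (ha : (a, true) ∈ sel p) :
    (childLabels sel p).card < (sel p).card := by
  have h : insert (a, true) ((childLabels sel p).image fun y => (y, false)) ⊆ sel p := by
    intro l hl
    rcases Finset.mem_insert.1 hl with rfl | hl
    · exact ha
    · obtain ⟨y, hy, rfl⟩ := Finset.mem_image.1 hl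
      exact mem_childLabels.1 hy
  have h2 := Finset.card_le_card h
  rw [Finset.card_insert_of_notMem (by simp),
    Finset.card_image_of_injective _ (fun _ _ h => by simpa using h)] at h2
  omega

theorem IsClauseLabelling.card_childLabels_le (hF : IsUnique3CNF F)
    (hs : IsClauseLabelling F canon sel) {p : List V} (hp : p ≠ []) :
    (childLabels sel p).card ≤ 2 := by
  obtain ⟨a, ha⟩ := hF.exists_pos (hs.mem p hp)
  have := card_childLabels_lt ha
  have := hF.width _ (hs.mem p hp)
  omega

theorem IsClauseLabelling.sel_eq_canon_iff (hs : IsClauseLabelling F canon sel) {a : V}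
    {q : List V} : sel (a :: q) = canon a ↔ ¬ Sat (pathAssignment (a :: q)) (canon a) :=
  ⟨fun h => h ▸ hs.violated _ (by simp), hs.canonical_first a q⟩

/-- Removing ancestors from the path keeps the clause violated: the negative literals of `canon a`
remain false, and its only positive literal `a` stays on the path. -/
theorem IsClauseLabelling.sel_eq_canon_of_append (hs : IsClauseLabelling F canon sel)
    (hc : IsCanonicalChoice F canon) {a : V} {q t : List V}
    (h : sel (a :: q ++ t) = canon a) : sel (a :: q) = canon a := by
  rw [List.cons_append, hs.sel_eq_canon_iff, not_sat_pathAssignment] at h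
  rw [hs.sel_eq_canon_iff, not_sat_pathAssignment]
  intro u
  refine ⟨fun hu => ?_, fun hu hu' => (h u).2 hu ?_⟩
  · by_contra hne
    by_cases hua : u = a
    · simp [hua] at hne
    · have := ((hc a).2.2 _ hu (by simpa using hua)).1
      simp at this
  · rcases List.mem_cons.1 hu' with rfl | hu'
    · simp
    · simp [hu']

/-- The nodes of a critical clause tree that are canonical. -/
inductive CanonPath (canon : V → Clause V) (sel : List V → Clause V) (two : Finset V) :
    List V → Prop
  | root (x : V) : x ∉ two → CanonPath canon sel two [x]
  | step (c a : V) (q : List V) : CanonPath canon sel two (a :: q) → sel (a :: q) = canon a →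
      c ∈ childLabels sel (a :: q) → c ∉ two → CanonPath canon sel two (c :: a :: q)

theorem CanonPath.not_mem_two {two : Finset V} {p : List V}
    (h : CanonPath canon sel two p) {u : V} (hu : u ∈ p) : u ∉ two := by
  induction h with
  | root x hx =>
    rw [List.mem_singleton] at hu
    exact hu ▸ hx
  | step c a q _ _ _ hc ih =>
    rcases List.mem_cons.1 hu with rfl | hu
    · exact hc
    · exact ih hu

/-- Every label on a canonical path other than the first has a child on the path. -/
theorem CanonPath.exists_child {two : Finset V} {p : List V}
    (h : CanonPath canon sel two p) {u : V} (hu : u ∈ p.tail) :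
    ∃ c ∈ p, (c, false) ∈ canon u := by
  induction h with
  | root x hx => simp at hu
  | step c a q _ hs hc _ ih =>
    rcases List.mem_cons.1 hu with rfl | hu
    · exact ⟨c, by simp, by rw [← hs]; exact mem_childLabels.1 hc⟩
    · obtain ⟨d, hd, hd'⟩ := ih hu
      exact ⟨d, List.mem_cons_of_mem _ hd, hd'⟩

theorem eq_canon_of_isCritical (hc : IsCanonicalChoice F canon) (hF : IsUnique3CNF F) {a : V}
    (ha : a ∉ twoCC F) {C : Clause V} (hC : C ∈ F) (hCa : IsCritical C a) : C = canon a := by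
  by_contra hne
  apply ha
  simp only [twoCC, Finset.mem_filter, Finset.mem_univ, true_and]
  exact ⟨C, canon a, hne, ⟨hF.width _ hC, Or.inl hC⟩, ⟨hF.width _ (hc a).1, Or.inl (hc a).1⟩,
    hCa, (hc a).2⟩

/-- At a canonical node, a clause label other than the canonical critical clause has at most one
negative literal. -/
theorem CanonPath.card_childLabels_le_one (hF : IsUnique3CNF F)
    (hc : IsCanonicalChoice F canon) (hs : IsClauseLabelling F canon sel) {a : V} {q : List V}
    (h : CanonPath canon sel (twoCC F) (a :: q)) (hsel : sel (a :: q) ≠ canon a) :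
    (childLabels sel (a :: q)).card ≤ 1 := by
  by_contra! hcard
  have hm := hs.mem (a :: q) (by simp)
  have hv := not_sat_pathAssignment.1 (hs.violated (a :: q) (by simp))
  obtain ⟨b, hb⟩ := hF.exists_pos hm
  have hbp : b ∈ a :: q := (hv b).1 hb
  -- With two negative literals there is no room for a second positive one. Since `b` is on the path
  -- and the children are not, the clause is critical for `b`.
  have hcrit : IsCritical (sel (a :: q)) b := by
    refine ⟨hb, ?_⟩
    have hsub : insert (b, true) ((childLabels sel (a :: q)).image fun y => (y, false)) =
        sel (a :: q) := by
      apply Finset.eq_of_subset_of_card_le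
      · intro l hl
        rcases Finset.mem_insert.1 hl with rfl | hl
        · exact hb
        · obtain ⟨y, hy, rfl⟩ := Finset.mem_image.1 hl
          exact mem_childLabels.1 hy
      · rw [Finset.card_insert_of_notMem (by simp),
          Finset.card_image_of_injective _ (fun _ _ h => by simpa using h)]
        have := hF.width _ hm
        omega
    intro l hl hne
    rw [← hsub] at hl
    rcases Finset.mem_insert.1 hl with rfl | hl
    · exact absurd rfl hne
    · obtain ⟨y, hy, rfl⟩ := Finset.mem_image.1 hl
      refine ⟨rfl, ?_⟩
      rintro rfl
      exact hs.not_mem_of_mem_childLabels (by simp) hy hbp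
  -- Outside `twoCC` critical clauses are unique, so the label is `canon b`. If `b` were a proper
  -- ancestor, this clause would contain the negation of a label on the path and hence be satisfied.
  have heq := eq_canon_of_isCritical hc hF (h.not_mem_two hbp) hm hcrit
  rcases List.mem_cons.1 hbp with rfl | hbq
  · exact hsel heq
  · obtain ⟨c, hcp, hcb⟩ := h.exists_child (u := b) hbq
    rw [← heq] at hcb
    exact (hv c).2 hcb hcp

/-- More ancestors can only destroy canonical clause labels. This compares the subtree below a node
labelled `u` in T_x with the tree T_u itself. -/
theorem canonCount_append_le (hs : IsClauseLabelling F canon sel)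
    (hc : IsCanonicalChoice F canon) (two : Finset V) (b : V) (d : ℕ) (l t : List V)
    (hl : l ≠ []) :
    canonCount canon sel two b d (l ++ t) ≤ canonCount canon sel two b d l := by
  induction d generalizing l with
  | zero =>
    obtain ⟨a, q, rfl⟩ := List.exists_cons_of_ne_nil hl
    simp [canonCount]
  | succ d ih =>
    obtain ⟨a, q, rfl⟩ := List.exists_cons_of_ne_nil hl
    rw [List.cons_append, canonCount, canonCount]
    split_ifs with h1 h2
    · have : childLabels sel (a :: (q ++ t)) = childLabels sel (a :: q) := by
        simp [childLabels, h1, h2]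
      rw [this]
      exact Finset.sum_le_sum fun c _ => ih (c :: a :: q) (by simp)
    · exact absurd (hs.sel_eq_canon_of_append hc h1) h2
    · exact Nat.zero_le _
    · exact le_rfl

/-- Labels do not repeat along a path, because a negative literal of a violated clause belongs to a
variable off the path. -/
theorem canonCount_eq_zero_of_mem (hs : IsClauseLabelling F canon sel) (two : Finset V) {b : V}
    (d : ℕ) {p : List V} (hb : b ∈ p) : canonCount canon sel two b (d + 1) p = 0 := by
  induction d generalizing p with
  | zero =>
    obtain ⟨a, q, rfl⟩ := List.exists_cons_of_ne_nil (List.ne_nil_of_mem hb)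
    rw [canonCount]
    split_ifs
    · refine Finset.sum_eq_zero fun c hc => ?_
      have := hs.not_mem_of_mem_childLabels (by simp) (Finset.mem_filter.1 hc).1
      simp only [canonCount, List.head?_cons, Option.some.injEq, ite_eq_right_iff]
      rintro rfl
      exact absurd hb this
    · rfl
  | succ d ih =>
    obtain ⟨a, q, rfl⟩ := List.exists_cons_of_ne_nil (List.ne_nil_of_mem hb)
    rw [canonCount]
    split_ifs
    · exact Finset.sum_eq_zero fun c _ => ih (List.mem_cons_of_mem _ hb)
    · rfl

/-- Kraft's inequality for the canonical nodes with a given label. -/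
theorem sum_canonCount_le_one (hF : IsUnique3CNF F) (hs : IsClauseLabelling F canon sel)
    (two : Finset V) (b : V) (n : ℕ) {p : List V} (hp : p ≠ []) {ρ : ℝ} (h0 : 0 ≤ ρ)
    (h1 : ρ ≤ 1 / 2) :
    ∑ d ∈ Finset.range n, (canonCount canon sel two b d p : ℝ) * ρ ^ d ≤ 1 := by
  induction n generalizing p with
  | zero => simp
  | succ n ih =>
    obtain ⟨a, q, rfl⟩ := List.exists_cons_of_ne_nil hp
    rw [Finset.sum_range_succ']
    -- The counted nodes form an antichain: below a node labelled `b` the label does not recur. At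
    -- any other node there are at most two children, each with weight `ρ ≤ 1/2`.
    by_cases hb : b = a
    · rw [Finset.sum_eq_zero]
      · simp [canonCount, hb]
      · intro d _
        rw [canonCount_eq_zero_of_mem hs two d (by simp [hb])]
        simp
    · have h0' : (canonCount canon sel two b 0 (a :: q) : ℝ) = 0 := by
        simp [canonCount, Ne.symm hb]
      rw [h0', zero_mul, add_zero]
      by_cases hsel : sel (a :: q) = canon a
      · have : ∀ d ∈ Finset.range n,
            (canonCount canon sel two b (d + 1) (a :: q) : ℝ) * ρ ^ (d + 1) =
            ∑ c ∈ (childLabels sel (a :: q)).filter (· ∉ two),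
              ρ * ((canonCount canon sel two b d (c :: a :: q) : ℝ) * ρ ^ d) := by
          intro d _
          rw [canonCount, if_pos hsel]
          push_cast
          rw [Finset.sum_mul]
          exact Finset.sum_congr rfl fun c _ => by ring
        rw [Finset.sum_congr rfl this, Finset.sum_comm]
        calc _ ≤ ∑ c ∈ (childLabels sel (a :: q)).filter (· ∉ two), ρ := by
              refine Finset.sum_le_sum fun c _ => ?_
              rw [← Finset.mul_sum]
              exact mul_le_of_le_one_right h0 (ih (by simp))
          _ = (((childLabels sel (a :: q)).filter (· ∉ two)).card : ℝ) * ρ := by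
              rw [Finset.sum_const, nsmul_eq_mul]
          _ ≤ 2 * ρ := by
              gcongr
              exact_mod_cast (Finset.card_filter_le _ _).trans
                (hs.card_childLabels_le hF (by simp))
          _ ≤ 1 := by linarith
      · refine (Finset.sum_eq_zero fun d _ => ?_).le.trans zero_le_one
        rw [canonCount, if_neg hsel]
        simp

theorem canonCount_le_two_pow (hF : IsUnique3CNF F) (hs : IsClauseLabelling F canon sel)
    (two : Finset V) (b : V) (d : ℕ) {p : List V} (hp : p ≠ []) :
    (canonCount canon sel two b d p : ℝ) ≤ 2 ^ d := by
  have h := sum_canonCount_le_one hF hs two b (d + 1) hp (ρ := 1 / 2) (by norm_num) le_rfl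
  have h2 := Finset.single_le_sum (f := fun d => (canonCount canon sel two b d p : ℝ) * (1 / 2) ^ d)
    (fun i _ => by positivity) (Finset.self_mem_range_succ d)
  have h3 := h2.trans h
  rw [div_pow, one_pow, mul_one_div, div_le_one (by positivity)] at h3
  exact h3

end Formula

end Tree

/-! ### The full binary tree -/

/-- The probability that the full binary tree of height `k` with distinct labels is not cut. -/
noncomputable def nomUncut (r : ℝ) : ℕ → ℝ
  | 0 => 1
  | k + 1 => 1 - (1 - (1 - r) * nomUncut r k) ^ 2

/-- The limit of `nomUncut r` for `r < 1 / 2`. -/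
noncomputable def limUncut (r : ℝ) : ℝ := (1 - 2 * r) / (1 - r) ^ 2

theorem nomUncut_mem {r : ℝ} (h0 : 0 ≤ r) (h1 : r ≤ 1) (k : ℕ) :
    0 ≤ nomUncut r k ∧ nomUncut r k ≤ 1 := by
  induction k with
  | zero => simp [nomUncut]
  | succ k ih =>
    rw [nomUncut]
    have h2 : 0 ≤ (1 - r) * nomUncut r k := mul_nonneg (by linarith) ih.1
    have h3 : (1 - r) * nomUncut r k ≤ 1 := by nlinarith [ih.1, ih.2]
    constructor <;> nlinarith

theorem nomUncut_succ_le {r : ℝ} (h0 : 0 ≤ r) (h1 : r ≤ 1) (k : ℕ) :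
    nomUncut r (k + 1) ≤ nomUncut r k := by
  induction k with
  | zero => exact (nomUncut_mem h0 h1 1).2
  | succ k ih =>
    have h2 := nomUncut_mem h0 h1 k
    have h3 := nomUncut_mem h0 h1 (k + 1)
    change 1 - (1 - (1 - r) * nomUncut r (k + 1)) ^ 2 ≤ 1 - (1 - (1 - r) * nomUncut r k) ^ 2
    have h4 : (1 - r) * nomUncut r (k + 1) ≤ (1 - r) * nomUncut r k :=
      mul_le_mul_of_nonneg_left ih (by linarith)
    have h5 : (1 - r) * nomUncut r k ≤ 1 := by nlinarith
    nlinarith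

theorem nomUncut_antitone {r : ℝ} (h0 : 0 ≤ r) (h1 : r ≤ 1) : Antitone (nomUncut r) :=
  antitone_nat_of_succ_le (nomUncut_succ_le h0 h1)

theorem nomUncut_one_le {r : ℝ} (h0 : 0 ≤ r) (h1 : r ≤ 1) {k : ℕ} (hk : 1 ≤ k) :
    nomUncut r k ≤ 1 - r ^ 2 := by
  refine (nomUncut_antitone h0 h1 hk).trans (le_of_eq ?_)
  simp only [nomUncut]
  ring

theorem limUncut_fixed {r : ℝ} (h1 : r < 1) :
    1 - (1 - (1 - r) * limUncut r) ^ 2 = limUncut r := by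
  have : (1 - r) ≠ 0 := by linarith
  unfold limUncut
  field_simp
  ring

theorem one_sub_mul_limUncut {r : ℝ} (h1 : r < 1) :
    1 - (1 - r) * limUncut r = r / (1 - r) := by
  have : (1 - r) ≠ 0 := by linarith
  unfold limUncut
  field_simp
  ring

theorem limUncut_nonneg {r : ℝ} (h1 : r ≤ 1 / 2) : 0 ≤ limUncut r :=
  div_nonneg (by linarith) (sq_nonneg _)

theorem limUncut_le_one {r : ℝ} (h1 : r < 1) : limUncut r ≤ 1 := by
  unfold limUncut
  rw [div_le_one (pow_pos (by linarith) 2)]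
  nlinarith [sq_nonneg r]

theorem limUncut_le_nomUncut {r : ℝ} (h0 : 0 ≤ r) (h1 : r ≤ 1 / 2) (k : ℕ) :
    limUncut r ≤ nomUncut r k := by
  induction k with
  | zero => exact limUncut_le_one (by linarith)
  | succ k ih =>
    rw [nomUncut, ← limUncut_fixed (by linarith : r < 1)]
    have h4 : (1 - r) * limUncut r ≤ (1 - r) * nomUncut r k :=
      mul_le_mul_of_nonneg_left ih (by linarith)
    have h5 : (1 - r) * nomUncut r k ≤ 1 := by
      nlinarith [nomUncut_mem h0 (by linarith) k]
    nlinarith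

/-- With P = r/(1-r), a gap δ to the fixed point becomes 2P(1-r)δ - ((1-r)δ)², which is at most 2rδ.
-/
theorem nomUncut_sub_le {r : ℝ} (h0 : 0 ≤ r) (h1 : r ≤ 1 / 2) (k : ℕ) :
    nomUncut r k ≤ limUncut r + (2 * r) ^ k := by
  induction k with
  | zero => simpa [nomUncut] using limUncut_nonneg h1
  | succ k ih =>
    have hl := limUncut_le_nomUncut h0 h1 k
    have hp := one_sub_mul_limUncut (by linarith : r < 1)
    have hf := limUncut_fixed (by linarith : r < 1)
    rw [nomUncut, pow_succ (2 * r)]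
    set P := 1 - (1 - r) * limUncut r with hP
    have hPr : P * (1 - r) = r := by
      rw [hp, div_mul_cancel₀]
      linarith
    have hd : 1 - (1 - r) * nomUncut r k = P - (1 - r) * (nomUncut r k - limUncut r) := by
      rw [hP]; ring
    rw [hd]
    have h6 : 0 ≤ (1 - r) * (nomUncut r k - limUncut r) :=
      mul_nonneg (by linarith) (by linarith)
    have : 1 - (P - (1 - r) * (nomUncut r k - limUncut r)) ^ 2 ≤
        1 - P ^ 2 + 2 * (P * (1 - r)) * (nomUncut r k - limUncut r) := by nlinarith
    rw [hPr, hf] at this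
    nlinarith

/-- At the critical value r = 1/2 the convergence to 0 is only of order 1/k; 4/(k+4) is a
supersolution of U ↦ 1 - (1 - U/2)², and larger r only helps. -/
theorem nomUncut_le_of_half_le {r : ℝ} (h0 : 1 / 2 ≤ r) (h1 : r ≤ 1) (k : ℕ) :
    nomUncut r k ≤ 4 / (k + 4) := by
  induction k with
  | zero => simp [nomUncut]
  | succ k ih =>
    have h2 := nomUncut_mem (by linarith) h1 k
    rw [nomUncut]
    have hk : (0 : ℝ) < k + 4 := by positivity
    have h3 : (1 - r) * nomUncut r k ≤ 2 / (k + 4) := by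
      have : (1 - r) * nomUncut r k ≤ 1 / 2 * (4 / (k + 4)) :=
        mul_le_mul (by linarith) ih h2.1 (by norm_num)
      refine this.trans (le_of_eq ?_)
      ring
    have h4 : (2 : ℝ) / (k + 4) ≤ 1 := by
      rw [div_le_one hk]; linarith
    have h5 : 1 - (1 - (1 - r) * nomUncut r k) ^ 2 ≤ 1 - (1 - 2 / (k + 4)) ^ 2 := by nlinarith
    refine h5.trans ?_
    push_cast
    have hk5 : (0 : ℝ) < k + 1 + 4 := by positivity
    rw [show (1 : ℝ) - (1 - 2 / (k + 4)) ^ 2 = 4 * (k + 3) / (k + 4) ^ 2 by field_simp; ring,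
      div_le_div_iff₀ (by positivity) hk5]
    nlinarith

/-! ### Pairs of cut probabilities -/

/-- A lower bound for the pair of the probabilities of an event, given that a certain variable
comes early (`Q₁`) or late (`Q₀`): `q` bounds the average, `D` the difference, and a surplus `E` of
the average counts for a difference. -/
def Good (r Q₁ Q₀ q D : ℝ) : Prop :=
  ∃ Δ E, 0 ≤ Δ ∧ 0 ≤ E ∧ q + E + (1 - r) * Δ ≤ Q₁ ∧ q + E - r * Δ ≤ Q₀ ∧
    D ≤ Δ + (1 + r / 2) / (1 - r) * E

theorem Good.mono {r Q₁ Q₀ q D q' D' : ℝ} (h : Good r Q₁ Q₀ q D) (hq : q' ≤ q) (hD : D' ≤ D) :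
    Good r Q₁ Q₀ q' D' := by
  obtain ⟨Δ, E, h1, h2, h3, h4, h5⟩ := h
  exact ⟨Δ, E, h1, h2, by linarith, by linarith, by linarith⟩

theorem Good.affine {r Q₁ Q₀ q D p t : ℝ} (h : Good r Q₁ Q₀ q D) (ht : 0 ≤ t) :
    Good r (p + t * Q₁) (p + t * Q₀) (p + t * q) (t * D) := by
  obtain ⟨Δ, E, h1, h2, h3, h4, h5⟩ := h
  refine ⟨t * Δ, t * E, by positivity, by positivity, ?_, ?_, ?_⟩
  · nlinarith
  · nlinarith
  · calc t * D ≤ t * (Δ + (1 + r / 2) / (1 - r) * E) := by gcongr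
      _ = _ := by ring

theorem Good.le_of_eq {r Q q D : ℝ} (h : Good r Q Q q D) (hr : r ≤ 1) : q ≤ Q := by
  obtain ⟨Δ, E, h1, h2, h3, h4, h5⟩ := h
  nlinarith

theorem good_refl {r Q q : ℝ} (h : q ≤ Q) : Good r Q Q q 0 :=
  ⟨0, 0, le_rfl, le_rfl, by linarith, by linarith, by simp⟩

/-- The pair at a node labelled `z`, which is cut for certain if `z` is early; the whole gap 1 - q
becomes a difference. -/
theorem good_early {r Q₀ q : ℝ} (h : q ≤ Q₀) (hq : q ≤ 1) :
    Good r 1 Q₀ (r + (1 - r) * q) (1 - q) :=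
  ⟨1 - q, 0, by linarith, le_rfl, by linarith, by linarith, by simp⟩

/-- The average of the product gains the covariance r(1-r)ΔΔ' ≥ 0, which is dropped. Each difference
is weighted by the average of the other factor, and the mixed terms in the surpluses only help. -/
theorem Good.mul {r P₁ P₀ p D P₁' P₀' p' D' : ℝ} (h : Good r P₁ P₀ p D)
    (h' : Good r P₁' P₀' p' D') (hr0 : 0 ≤ r) (hr1 : r < 1) (hp : 0 ≤ p) (hp' : 0 ≤ p')
    (hP : 0 ≤ P₀) (hP' : 0 ≤ P₀') :
    Good r (P₁ * P₁') (P₀ * P₀') (p * p') (p' * D + p * D') := by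
  obtain ⟨Δ, E, h1, h2, h3, h4, h5⟩ := h
  obtain ⟨Δ', E', h1', h2', h3', h4', h5'⟩ := h'
  have hs : 0 < 1 - r := by linarith
  set κ := (1 + r / 2) / (1 - r) with hκ
  have hκ0 : 0 ≤ κ := by positivity
  refine ⟨(p' + E') * Δ + (p + E) * Δ', E * p' + E' * p + E * E', by positivity, by positivity,
    ?_, ?_, ?_⟩
  · have : (p + E + (1 - r) * Δ) * (p' + E' + (1 - r) * Δ') ≤ P₁ * P₁' :=
      mul_le_mul h3 h3' (by positivity) (le_trans (by positivity) h3)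
    nlinarith [mul_nonneg (mul_nonneg hs.le h1) (mul_nonneg hs.le h1')]
  · have key : (p + E) * (p' + E') - r * ((p' + E') * Δ + (p + E) * Δ') ≤ P₀ * P₀' := by
      -- Negative lower bounds cannot be multiplied, but if one of the two late bounds is negative,
      -- the target is at most 0 and P₀P₀' ≥ 0 suffices.
      rcases le_or_gt 0 (p + E - r * Δ) with ha | ha
      · rcases le_or_gt 0 (p' + E' - r * Δ') with hb | hb
        · have := mul_le_mul h4 h4' hb hP
          nlinarith [mul_nonneg (mul_nonneg hr0 h1) (mul_nonneg hr0 h1')]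
        · refine le_trans ?_ (mul_nonneg hP hP')
          have : 0 ≤ r * ((p' + E') * Δ) := by positivity
          nlinarith [mul_nonneg (add_nonneg hp h2) (neg_nonneg.2 hb.le)]
      · refine le_trans ?_ (mul_nonneg hP hP')
        have : 0 ≤ r * ((p + E) * Δ') := by positivity
        nlinarith [mul_nonneg (add_nonneg hp' h2') (neg_nonneg.2 ha.le)]
    nlinarith
  · have h6 : p' * D ≤ p' * (Δ + κ * E) := by gcongr
    have h7 : p * D' ≤ p * (Δ' + κ * E') := by gcongr
    have h8 : 0 ≤ E' * Δ + E * Δ' + κ * (E * E') := by positivity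
    nlinarith

/-- The siblings below a node of nominal uncut probability `2W - W²`. -/
theorem good_prod {V : Type} {r W π₀ : ℝ} (s : Finset V) (hs : s.card ≤ 2) (P₁ P₀ m D : V → ℝ)
    (hr0 : 0 ≤ r) (hr1 : r < 1) (hW0 : 0 ≤ W) (hπ : 0 ≤ π₀) (hWπ : W ≤ 1 - π₀)
    (hWr : 1 - W ≤ r * (2 - W))
    (hgood : ∀ c ∈ s, Good r (P₁ c) (P₀ c) (1 - W * (1 + m c)) (D c))
    (hm : ∀ c ∈ s, 0 ≤ m c) (hWm : ∀ c ∈ s, W * (1 + m c) ≤ 1 - π₀) (hD : ∀ c ∈ s, 0 ≤ D c)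
    (hP : ∀ c ∈ s, 0 ≤ P₀ c) :
    Good r (∏ c ∈ s, P₁ c) (∏ c ∈ s, P₀ c) (1 - (2 * W - W ^ 2) * (1 + r * ∑ c ∈ s, m c))
      (π₀ * ∑ c ∈ s, D c) := by
  classical
  have hW1 : W ≤ 1 := by linarith
  have key : ∀ {P P' Q Q' n n' d d' : ℝ}, Good r P Q (1 - W * (1 + n)) d →
      Good r P' Q' (1 - W * (1 + n')) d' → 0 ≤ n → 0 ≤ n' → W * (1 + n) ≤ 1 - π₀ →
      W * (1 + n') ≤ 1 - π₀ → 0 ≤ d → 0 ≤ d' → 0 ≤ Q → 0 ≤ Q' →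
      Good r (P * P') (Q * Q') (1 - (2 * W - W ^ 2) * (1 + r * (n + n'))) (π₀ * (d + d')) := by
    intro P P' Q Q' n n' d d' h h' hn hn' hw hw' hd hd' hQ hQ'
    refine (h.mul h' hr0 hr1 (by linarith) (by linarith) hQ hQ').mono ?_ ?_
    -- Damping: W(1-W) ≤ r(2W - W²), so a relative loss at a child costs at most r times as much
    -- relative to the nominal value 2W - W² of the parent.
    · have h1 : W * ((n + n') * (1 - W)) ≤ W * ((n + n') * (r * (2 - W))) := by gcongr
      have h2 : 0 ≤ W ^ 2 * (n * n') := by positivity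
      nlinarith
    · have h1 : π₀ * d ≤ (1 - W * (1 + n')) * d := by gcongr; linarith
      have h2 : π₀ * d' ≤ (1 - W * (1 + n)) * d' := by gcongr; linarith
      linarith
  -- A missing child counts as a sibling that is cut for certain, without loss or difference.
  have hone : Good r 1 1 (1 - W * (1 + 0)) 0 := good_refl (by linarith)
  interval_cases h : s.card
  · obtain rfl := Finset.card_eq_zero.1 h
    simpa using key hone hone le_rfl le_rfl (by linarith) (by linarith) le_rfl le_rfl zero_le_one
      zero_le_one
  · obtain ⟨a, rfl⟩ := Finset.card_eq_one.1 h
    simp only [Finset.mem_singleton, forall_eq] at *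
    simpa using key hgood hone hm le_rfl hWm (by linarith) hD le_rfl hP zero_le_one
  · obtain ⟨a, b, hab, rfl⟩ := Finset.card_eq_two.1 h
    simp only [Finset.mem_insert, Finset.mem_singleton, forall_eq_or_imp, forall_eq] at *
    rw [Finset.prod_pair hab, Finset.prod_pair hab, Finset.sum_pair hab, Finset.sum_pair hab]
    exact key hgood.1 hgood.2 hm.1 hm.2 hWm.1 hWm.2 hD.1 hD.2 hP.1 hP.2

/-! ### The recursion along the tree -/

section Tree

variable {V : Type} [Fintype V] [DecidableEq V]

/-- The probability that the subtree of height `k` below a node is cut, if every node `p` is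
independently cut off with probability `ph p` and is not with probability `qh p`. -/
noncomputable def treeVal (sel : List V → Clause V) (ph qh : List V → ℝ) : ℕ → List V → ℝ
  | 0, _ => 0
  | k + 1, p => ∏ c ∈ childLabels sel p, (ph (c :: p) + qh (c :: p) * treeVal sel ph qh k (c :: p))

theorem treeVal_mem {sel : List V → Clause V} {ph qh : List V → ℝ}
    (h : ∀ c q, c ∈ childLabels sel q → 0 ≤ ph (c :: q) ∧ 0 ≤ qh (c :: q) ∧
      ph (c :: q) + qh (c :: q) ≤ 1) (k : ℕ) (p : List V) :
    0 ≤ treeVal sel ph qh k p ∧ treeVal sel ph qh k p ≤ 1 := by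
  induction k generalizing p with
  | zero => simp [treeVal]
  | succ k ih =>
    rw [treeVal]
    have h' : ∀ c ∈ childLabels sel p,
        0 ≤ ph (c :: p) + qh (c :: p) * treeVal sel ph qh k (c :: p) ∧
        ph (c :: p) + qh (c :: p) * treeVal sel ph qh k (c :: p) ≤ 1 := by
      intro c hc
      obtain ⟨h1, h2, h3⟩ := h c p hc
      obtain ⟨h4, h5⟩ := ih (c :: p)
      exact ⟨by positivity, by nlinarith⟩
    exact ⟨Finset.prod_nonneg fun c hc => (h' c hc).1,
      Finset.prod_le_one (fun c hc => (h' c hc).1) fun c hc => (h' c hc).2⟩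

end Tree

/-! ### Losses along the tree -/

section Loss

variable {V : Type} [Fintype V] [DecidableEq V]

/-- The relative loss at a node: a neighbour `x` of its label costs `σx`, another neighbour on the
path costs `σn`. -/
def nodeLoss (N : V → Finset V) (x : V) (σn σx : ℝ) : List V → ℝ
  | [] => 0
  | c :: q => ∑ b ∈ N c, if b = x then σx else if b ∈ q then σn else 0

/-- The discounted sum of the losses at the canonical nodes below a node. -/
noncomputable def lossSum (canon : V → Clause V) (sel : List V → Clause V) (two : Finset V)
    (r : ℝ) (σ : List V → ℝ) : ℕ → List V → ℝ
  | 0, _ => 0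
  | _ + 1, [] => 0
  | k + 1, a :: q => if sel (a :: q) = canon a then
      r * ∑ c ∈ (childLabels sel (a :: q)).filter (· ∉ two),
        (lossSum canon sel two r σ k (c :: a :: q) + 1.01 * σ (c :: a :: q))
      else 0

/-- An upper bound for `σ + L` at every node. -/
noncomputable def maxLoss (r σn σx : ℝ) : ℝ := 2.02 * σn / (1 - 2 * r) + 1.01 * σx / (1 - r)

/-- An upper bound for the loss below a node. -/
noncomputable def crudeLoss (N : V → Finset V) (x : V) (r σn σx : ℝ) (p : List V) : ℝ :=
  2 * r * (2.02 * σn) / (1 - 2 * r) +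
    ((N x).filter (· ∉ p)).card * (r * (1.01 * σx) / (1 - r))

/-- The hypotheses on the cut-off probabilities: `z` comes early (`true`) or late (`false`), labels
in `twoCC` have a relative gain `g`, and the other labels have the loss `nodeLoss`. -/
structure IsLossyTree (F : Finset (Clause V)) (canon : V → Clause V) (sel : List V → Clause V)
    (N : V → Finset V) (x z : V) (r σn σx g : ℝ) (ph qh : Bool → List V → ℝ) : Prop where
  unique : IsUnique3CNF F
  choice : IsCanonicalChoice F canon
  labelling : IsClauseLabelling F canon sel
  pos : 0 < r
  lt_half : r < 1 / 2
  symm : ∀ a b, b ∈ N a → a ∈ N b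
  card_le : ∀ a, (N a).card ≤ 2
  isolated : ∀ a, z ∉ N a
  not_two : z ∉ twoCC F
  lossN_nonneg : 0 ≤ σn
  lossX_nonneg : 0 ≤ σx
  maxLoss_le : maxLoss r σn σx ≤ 0.4 * r ^ 2
  maxLoss_small : 2 * r * maxLoss r σn σx ≤ 0.01
  le_gain : 2 * r * maxLoss r σn σx ≤ g
  gain_le : g ≤ 1
  early : ∀ q, ph true (z :: q) = 1 ∧ qh true (z :: q) = 0
  late : ∀ q, ph false (z :: q) = 0 ∧ qh false (z :: q) = 1
  same : ∀ c q, c ≠ z → ph true (c :: q) = ph false (c :: q) ∧ qh true (c :: q) = qh false (c :: q)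
  gain : ∀ i c q, c ∈ twoCC F → ph i (c :: q) = r + (1 - r) * g ∧ qh i (c :: q) = (1 - r) * (1 - g)
  ordinary : ∀ i c q, c ≠ z → c ∉ twoCC F → 0 ≤ ph i (c :: q) ∧ 1 - r ≤ qh i (c :: q) ∧
    ph i (c :: q) + qh i (c :: q) ≤ 1 ∧ ∀ q₀, 0 ≤ q₀ → q₀ ≤ 1 - limUncut r →
      1 - ph i (c :: q) - qh i (c :: q) * q₀ ≤
        (1 - r) * (1 - q₀) * (1 + nodeLoss N x σn σx (c :: q))

variable {F : Finset (Clause V)} {canon : V → Clause V} {sel : List V → Clause V}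
  {N : V → Finset V} {x z : V} {r σn σx g : ℝ} {ph qh : Bool → List V → ℝ}

theorem nodeLoss_nonneg (hn : 0 ≤ σn) (hx : 0 ≤ σx) (p : List V) : 0 ≤ nodeLoss N x σn σx p := by
  cases p with
  | nil => exact le_rfl
  | cons c q =>
    refine Finset.sum_nonneg fun b _ => ?_
    split_ifs <;> first | assumption | exact le_rfl

namespace IsLossyTree

theorem one_sub_pos (T : IsLossyTree F canon sel N x z r σn σx g ph qh) : 0 < 1 - r := by
  linarith [T.lt_half]

theorem one_sub_two_pos (T : IsLossyTree F canon sel N x z r σn σx g ph qh) : 0 < 1 - 2 * r := by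
  linarith [T.lt_half]

theorem maxLoss_nonneg (T : IsLossyTree F canon sel N x z r σn σx g ph qh) :
    0 ≤ maxLoss r σn σx := by
  have := T.one_sub_pos
  have := T.one_sub_two_pos
  have := T.lossN_nonneg
  have := T.lossX_nonneg
  unfold maxLoss
  positivity

theorem two_mul_r_mul_maxLoss (r σn σx : ℝ) : 2 * r * maxLoss r σn σx =
    2 * r * (2.02 * σn) / (1 - 2 * r) + 2 * (r * (1.01 * σx) / (1 - r)) := by
  unfold maxLoss
  ring

theorem crudeLoss_nonneg (T : IsLossyTree F canon sel N x z r σn σx g ph qh) (p : List V) :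
    0 ≤ crudeLoss N x r σn σx p := by
  have := T.one_sub_pos
  have := T.one_sub_two_pos
  have := T.lossN_nonneg
  have := T.lossX_nonneg
  have := T.pos
  unfold crudeLoss
  positivity

theorem crudeLoss_le (T : IsLossyTree F canon sel N x z r σn σx g ph qh) (p : List V) :
    crudeLoss N x r σn σx p ≤ 2 * r * maxLoss r σn σx := by
  have := T.one_sub_pos
  have := T.one_sub_two_pos
  have := T.lossN_nonneg
  have := T.lossX_nonneg
  have := T.pos
  rw [two_mul_r_mul_maxLoss, crudeLoss]
  gcongr
  exact_mod_cast (Finset.card_filter_le _ _).trans (T.card_le x)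

theorem nodeLoss_le (T : IsLossyTree F canon sel N x z r σn σx g ph qh) (c : V) (q : List V) :
    nodeLoss N x σn σx (c :: q) ≤ 2 * σn + if c ∈ N x then σx else 0 := by
  have hn := T.lossN_nonneg
  have hx := T.lossX_nonneg
  calc nodeLoss N x σn σx (c :: q)
      ≤ ∑ b ∈ N c, (σn + if b = x then σx else 0) := by
        refine Finset.sum_le_sum fun b _ => ?_
        split_ifs <;> linarith
    _ = (N c).card * σn + if x ∈ N c then σx else 0 := by
        rw [Finset.sum_add_distrib, Finset.sum_const, nsmul_eq_mul, Finset.sum_ite_eq']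
    _ ≤ 2 * σn + if x ∈ N c then σx else 0 := by
        gcongr
        exact_mod_cast T.card_le c
    _ ≤ _ := by
        have : x ∈ N c ↔ c ∈ N x := ⟨T.symm c x, T.symm x c⟩
        simp only [this, le_refl]

/-- The bound for the loss at and below a child. -/
theorem crudeLoss_cons_add_le (T : IsLossyTree F canon sel N x z r σn σx g ph qh) {c : V}
    {p : List V} (hc : c ∉ p) :
    crudeLoss N x r σn σx (c :: p) + 1.01 * nodeLoss N x σn σx (c :: p) ≤
      2 * r * (2.02 * σn) / (1 - 2 * r) + 2.02 * σn +
      ((N x).filter (· ∉ p)).card * (r * (1.01 * σx) / (1 - r)) +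
      if c ∈ N x then 1.01 * σx - r * (1.01 * σx) / (1 - r) else 0 := by
  have h1 := T.nodeLoss_le c p
  unfold crudeLoss
  have hcard : (N x).filter (· ∉ c :: p) = ((N x).filter (· ∉ p)).erase c := by
    ext b
    simp only [Finset.mem_filter, List.mem_cons, Finset.mem_erase]
    tauto
  rw [hcard]
  split_ifs with h
  · rw [if_pos h] at h1
    have hm : c ∈ (N x).filter (· ∉ p) := Finset.mem_filter.2 ⟨h, hc⟩
    have h2 := Finset.card_erase_add_one hm
    have h3 : ((((N x).filter (· ∉ p)).erase c).card : ℝ) =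
        ((N x).filter (· ∉ p)).card - 1 := by
      rw [← h2]; push_cast; ring
    rw [h3]
    linarith
  · rw [if_neg h] at h1
    rw [Finset.erase_eq_of_notMem (by simp [h])]
    linarith

theorem crudeLoss_cons_add_le_maxLoss (T : IsLossyTree F canon sel N x z r σn σx g ph qh) {c : V}
    {p : List V} (hc : c ∉ p) :
    crudeLoss N x r σn σx (c :: p) + 1.01 * nodeLoss N x σn σx (c :: p) ≤ maxLoss r σn σx := by
  have h1 := T.one_sub_pos
  have h2 := T.one_sub_two_pos
  have hn := T.lossN_nonneg
  have hx := T.lossX_nonneg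
  have hr := T.pos
  refine (T.crudeLoss_cons_add_le hc).trans ?_
  set j := ((N x).filter (· ∉ p)).card with hj
  have hj2 : j ≤ 2 := (Finset.card_filter_le _ _).trans (T.card_le x)
  have e1 : 2 * r * (2.02 * σn) / (1 - 2 * r) + 2.02 * σn = 2.02 * σn / (1 - 2 * r) := by
    field_simp; ring
  have e2 : 1.01 * σx + r * (1.01 * σx) / (1 - r) = 1.01 * σx / (1 - r) := by
    field_simp; ring
  have e3 : 0 ≤ r * (1.01 * σx) / (1 - r) := by positivity
  have e4 : r * (1.01 * σx) / (1 - r) ≤ 1.01 * σx := by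
    rw [div_le_iff₀ h1]
    nlinarith [T.lt_half]
  unfold maxLoss
  rw [e1, ← e2]
  split_ifs with h
  · have : (j : ℝ) * (r * (1.01 * σx) / (1 - r)) ≤ 2 * (r * (1.01 * σx) / (1 - r)) := by
      gcongr; exact_mod_cast hj2
    linarith
  · have : (j : ℝ) * (r * (1.01 * σx) / (1 - r)) ≤ 2 * (r * (1.01 * σx) / (1 - r)) := by
      gcongr; exact_mod_cast hj2
    linarith

/-- `crudeLoss` is a supersolution of the recursion for losses. Neighbours on the path cost at most
2.02 σn at each of at most two children, a geometric series in 2r. A neighbour of `x` occurs at most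
once on a path, so in the worst case it gives one node on every level, a geometric series in r. -/
theorem sum_crudeLoss_le (T : IsLossyTree F canon sel N x z r σn σx g ph qh) {p : List V}
    (hp : p ≠ []) :
    r * ∑ c ∈ childLabels sel p,
      (crudeLoss N x r σn σx (c :: p) + 1.01 * nodeLoss N x σn σx (c :: p)) ≤
      crudeLoss N x r σn σx p := by
  have h1 := T.one_sub_pos
  have h2 := T.one_sub_two_pos
  have hn := T.lossN_nonneg
  have hx := T.lossX_nonneg
  have hr := T.pos
  set j := ((N x).filter (· ∉ p)).card with hj
  set Kx := r * (1.01 * σx) / (1 - r) with hKx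
  have hKx0 : 0 ≤ Kx := by positivity
  have hKx' : r * (1.01 * σx) = (1 - r) * Kx := by rw [hKx]; field_simp
  set Kn := 2 * r * (2.02 * σn) / (1 - 2 * r) with hKn
  have hKn0 : 0 ≤ Kn := by positivity
  have hKn' : 2 * r * (2.02 * σn) = (1 - 2 * r) * Kn := by rw [hKn]; field_simp
  have hle : ∑ c ∈ childLabels sel p,
      (crudeLoss N x r σn σx (c :: p) + 1.01 * nodeLoss N x σn σx (c :: p)) ≤
      ∑ c ∈ childLabels sel p, ((Kn + 2.02 * σn + j * Kx) +
        if c ∈ N x then 1.01 * σx - Kx else 0) :=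
    Finset.sum_le_sum fun c hc =>
      T.crudeLoss_cons_add_le (T.labelling.not_mem_of_mem_childLabels hp hc)
  rw [Finset.sum_add_distrib (f := fun _ => Kn + 2.02 * σn + j * Kx), Finset.sum_const,
    nsmul_eq_mul, ← Finset.sum_filter, Finset.sum_const, nsmul_eq_mul] at hle
  set i := ((childLabels sel p).filter (· ∈ N x)).card with hi
  have hij : i ≤ j := by
    refine Finset.card_le_card fun c hc => ?_
    obtain ⟨hc1, hc2⟩ := Finset.mem_filter.1 hc
    exact Finset.mem_filter.2 ⟨hc2, T.labelling.not_mem_of_mem_childLabels hp hc1⟩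
  have hc2 : ((childLabels sel p).card : ℝ) * (Kn + 2.02 * σn + j * Kx) ≤
      2 * (Kn + 2.02 * σn + j * Kx) := by
    refine mul_le_mul_of_nonneg_right ?_ (add_nonneg (add_nonneg hKn0 (by linarith))
      (mul_nonneg (Nat.cast_nonneg _) hKx0))
    exact Nat.cast_le_ofNat.2 (T.labelling.card_childLabels_le T.unique hp)
  have hij' : (i : ℝ) ≤ j := Nat.cast_le.2 hij
  calc _ ≤ r * (2 * (Kn + 2.02 * σn + j * Kx) + i * (1.01 * σx - Kx)) :=
        mul_le_mul_of_nonneg_left (by linarith) hr.le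
    _ = Kn + 2 * r * j * Kx + i * ((1 - 2 * r) * Kx) := by
        linear_combination hKn' + i * hKx'
    _ ≤ Kn + 2 * r * j * Kx + j * ((1 - 2 * r) * Kx) := by
        have := mul_le_mul_of_nonneg_right hij' (mul_nonneg h2.le hKx0)
        linarith
    _ = _ := by rw [crudeLoss]; ring

theorem lossSum_mem (T : IsLossyTree F canon sel N x z r σn σx g ph qh) (two : Finset V) (k : ℕ)
    (p : List V) :
    0 ≤ lossSum canon sel two r (nodeLoss N x σn σx) k p ∧
      lossSum canon sel two r (nodeLoss N x σn σx) k p ≤ crudeLoss N x r σn σx p := by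
  have hr := T.pos
  induction k generalizing p with
  | zero => exact ⟨le_rfl, T.crudeLoss_nonneg p⟩
  | succ k ih =>
    cases p with
    | nil => exact ⟨le_rfl, T.crudeLoss_nonneg _⟩
    | cons a q =>
      rw [lossSum]
      split_ifs
      · constructor
        · refine mul_nonneg hr.le (Finset.sum_nonneg fun c _ => ?_)
          have := (ih (c :: a :: q)).1
          have := nodeLoss_nonneg (N := N) (x := x) T.lossN_nonneg T.lossX_nonneg (c :: a :: q)
          linarith
        · refine le_trans ?_ (T.sum_crudeLoss_le (p := a :: q) (by simp))
          refine mul_le_mul_of_nonneg_left ?_ hr.le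
          calc _ ≤ ∑ c ∈ (childLabels sel (a :: q)).filter (· ∉ two),
                (crudeLoss N x r σn σx (c :: a :: q) + 1.01 * nodeLoss N x σn σx (c :: a :: q)) :=
                Finset.sum_le_sum fun c _ => by linarith [(ih (c :: a :: q)).2]
            _ ≤ _ := by
                refine Finset.sum_le_sum_of_subset_of_nonneg (Finset.filter_subset _ _) ?_
                intro c _ _
                have := nodeLoss_nonneg (N := N) (x := x) T.lossN_nonneg T.lossX_nonneg
                  (c :: a :: q)
                have := T.crudeLoss_nonneg (c :: a :: q)
                linarith
      · exact ⟨le_rfl, T.crudeLoss_nonneg _⟩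

theorem treeVal_mem' (T : IsLossyTree F canon sel N x z r σn σx g ph qh) (i : Bool) (k : ℕ)
    (p : List V) :
    0 ≤ treeVal sel (ph i) (qh i) k p ∧ treeVal sel (ph i) (qh i) k p ≤ 1 := by
  have h1 := T.one_sub_pos
  refine treeVal_mem (fun c q _ => ?_) k p
  by_cases hz : c = z
  · subst hz
    cases i
    · rw [(T.late q).1, (T.late q).2]; norm_num
    · rw [(T.early q).1, (T.early q).2]; norm_num
  · by_cases h2 : c ∈ twoCC F
    · obtain ⟨e1, e2⟩ := T.gain i c q h2
      have hg0 : 0 ≤ g := le_trans (mul_nonneg (by linarith [T.pos]) T.maxLoss_nonneg) T.le_gain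
      have := T.gain_le
      have := T.pos
      rw [e1, e2]
      exact ⟨by positivity, mul_nonneg h1.le (by linarith), by linarith⟩
    · obtain ⟨e1, e2, e3, -⟩ := T.ordinary i c q hz h2
      exact ⟨e1, by linarith, e3⟩

theorem nodeVal_nonneg (T : IsLossyTree F canon sel N x z r σn σx g ph qh) (i : Bool) (k : ℕ)
    (c : V) (p : List V) :
    0 ≤ ph i (c :: p) + qh i (c :: p) * treeVal sel (ph i) (qh i) k (c :: p) := by
  have h1 := T.one_sub_pos
  have hT := (T.treeVal_mem' i k (c :: p)).1
  by_cases hz : c = z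
  · subst hz
    cases i
    · rw [(T.late p).1, (T.late p).2]; simpa using hT
    · rw [(T.early p).1, (T.early p).2]; norm_num
  · by_cases h2 : c ∈ twoCC F
    · obtain ⟨e1, e2⟩ := T.gain i c p h2
      have hg0 : 0 ≤ g := le_trans (mul_nonneg (by linarith [T.pos]) T.maxLoss_nonneg) T.le_gain
      have := T.gain_le
      have := T.pos
      rw [e1, e2]
      have : 0 ≤ 1 - g := by linarith
      positivity
    · obtain ⟨e1, e2, e3, -⟩ := T.ordinary i c p hz h2
      have : 0 ≤ qh i (c :: p) := by linarith
      positivity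

theorem treeVal_eq_of_mem (T : IsLossyTree F canon sel N x z r σn σx g ph qh) (k : ℕ)
    {p : List V} (hz : z ∈ p) :
    treeVal sel (ph true) (qh true) k p = treeVal sel (ph false) (qh false) k p := by
  induction k generalizing p with
  | zero => rfl
  | succ k ih =>
    refine Finset.prod_congr rfl fun c hc => ?_
    have hcz : c ≠ z := by
      rintro rfl
      exact T.labelling.not_mem_of_mem_childLabels (List.ne_nil_of_mem hz) hc hz
    rw [(T.same c p hcz).1, (T.same c p hcz).2, ih (List.mem_cons_of_mem _ hz)]

/-- For W = (1-r) `limUncut r` one has 1 - W = r/(1-r) and 2 - W = 1/(1-r), so (1-W)/(2-W) is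
exactly r. This quotient decreases in W, and `nomUncut` stays above its limit. -/
theorem one_sub_nomUncut_le (T : IsLossyTree F canon sel N x z r σn σx g ph qh) (k : ℕ) :
    1 - (1 - r) * nomUncut r k ≤ r * (2 - (1 - r) * nomUncut r k) := by
  have h := limUncut_le_nomUncut T.pos.le T.lt_half.le k
  have h1 := T.one_sub_pos
  have hp := one_sub_mul_limUncut (by linarith : r < 1)
  have h2 : (1 - r) * limUncut r ≤ (1 - r) * nomUncut r k := by gcongr
  have h3 : (1 - (1 - r) * nomUncut r k) * (1 - r) ≤ r := by
    rw [← le_div_iff₀ h1]; linarith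
  linarith

/-- The step from a node to the edge that leads to it. -/
theorem good_child (T : IsLossyTree F canon sel N x z r σn σx g ph qh) {k : ℕ} {c : V}
    {p : List V} {L D : ℝ} (hc : c ∉ twoCC F) (hL0 : 0 ≤ L) (hL : L ≤ 2 * r * maxLoss r σn σx)
    (hU : nomUncut r k * (1 + L) ≤ 1) (hD0 : 0 ≤ D)
    (h : Good r (treeVal sel (ph true) (qh true) k (c :: p))
      (treeVal sel (ph false) (qh false) k (c :: p)) (1 - nomUncut r k * (1 + L)) D) :
    Good r (ph true (c :: p) + qh true (c :: p) * treeVal sel (ph true) (qh true) k (c :: p))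
      (ph false (c :: p) + qh false (c :: p) * treeVal sel (ph false) (qh false) k (c :: p))
      (1 - (1 - r) * nomUncut r k * (1 + (L + 1.01 * nodeLoss N x σn σx (c :: p))))
      (if c = z then limUncut r else (1 - r) * D) := by
  have h1 := T.one_sub_pos
  have hlim := limUncut_le_nomUncut T.pos.le T.lt_half.le k
  have hlim0 := limUncut_nonneg T.lt_half.le
  have hU0 : 0 ≤ nomUncut r k := hlim0.trans hlim
  have hσ := nodeLoss_nonneg (N := N) (x := x) T.lossN_nonneg T.lossX_nonneg (c :: p)
  have hUL : nomUncut r k ≤ nomUncut r k * (1 + L) := by nlinarith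
  by_cases hz : c = z
  · subst hz
    rw [if_pos rfl, (T.early p).1, (T.early p).2, (T.late p).1, (T.late p).2]
    -- Once `z` is on the path it does not recur, so below this node the values for `z` early and
    -- `z` late agree.
    have he := T.treeVal_eq_of_mem k (p := c :: p) (by simp)
    rw [he] at h
    have hq := h.le_of_eq (by linarith)
    rw [zero_mul, add_zero, zero_add, one_mul]
    refine (good_early hq (by linarith)).mono ?_ (by linarith)
    have : (1 - r) * nomUncut r k * (1 + L) ≤ (1 - r) * nomUncut r k *
        (1 + (L + 1.01 * nodeLoss N x σn σx (c :: p))) := by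
      gcongr; linarith
    linarith
  · rw [if_neg hz]
    obtain ⟨e1, e2, e3, e4⟩ := T.ordinary true c p hz hc
    rw [← (T.same c p hz).1, ← (T.same c p hz).2]
    refine (h.affine (p := ph true (c :: p)) (by linarith : 0 ≤ qh true (c :: p))).mono ?_
      (by gcongr)
    have h4 := e4 (1 - nomUncut r k * (1 + L)) (by linarith) (by linarith)
    -- Origin of the factor 1.01: as L ≤ 0.01, the product of the two losses is absorbed by a
    -- hundredth of the loss at the node.
    have h5 : L * nodeLoss N x σn σx (c :: p) ≤ 0.01 * nodeLoss N x σn σx (c :: p) := by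
      gcongr; exact hL.trans T.maxLoss_small
    have h6 : (1 - r) * nomUncut r k * ((1 + L) * (1 + nodeLoss N x σn σx (c :: p))) ≤
        (1 - r) * nomUncut r k * (1 + (L + 1.01 * nodeLoss N x σn σx (c :: p))) := by
      gcongr; linarith
    nlinarith

/-- Labels with two critical clauses have no loss. -/
theorem good_child_two (T : IsLossyTree F canon sel N x z r σn σx g ph qh) {k : ℕ} {c : V}
    {p : List V} {L : ℝ} (hc : c ∈ twoCC F) (hL : L ≤ 2 * r * maxLoss r σn σx)
    (h : Good r (treeVal sel (ph true) (qh true) k (c :: p))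
      (treeVal sel (ph false) (qh false) k (c :: p)) (1 - nomUncut r k * (1 + L)) 0) :
    Good r (ph true (c :: p) + qh true (c :: p) * treeVal sel (ph true) (qh true) k (c :: p))
      (ph false (c :: p) + qh false (c :: p) * treeVal sel (ph false) (qh false) k (c :: p))
      (1 - (1 - r) * nomUncut r k) 0 := by
  have h1 := T.one_sub_pos
  have hU0 := (nomUncut_mem T.pos.le (by linarith [T.lt_half]) k).1
  have hg := T.gain_le
  obtain ⟨e1, e2⟩ := T.gain true c p hc
  obtain ⟨e3, e4⟩ := T.gain false c p hc
  have hL' := hL.trans T.le_gain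
  have hg0 : 0 ≤ g := le_trans (mul_nonneg (by linarith [T.pos]) T.maxLoss_nonneg) T.le_gain
  rw [e1, e2, e3, e4]
  refine (h.affine (mul_nonneg h1.le (by linarith))).mono ?_ (by simp)
  -- The relative gain at a label in `twoCC` pays for all losses below it.
  have : (1 - g) * (1 + L) ≤ 1 := by nlinarith
  have : (1 - r) * nomUncut r k * ((1 - g) * (1 + L)) ≤ (1 - r) * nomUncut r k * 1 := by gcongr
  linarith

/-- A tree of positive height has U ≤ 1 - r², and (1 - r²)(1 + 0.4 r²) ≤ 1. This is the purpose of
the bound 0.4 r² on the losses. -/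
theorem nomUncut_mul_le_one (T : IsLossyTree F canon sel N x z r σn σx g ph qh) {k : ℕ}
    (hk : 1 ≤ k) {L : ℝ} (hL : L ≤ 2 * r * maxLoss r σn σx) : nomUncut r k * (1 + L) ≤ 1 := by
  have hr := T.pos
  have h2 := T.lt_half
  have hU0 := (nomUncut_mem hr.le (by linarith) k).1
  have hU := nomUncut_one_le hr.le (by linarith) hk
  have hL2 : L ≤ 0.4 * r ^ 2 := by
    have := T.maxLoss_le
    have := T.maxLoss_nonneg
    nlinarith
  calc nomUncut r k * (1 + L) ≤ nomUncut r k * (1 + 0.4 * r ^ 2) := by gcongr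
    _ ≤ (1 - r ^ 2) * (1 + 0.4 * r ^ 2) := by gcongr
    _ ≤ 1 := by nlinarith [sq_nonneg (r ^ 2), sq_nonneg r]

theorem nodeUncut_le (T : IsLossyTree F canon sel N x z r σn σx g ph qh) (k : ℕ) {m : ℝ}
    (hm : m ≤ maxLoss r σn σx) : (1 - r) * nomUncut r k * (1 + m) ≤ 1 := by
  have hr := T.pos
  have h2 := T.lt_half
  have h1 := T.one_sub_pos
  have hU := nomUncut_mem hr.le (by linarith) k
  have := T.maxLoss_le
  calc (1 - r) * nomUncut r k * (1 + m) ≤ (1 - r) * nomUncut r k * (1 + 0.4 * r ^ 2) := by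
        have := hU.1
        gcongr
        linarith
    _ ≤ (1 - r) * 1 * (1 + 0.4 * r ^ 2) := by
        have := hU.2
        gcongr
    _ ≤ 1 := by nlinarith

theorem nodeUncut_succ (k : ℕ) : nomUncut r (k + 1) =
    2 * ((1 - r) * nomUncut r k) - ((1 - r) * nomUncut r k) ^ 2 := by
  rw [nomUncut]; ring

/-- The bound for arbitrary nodes. -/
theorem good_crude (T : IsLossyTree F canon sel N x z r σn σx g ph qh) (k : ℕ) {p : List V}
    (hp : p ≠ []) : ∃ L, 0 ≤ L ∧ L ≤ crudeLoss N x r σn σx p ∧ nomUncut r k * (1 + L) ≤ 1 ∧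
      Good r (treeVal sel (ph true) (qh true) k p) (treeVal sel (ph false) (qh false) k p)
        (1 - nomUncut r k * (1 + L)) 0 := by
  have hr := T.pos
  have hlt := T.lt_half
  have h1 := T.one_sub_pos
  induction k generalizing p with
  | zero =>
    refine ⟨0, le_rfl, T.crudeLoss_nonneg p, by simp [nomUncut], good_refl (by simp [nomUncut, treeVal])⟩
  | succ k ih =>
    have hU := nomUncut_mem hr.le (by linarith) k
    have hc : ∀ c ∈ childLabels sel p, ∃ m, 0 ≤ m ∧
        m ≤ crudeLoss N x r σn σx (c :: p) + 1.01 * nodeLoss N x σn σx (c :: p) ∧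
        Good r (ph true (c :: p) + qh true (c :: p) * treeVal sel (ph true) (qh true) k (c :: p))
          (ph false (c :: p) + qh false (c :: p) * treeVal sel (ph false) (qh false) k (c :: p))
          (1 - (1 - r) * nomUncut r k * (1 + m)) 0 := by
      intro c _
      obtain ⟨L, hL0, hL, hUL, hg⟩ := ih (p := c :: p) (by simp)
      have hσ := nodeLoss_nonneg (N := N) (x := x) T.lossN_nonneg T.lossX_nonneg (c :: p)
      by_cases h2 : c ∈ twoCC F
      · refine ⟨0, le_rfl, by linarith, ?_⟩
        simpa using T.good_child_two h2 (hL.trans (T.crudeLoss_le _)) hg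
      · refine ⟨L + 1.01 * nodeLoss N x σn σx (c :: p), by linarith, by linarith, ?_⟩
        refine (T.good_child h2 hL0 (hL.trans (T.crudeLoss_le _)) hUL le_rfl hg).mono le_rfl ?_
        split_ifs
        · exact limUncut_nonneg hlt.le
        · simp
    choose! m hm0 hm hg using hc
    have hsum : r * ∑ c ∈ childLabels sel p, m c ≤ crudeLoss N x r σn σx p := by
      refine le_trans ?_ (T.sum_crudeLoss_le hp)
      gcongr with c hc
      exact hm c hc
    have hsum0 : 0 ≤ r * ∑ c ∈ childLabels sel p, m c :=
      mul_nonneg hr.le (Finset.sum_nonneg hm0)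
    refine ⟨_, hsum0, hsum, T.nomUncut_mul_le_one (by omega) (hsum.trans (T.crudeLoss_le p)), ?_⟩
    rw [nodeUncut_succ]
    have := good_prod (r := r) (W := (1 - r) * nomUncut r k) (π₀ := 0) (childLabels sel p)
      (T.labelling.card_childLabels_le T.unique hp) _ _ m 0 hr.le (by linarith)
      (mul_nonneg h1.le hU.1) le_rfl (by nlinarith) (T.one_sub_nomUncut_le k) hg hm0
      (fun c hc => by
        rw [sub_zero]
        exact T.nodeUncut_le k ((hm c hc).trans (T.crudeLoss_cons_add_le_maxLoss
          (T.labelling.not_mem_of_mem_childLabels hp hc))))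
      (fun _ _ => le_rfl) (fun c _ => T.nodeVal_nonneg false k c p)
    simpa [treeVal] using this

end IsLossyTree

end Loss

/-! ### Canonical nodes, the density of z below y, and the bound at the root. -/

section Canonical

variable {V : Type} [Fintype V] [DecidableEq V]
  {F : Finset (Clause V)} {canon : V → Clause V} {sel : List V → Clause V}
  {N : V → Finset V} {x z : V} {r σn σx g : ℝ} {ph qh : Bool → List V → ℝ}

/-- A surplus of the average may be booked as a difference. The rate (1 + r/2)/(1-r) is chosen so
that the root can honour it (`root_arith`). -/
theorem Good.surplus {r Q₁ Q₀ q D q' E' : ℝ} (h : Good r Q₁ Q₀ q D) (hE : 0 ≤ E')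
    (hq : q' + E' ≤ q) : Good r Q₁ Q₀ q' (D + (1 + r / 2) / (1 - r) * E') := by
  obtain ⟨Δ, E, h1, h2, h3, h4, h5⟩ := h
  exact ⟨Δ, E + E', h1, by linarith, by linarith, by linarith, by linarith⟩

/-- The root has exactly the children y and z. If z is early, only the branch of y matters; if z is
late, both branches must be cut. In the average of the two cases, Δ appears with coefficient r(1-r)
times the uncut probability of the late branch z. With Δ at least `limUncut r` times A and the uncut
probability at least `limUncut r`, this is the weight in the label density. -/
theorem root_arith {r U my Λz P1 P0 Q0 Δ E A : ℝ} (hr : 0 < r) (hlt : r < 1 / 2)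
    (hU0 : 0 ≤ U) (hlim : limUncut r ≤ U) (hWr : 1 - (1 - r) * U ≤ r * (2 - (1 - r) * U))
    (hmy : 0 ≤ my) (hΛz : 0 ≤ Λz) (hUz : U * (1 + Λz) ≤ 1)
    (hUzr : U * (1 + Λz) * (1 + r ^ 2 / 2) ≤ 1) (hP0n : 0 ≤ P0) (hqz : 1 - U * (1 + Λz) ≤ Q0)
    (hA0 : 0 ≤ limUncut r / (1 - r) * A) (hE : 0 ≤ E)
    (h3 : 1 - (1 - r) * U * (1 + my) + E + (1 - r) * Δ ≤ P1)
    (h4 : 1 - (1 - r) * U * (1 + my) + E - r * Δ ≤ P0)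
    (h5 : (1 - r) * (limUncut r / (1 - r) * A) ≤ Δ + (1 + r / 2) / (1 - r) * E) :
    1 - (2 * ((1 - r) * U) - ((1 - r) * U) ^ 2) * (1 + r * (my + Λz)) +
      (1 - 2 * r) ^ 2 / (1 - r) ^ 3 * r * A ≤ r * P1 + (1 - r) * (P0 * Q0) := by
  have h1 : 0 < 1 - r := by linarith
  have hlim0 := limUncut_nonneg hlt.le
  have hpz : 0 ≤ 1 - U * (1 + Λz) := by linarith
  generalize hW : (1 - r) * U = W at *
  have hW0 : 0 ≤ W := hW ▸ mul_nonneg h1.le hU0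
  have s1 : (1 - r) * (P0 * (1 - U * (1 + Λz))) ≤ (1 - r) * (P0 * Q0) := by gcongr
  have s2 : (1 - W * (1 + my) + E - r * Δ) * (1 - U * (1 + Λz)) ≤ P0 * (1 - U * (1 + Λz)) :=
    mul_le_mul_of_nonneg_right h4 hpz
  have s2' := mul_le_mul_of_nonneg_left s2 h1.le
  have s3 := mul_le_mul_of_nonneg_left h3 hr.le
  have s4 : 1 - (2 * W - W ^ 2) * (1 + r * (my + Λz)) ≤
      (1 - W * (1 + my)) * (1 - W * (1 + Λz)) := by
    have h1' : W * ((my + Λz) * (1 - W)) ≤ W * ((my + Λz) * (r * (2 - W))) := by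
      have := hmy
      have := hΛz
      gcongr
    have h2' : 0 ≤ W ^ 2 * (my * Λz) := by
      have := hmy
      have := hΛz
      positivity
    nlinarith
  -- Solvency of the exchange rate for E: with U' = U(1+Λz) the claim is (1-r)U' + r(1 + r/2)U' =
  -- U'(1 + r²/2) ≤ 1.
  have s5 : r * (1 + r / 2) * (U * (1 + Λz)) * E ≤ (1 - W * (1 + Λz)) * E := by
    refine mul_le_mul_of_nonneg_right ?_ hE
    rw [← hW]
    nlinarith
  have s6 : r * (1 - r) * limUncut r * (limUncut r * A) ≤
      r * (1 - r) * (U * (1 + Λz)) * (Δ + (1 + r / 2) / (1 - r) * E) := by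
    have hl2 : limUncut r ≤ U * (1 + Λz) := by nlinarith [hΛz]
    have h5' : limUncut r * A ≤ Δ + (1 + r / 2) / (1 - r) * E := by
      refine le_trans (le_of_eq ?_) h5
      field_simp
    have h6 : 0 ≤ limUncut r * A := by
      have : limUncut r * A = (1 - r) * (limUncut r / (1 - r) * A) := by field_simp
      rw [this]
      exact mul_nonneg h1.le hA0
    exact mul_le_mul (mul_le_mul_of_nonneg_left hl2 (by positivity)) h5' h6
      (mul_nonneg (by positivity) (hlim0.trans hl2))
  have s7 : (1 - 2 * r) ^ 2 / (1 - r) ^ 3 * r * A = r * (1 - r) * limUncut r * (limUncut r * A) := by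
    unfold limUncut
    field_simp
  have s8 : r * (1 - r) * (U * (1 + Λz)) * (Δ + (1 + r / 2) / (1 - r) * E) =
      r * (1 - r) * (U * (1 + Λz)) * Δ + r * (1 + r / 2) * (U * (1 + Λz)) * E := by
    field_simp
  rw [s7]
  have s9 : r * (1 - W * (1 + my) + E + (1 - r) * Δ) + (1 - r) *
      ((1 - W * (1 + my) + E - r * Δ) * (1 - U * (1 + Λz))) =
      (1 - W * (1 + my)) * (1 - W * (1 + Λz)) + (1 - W * (1 + Λz)) * E +
        r * (1 - r) * (U * (1 + Λz)) * Δ := by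
    rw [← hW]; ring
  linarith

namespace IsLossyTree

theorem crudeLoss_le_sq (T : IsLossyTree F canon sel N x z r σn σx g ph qh) (p : List V) :
    crudeLoss N x r σn σx p ≤ 0.4 * r ^ 2 := by
  have := T.crudeLoss_le p
  have := T.maxLoss_le
  have := T.maxLoss_nonneg
  nlinarith [T.lt_half]

/-- The loss at a child of a canonical node. -/
theorem childLoss_mem (T : IsLossyTree F canon sel N x z r σn σx g ph qh) (k : ℕ) {c : V}
    {p : List V} (hc : c ∉ p) :
    0 ≤ lossSum canon sel (twoCC F) r (nodeLoss N x σn σx) k (c :: p) +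
        1.01 * nodeLoss N x σn σx (c :: p) ∧
      lossSum canon sel (twoCC F) r (nodeLoss N x σn σx) k (c :: p) +
        1.01 * nodeLoss N x σn σx (c :: p) ≤ maxLoss r σn σx := by
  have h1 := T.lossSum_mem (twoCC F) k (c :: p)
  have h2 := T.crudeLoss_cons_add_le_maxLoss hc
  have h3 := nodeLoss_nonneg (N := N) (x := x) T.lossN_nonneg T.lossX_nonneg (c :: p)
  constructor <;> linarith

theorem nomUncut_mul_lossSum_le_one (T : IsLossyTree F canon sel N x z r σn σx g ph qh) (k : ℕ)
    (p : List V) :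
    nomUncut r k * (1 + lossSum canon sel (twoCC F) r (nodeLoss N x σn σx) k p) ≤ 1 := by
  rcases Nat.eq_zero_or_pos k with rfl | hk
  · simp [nomUncut, lossSum]
  · exact T.nomUncut_mul_le_one hk ((T.lossSum_mem _ k p).2.trans (T.crudeLoss_le p))

/-- A product over at most one child. -/
theorem good_single (T : IsLossyTree F canon sel N x z r σn σx g ph qh) (k : ℕ) {p : List V}
    (hp : p ≠ []) (hcard : (childLabels sel p).card ≤ 1) :
    Good r (treeVal sel (ph true) (qh true) (k + 1) p)
      (treeVal sel (ph false) (qh false) (k + 1) p)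
      (1 - (1 - r) * nomUncut r k * (1 + 0.4 * r ^ 2)) 0 := by
  have hr := T.pos
  have h1 := T.one_sub_pos
  have hU := nomUncut_mem hr.le (by linarith : r ≤ 1) k
  have hW : 0 ≤ (1 - r) * nomUncut r k := mul_nonneg h1.le hU.1
  have hW' : 0 ≤ (1 - r) * nomUncut r k * (0.4 * r ^ 2) := by positivity
  interval_cases hs : (childLabels sel p).card
  · rw [Finset.card_eq_zero] at hs
    simp only [treeVal, hs, Finset.prod_empty]
    exact good_refl (by nlinarith)
  · obtain ⟨c, hc⟩ := Finset.card_eq_one.1 hs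
    have hcp : c ∉ p := T.labelling.not_mem_of_mem_childLabels hp (by rw [hc]; simp)
    simp only [treeVal, hc, Finset.prod_singleton]
    obtain ⟨L, hL0, hL, hUL, hg⟩ := T.good_crude k (p := c :: p) (by simp)
    have hL' := hL.trans (T.crudeLoss_le _)
    by_cases h2 : c ∈ twoCC F
    · exact (T.good_child_two h2 hL' hg).mono (by linarith) le_rfl
    · refine (T.good_child h2 hL0 hL' hUL le_rfl hg).mono ?_ ?_
      · have h3 := T.crudeLoss_cons_add_le_maxLoss hcp
        have h4 := T.maxLoss_le
        have h5 : (1 - r) * nomUncut r k * (1 + (L + 1.01 * nodeLoss N x σn σx (c :: p))) ≤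
            (1 - r) * nomUncut r k * (1 + 0.4 * r ^ 2) := by
          refine mul_le_mul_of_nonneg_left ?_ hW
          linarith
        linarith
      · split_ifs
        · exact limUncut_nonneg T.lt_half.le
        · simp

open Classical in
/-- The step at a canonical node whose clause label is canonical. -/
theorem good_canon_step (T : IsLossyTree F canon sel N x z r σn σx g ph qh) (k : ℕ) {a : V}
    {q : List V} (hsel : sel (a :: q) = canon a) {π₀ : ℝ} (hπ : 0 ≤ π₀)
    (hWπ : (1 - r) * nomUncut r k * (1 + maxLoss r σn σx) ≤ 1 - π₀) (D : V → ℝ)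
    (hD : ∀ c, 0 ≤ D c)
    (h : ∀ c ∈ (childLabels sel (a :: q)).filter (· ∉ twoCC F),
      Good r (treeVal sel (ph true) (qh true) k (c :: a :: q))
        (treeVal sel (ph false) (qh false) k (c :: a :: q))
        (1 - nomUncut r k *
          (1 + lossSum canon sel (twoCC F) r (nodeLoss N x σn σx) k (c :: a :: q))) (D c)) :
    Good r (treeVal sel (ph true) (qh true) (k + 1) (a :: q))
      (treeVal sel (ph false) (qh false) (k + 1) (a :: q))
      (1 - nomUncut r (k + 1) *
        (1 + lossSum canon sel (twoCC F) r (nodeLoss N x σn σx) (k + 1) (a :: q)))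
      (π₀ * ∑ c ∈ (childLabels sel (a :: q)).filter (· ∉ twoCC F),
        if c = z then limUncut r else (1 - r) * D c) := by
  have hr := T.pos
  have hlt := T.lt_half
  have h1 := T.one_sub_pos
  have hU := nomUncut_mem hr.le (by linarith) k
  have hW : 0 ≤ (1 - r) * nomUncut r k := mul_nonneg h1.le hU.1
  have hmax := T.maxLoss_nonneg
  set m : V → ℝ := fun c => if c ∉ twoCC F then
    lossSum canon sel (twoCC F) r (nodeLoss N x σn σx) k (c :: a :: q) +
      1.01 * nodeLoss N x σn σx (c :: a :: q) else 0 with hm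
  set D' : V → ℝ := fun c => if c ∉ twoCC F then
    if c = z then limUncut r else (1 - r) * D c else 0 with hD'
  have hmm : ∀ c ∈ childLabels sel (a :: q), 0 ≤ m c ∧ m c ≤ maxLoss r σn σx := by
    intro c hc
    simp only [hm]
    split_ifs
    · exact ⟨le_rfl, hmax⟩
    · exact T.childLoss_mem k (T.labelling.not_mem_of_mem_childLabels (by simp) hc)
  have := good_prod (r := r) (W := (1 - r) * nomUncut r k) (π₀ := π₀) (childLabels sel (a :: q))
      (T.labelling.card_childLabels_le T.unique (by simp))
      (fun c => ph true (c :: a :: q) + qh true (c :: a :: q) *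
        treeVal sel (ph true) (qh true) k (c :: a :: q))
      (fun c => ph false (c :: a :: q) + qh false (c :: a :: q) *
        treeVal sel (ph false) (qh false) k (c :: a :: q)) m D' hr.le (by linarith)
      hW hπ (by nlinarith) (T.one_sub_nomUncut_le k) (fun c hc => by
        simp only [hm, hD']
        by_cases h2 : c ∈ twoCC F
        · obtain ⟨L, hL0, hL, hUL, hg⟩ := T.good_crude k (p := c :: a :: q) (by simp)
          rw [if_neg (by simpa using h2), if_neg (by simpa using h2), add_zero, mul_one]
          exact T.good_child_two h2 (hL.trans (T.crudeLoss_le _)) hg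
        · rw [if_pos h2, if_pos h2]
          exact T.good_child h2 (T.lossSum_mem _ k _).1
            ((T.lossSum_mem _ k _).2.trans (T.crudeLoss_le _))
            (T.nomUncut_mul_lossSum_le_one k _) (hD c) (h c (Finset.mem_filter.2 ⟨hc, h2⟩)))
      (fun c hc => (hmm c hc).1)
      (fun c hc => le_trans (mul_le_mul_of_nonneg_left (by linarith [(hmm c hc).2]) hW) hWπ)
      (fun c _ => by
        simp only [hD']
        have := hD c
        have := limUncut_nonneg hlt.le
        split_ifs <;> positivity)
      (fun c _ => T.nodeVal_nonneg false k c _)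
  rw [← nodeUncut_succ] at this
  rw [lossSum, if_pos hsel, Finset.sum_filter, Finset.sum_filter]
  exact this

/-- At a canonical clause label the losses of the children add up. At any other label there is at
most one child, and 1 - W(1 + 0.4 r²) exceeds the nominal (1-W)², because 1 - W ≥ r ≥ 0.4 r². -/
theorem good_canon (T : IsLossyTree F canon sel N x z r σn σx g ph qh) (k : ℕ) {p : List V}
    (hp : CanonPath canon sel (twoCC F) p) :
    Good r (treeVal sel (ph true) (qh true) k p) (treeVal sel (ph false) (qh false) k p)
      (1 - nomUncut r k * (1 + lossSum canon sel (twoCC F) r (nodeLoss N x σn σx) k p)) 0 := by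
  have hr := T.pos
  have hlt := T.lt_half
  have h1 := T.one_sub_pos
  induction k generalizing p with
  | zero => exact good_refl (by simp [nomUncut, lossSum, treeVal])
  | succ k ih =>
    have hU := nomUncut_mem hr.le (by linarith) k
    obtain ⟨a, q, rfl⟩ : ∃ a q, p = a :: q := by cases hp <;> exact ⟨_, _, rfl⟩
    by_cases hsel : sel (a :: q) = canon a
    · have := T.good_canon_step k hsel le_rfl (by simpa using T.nodeUncut_le k le_rfl)
        0 (fun _ => le_rfl)
        (fun c hc => ih (CanonPath.step c a q hp hsel (Finset.mem_filter.1 hc).1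
          (Finset.mem_filter.1 hc).2))
      simpa using this
    · have hcard := hp.card_childLabels_le_one T.unique T.choice T.labelling hsel
      refine (T.good_single k (by simp) hcard).mono ?_ le_rfl
      rw [lossSum, if_neg hsel, nodeUncut_succ]
      have hW : 0 ≤ (1 - r) * nomUncut r k := mul_nonneg h1.le hU.1
      have hW1 : (1 - r) * nomUncut r k ≤ 1 - r := by nlinarith
      have := mul_le_mul_of_nonneg_left
        (by nlinarith : 0.4 * r ^ 2 ≤ 1 - (1 - r) * nomUncut r k) hW
      linarith

/-- The density of the label `z` below a node counts for the difference. -/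
theorem good_density (T : IsLossyTree F canon sel N x z r σn σx g ph qh) {y : V} (hxz : x ≠ z)
    (hy : (y, false) ∈ canon x) {π₀ ρ : ℝ} (K H k : ℕ) (hk : K + H ≤ k)
    (hπ₀ : π₀ = 1 - (1 - r) * nomUncut r K * (1 + maxLoss r σn σx)) (hρ : ρ = (1 - r) * π₀)
    {l : List V} (hyl : y ∈ l) (hl : CanonPath canon sel (twoCC F) (l ++ [x])) :
    Good r (treeVal sel (ph true) (qh true) k (l ++ [x]))
      (treeVal sel (ph false) (qh false) k (l ++ [x]))
      (1 - nomUncut r k *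
        (1 + lossSum canon sel (twoCC F) r (nodeLoss N x σn σx) k (l ++ [x])))
      (limUncut r / (1 - r) * ∑ d ∈ Finset.range H,
        (canonCount canon sel (twoCC F) z (d + 1) l : ℝ) * ρ ^ (d + 1)) := by
  have hr := T.pos
  have hlt := T.lt_half
  have h1 := T.one_sub_pos
  have hlim0 := limUncut_nonneg hlt.le
  have hmax := T.maxLoss_nonneg
  have hWK : (1 - r) * limUncut r ≤ (1 - r) * nomUncut r K :=
    mul_le_mul_of_nonneg_left (limUncut_le_nomUncut hr.le hlt.le K) h1.le
  have hWK0 : 0 ≤ (1 - r) * limUncut r := mul_nonneg h1.le hlim0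
  have hπ0 : 0 ≤ π₀ := by linarith [T.nodeUncut_le K (le_refl (maxLoss r σn σx))]
  have hπ1 : π₀ ≤ r / (1 - r) := by
    rw [hπ₀, ← one_sub_mul_limUncut (by linarith)]
    nlinarith
  have hρ0 : 0 ≤ ρ := hρ ▸ mul_nonneg h1.le hπ0
  have hρ1 : ρ ≤ 1 / 2 := by
    rw [le_div_iff₀ h1] at hπ1
    linarith
  induction H generalizing k l with
  | zero => simpa using T.good_canon k hl
  | succ H ih =>
    obtain ⟨k, rfl⟩ : ∃ k', k = k' + 1 := ⟨k - 1, by omega⟩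
    obtain ⟨a, q, rfl⟩ := List.exists_cons_of_ne_nil (List.ne_nil_of_mem hyl)
    have hU := nomUncut_mem hr.le (by linarith) k
    have hW : 0 ≤ (1 - r) * nomUncut r k := mul_nonneg h1.le hU.1
    have hkK : (1 - r) * nomUncut r k ≤ (1 - r) * nomUncut r K :=
      mul_le_mul_of_nonneg_left (nomUncut_antitone hr.le (by linarith) (by omega)) h1.le
    by_cases hs0 : sel (a :: q) = canon a
    swap
    · have h0 : ∀ d, canonCount canon sel (twoCC F) z (d + 1) (a :: q) = 0 := fun d => by
        rw [canonCount, if_neg hs0]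
      simpa [h0] using T.good_canon (k + 1) hl
    -- Each level costs ρ: the factor 1-r of the edge and the factor π₀ for the sibling, which must
    -- be cut as well. The prefactor 1/(1-r) is there because the edge into the node labelled `z`
    -- does not cost 1-r; there the difference is `limUncut r` itself.
    have hcnt : limUncut r / (1 - r) * ∑ d ∈ Finset.range (H + 1),
        (canonCount canon sel (twoCC F) z (d + 1) (a :: q) : ℝ) * ρ ^ (d + 1) =
        π₀ * limUncut r * ∑ c ∈ (childLabels sel (a :: q)).filter (· ∉ twoCC F),
          ∑ d ∈ Finset.range (H + 1),
            (canonCount canon sel (twoCC F) z d (c :: a :: q) : ℝ) * ρ ^ d := by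
      rw [Finset.sum_comm, Finset.mul_sum, Finset.mul_sum]
      refine Finset.sum_congr rfl fun d _ => ?_
      rw [canonCount, if_pos hs0, Nat.cast_sum, ← Finset.sum_mul, pow_succ]
      nth_rw 2 [hρ]
      field_simp
    by_cases hs1 : sel (a :: (q ++ [x])) = canon a
    · have hch : childLabels sel (a :: (q ++ [x])) = childLabels sel (a :: q) := by
        rw [childLabels, childLabels, hs0, hs1]
      have := T.good_canon_step (a := a) (q := q ++ [x]) k hs1 hπ0 (hπ₀ ▸ by nlinarith)
        (fun c => limUncut r / (1 - r) * ∑ d ∈ Finset.range H,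
          (canonCount canon sel (twoCC F) z (d + 1) (c :: a :: q) : ℝ) * ρ ^ (d + 1))
        (fun c => by positivity)
        (fun c hc => ih k (l := c :: a :: q) (by omega) (List.mem_cons_of_mem _ hyl)
          (CanonPath.step c a (q ++ [x]) hl hs1 (Finset.mem_filter.1 hc).1
            (Finset.mem_filter.1 hc).2))
      refine this.mono le_rfl (le_of_eq ?_)
      rw [hcnt, hch, mul_assoc, Finset.mul_sum (a := limUncut r)]
      congr 1
      refine Finset.sum_congr rfl fun c hc => ?_
      rw [Finset.sum_range_succ']
      split_ifs with hcz
      · have : ∀ d, canonCount canon sel (twoCC F) z (d + 1) (c :: a :: q) = 0 := fun d =>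
          canonCount_eq_zero_of_mem T.labelling _ d (by simp [hcz])
        simp [this]
        simp [canonCount, hcz]
      · rw [show canonCount canon sel (twoCC F) z 0 (c :: a :: q) = 0 by simp [canonCount, hcz]]
        field_simp
        simp
    -- The paths in T_x and T_y differ only in the final label `x`. A clause label that is canonical
    -- in T_y and not in T_x must therefore contain the negation of `x`.
    · have hxa : (x, false) ∈ canon a := by
        by_contra hxa
        apply hs1
        rw [T.labelling.sel_eq_canon_iff, not_sat_pathAssignment] at hs0
        refine T.labelling.canonical_first a (q ++ [x]) ?_
        rw [not_sat_pathAssignment]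
        intro u
        refine ⟨fun hu => ?_, fun hu hu' => ?_⟩
        · have := (hs0 u).1 hu
          simp only [List.mem_cons, List.mem_append] at this ⊢
          tauto
        · have := (hs0 u).2 hu
          simp only [List.mem_cons, List.mem_append, List.not_mem_nil] at this hu'
          have hux : u = x := by tauto
          exact hxa (hux ▸ hu)
      have hxch : x ∈ childLabels sel (a :: q) := by rw [mem_childLabels, hs0]; exact hxa
      -- In T_y the child `x` leads to no counted node: `canon x` contains the negation of `y`,
      -- which is already on the path, so it is not violated there.
      have hzero : ∀ d, canonCount canon sel (twoCC F) z d (x :: a :: q) = 0 := by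
        intro d
        cases d with
        | zero => simp [canonCount, hxz]
        | succ d =>
          rw [canonCount, if_neg]
          intro hsx
          have := T.labelling.not_mem_of_mem_childLabels (p := x :: a :: q) (by simp)
            (c := y) (by rw [mem_childLabels, hsx]; exact hy)
          exact this (List.mem_cons_of_mem _ hyl)
      -- Only one child can lead to `z`, so by Kraft's inequality the density that is lost here is
      -- bounded by 1.
      have hkraft : ∑ c ∈ (childLabels sel (a :: q)).filter (· ∉ twoCC F),
          ∑ d ∈ Finset.range (H + 1),
            (canonCount canon sel (twoCC F) z d (c :: a :: q) : ℝ) * ρ ^ d ≤ 1 := by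
        calc _ ≤ ∑ c ∈ childLabels sel (a :: q), ∑ d ∈ Finset.range (H + 1),
            (canonCount canon sel (twoCC F) z d (c :: a :: q) : ℝ) * ρ ^ d :=
              Finset.sum_le_sum_of_subset_of_nonneg (Finset.filter_subset _ _)
                fun c _ _ => Finset.sum_nonneg fun d _ => by positivity
          _ = ∑ c ∈ (childLabels sel (a :: q)).erase x, ∑ d ∈ Finset.range (H + 1),
            (canonCount canon sel (twoCC F) z d (c :: a :: q) : ℝ) * ρ ^ d := by
              rw [← Finset.add_sum_erase _ _ hxch]
              simp [hzero]
          _ ≤ ∑ c ∈ (childLabels sel (a :: q)).erase x, (1 : ℝ) :=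
              Finset.sum_le_sum fun c _ => sum_canonCount_le_one T.unique T.labelling _ z _
                (by simp) hρ0 hρ1
          _ ≤ 1 := by
              rw [Finset.sum_const, nsmul_eq_mul, mul_one]
              have h2 := T.labelling.card_childLabels_le T.unique (p := a :: q) (by simp)
              have h3 := Finset.card_erase_of_mem hxch
              exact_mod_cast (by omega : ((childLabels sel (a :: q)).erase x).card ≤ 1)
      have hcard := hl.card_childLabels_le_one T.unique T.choice T.labelling hs1
      have hW1 : (1 - r) * nomUncut r k ≤ 1 - r := by nlinarith
      -- In T_x the node has at most one child. Its surplus over the value of two children is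
      -- exchanged for the density that is lost.
      refine ((T.good_single k (p := a :: (q ++ [x])) (by simp) hcard).surplus
        (E' := (1 - r) * nomUncut r k * (1 - (1 - r) * nomUncut r k - 0.4 * r ^ 2)) ?_ ?_).mono
        le_rfl ?_
      · refine mul_nonneg hW ?_
        nlinarith
      · rw [List.cons_append, lossSum, if_neg hs1, nodeUncut_succ]
        linarith
      · rw [hcnt, zero_add]
        have h5 : limUncut r ≤ nomUncut r k := limUncut_le_nomUncut hr.le hlt.le k
        have h6 : π₀ ≤ 1 - (1 - r) * nomUncut r k := by
          rw [hπ₀]; nlinarith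
        -- The rate 1 + r/2 suffices because 1 - W ≥ r, while (1 + r/2) · 0.4 r² ≤ r²/2 for r < 1/2.
        have h7 : 1 - (1 - r) * nomUncut r k ≤
            (1 + r / 2) * (1 - (1 - r) * nomUncut r k - 0.4 * r ^ 2) := by nlinarith
        calc _ ≤ π₀ * limUncut r * 1 := by gcongr
          _ ≤ (1 + r / 2) * (1 - (1 - r) * nomUncut r k - 0.4 * r ^ 2) * nomUncut r k := by
              rw [mul_one]
              exact mul_le_mul (h6.trans h7) h5 hlim0 (by linarith)
          _ = _ := by field_simp

/-- The lower bound at the root. -/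
theorem root_le (T : IsLossyTree F canon sel N x z r σn σx g ph qh) {y : V} (hxz : x ≠ z)
    (hyz : y ≠ z) (hcx : canon x = critClause x y z) (hx2 : x ∉ twoCC F) (hy2 : y ∉ twoCC F)
    {π₀ ρ : ℝ} (K H k : ℕ) (hK : 1 ≤ K) (hk : K + H ≤ k)
    (hπ₀ : π₀ = 1 - (1 - r) * nomUncut r K * (1 + maxLoss r σn σx)) (hρ : ρ = (1 - r) * π₀) :
    1 - nomUncut r (k + 1) *
        (1 + lossSum canon sel (twoCC F) r (nodeLoss N x σn σx) (k + 1) [x]) +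
      (1 - 2 * r) ^ 2 / (1 - r) ^ 3 * r * ∑ d ∈ Finset.range H,
        (canonCount canon sel (twoCC F) z (d + 1) [y] : ℝ) * ρ ^ (d + 1) ≤
    r * treeVal sel (ph true) (qh true) (k + 1) [x] +
      (1 - r) * treeVal sel (ph false) (qh false) (k + 1) [x] := by
  have hr := T.pos
  have hlt := T.lt_half
  have h1 := T.one_sub_pos
  have hsel : sel [x] = canon x := by
    refine T.labelling.canonical_first x [] ?_
    rw [not_sat_pathAssignment]
    intro u
    have h := (T.choice x).2.2
    refine ⟨fun hu => ?_, fun hu => ?_⟩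
    · by_contra hne
      have := (h _ hu (by simpa using hne)).1
      simp at this
    · have := (h _ hu (by simp)).2
      simpa using this
  have hch : childLabels sel [x] = {y, z} := by
    ext c
    rw [mem_childLabels, hsel, hcx]
    simp [critClause]
  have hyx : (y, false) ∈ canon x := by rw [hcx]; simp [critClause]
  have hroot := CanonPath.root (canon := canon) (sel := sel) x hx2
  have hcy : CanonPath canon sel (twoCC F) [y, x] :=
    CanonPath.step y x [] hroot hsel (by rw [hch]; simp) hy2
  have hcz : CanonPath canon sel (twoCC F) [z, x] :=
    CanonPath.step z x [] hroot hsel (by rw [hch]; simp) T.not_two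
  have hlim0 := limUncut_nonneg hlt.le
  have hlim := limUncut_le_nomUncut hr.le hlt.le k
  set U := nomUncut r k with hU
  set Λy := lossSum canon sel (twoCC F) r (nodeLoss N x σn σx) k [y, x] with hΛy
  set Λz := lossSum canon sel (twoCC F) r (nodeLoss N x σn σx) k [z, x] with hΛz
  have hU0 : 0 ≤ U := hlim0.trans hlim
  have hy0 := T.lossSum_mem (twoCC F) k [y, x]
  have hz0 := T.lossSum_mem (twoCC F) k [z, x]
  rw [← hΛy] at hy0
  rw [← hΛz] at hz0
  have hσz : nodeLoss N x σn σx [z, x] = 0 := by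
    have : N z = ∅ := Finset.eq_empty_of_forall_notMem fun b hb => T.isolated b (T.symm _ _ hb)
    simp [nodeLoss, this]
  set my := Λy + 1.01 * nodeLoss N x σn σx [y, x] with hmy
  have hUz : U * (1 + Λz) ≤ 1 := T.nomUncut_mul_lossSum_le_one k _
  -- the child `z`
  have hz := T.good_canon k hcz
  rw [T.treeVal_eq_of_mem k (p := [z, x]) (by simp)] at hz
  have hqz := hz.le_of_eq (by linarith)
  rw [← hU, ← hΛz] at hqz
  -- the child `y`
  set A := ∑ d ∈ Finset.range H,
    (canonCount canon sel (twoCC F) z (d + 1) [y] : ℝ) * ρ ^ (d + 1) with hA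
  have hA0 : 0 ≤ limUncut r / (1 - r) * A := by
    have hWK : (1 - r) * nomUncut r K * (1 + maxLoss r σn σx) ≤ 1 := T.nodeUncut_le K le_rfl
    have : 0 ≤ ρ := hρ ▸ mul_nonneg h1.le (by linarith)
    positivity
  have hyg := T.good_child (c := y) (p := [x]) hy2 hy0.1 (hy0.2.trans (T.crudeLoss_le _))
    (T.nomUncut_mul_lossSum_le_one k _) hA0
    (T.good_density hxz hyx K H k hk hπ₀ hρ (l := [y]) (by simp) hcy)
  rw [if_neg hyz, ← hmy] at hyg
  obtain ⟨Δ, E, hΔ, hE, h3, h4, h5⟩ := hyg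
  set P1 := ph true [y, x] + qh true [y, x] * treeVal sel (ph true) (qh true) k [y, x] with hP1
  set P0 := ph false [y, x] + qh false [y, x] * treeVal sel (ph false) (qh false) k [y, x] with hP0
  set Q0 := treeVal sel (ph false) (qh false) k [z, x] with hQ0
  have e1 : treeVal sel (ph true) (qh true) (k + 1) [x] = P1 := by
    rw [treeVal, hch, Finset.prod_pair hyz, (T.early [x]).1, (T.early [x]).2]
    simp [hP1]
  have e0 : treeVal sel (ph false) (qh false) (k + 1) [x] = P0 * Q0 := by
    rw [treeVal, hch, Finset.prod_pair hyz, (T.late [x]).1, (T.late [x]).2]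
    simp [hP0, hQ0]
  have eΛ : lossSum canon sel (twoCC F) r (nodeLoss N x σn σx) (k + 1) [x] =
      r * (my + Λz) := by
    rw [lossSum, if_pos hsel, hch, Finset.filter_true_of_mem, Finset.sum_pair hyz, hσz]
    · simp [hmy, hΛy, hΛz]
    · intro c hc
      rcases Finset.mem_insert.1 hc with rfl | hc
      · exact hy2
      · exact Finset.mem_singleton.1 hc ▸ T.not_two
  have hP0n : 0 ≤ P0 := T.nodeVal_nonneg false k y [x]
  have hmy0 : 0 ≤ my ∧ my ≤ maxLoss r σn σx := T.childLoss_mem k (by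
    simpa using fun h : y = x => absurd ((T.choice x).2.2 _ hyx (by simp)).2 (by simp [h]))
  have hWr : 1 - (1 - r) * U ≤ r * (2 - (1 - r) * U) := T.one_sub_nomUncut_le k
  have hUzr : U * (1 + Λz) * (1 + r ^ 2 / 2) ≤ 1 := by
    have hU1 := nomUncut_one_le hr.le (by linarith : r ≤ 1) (by omega : 1 ≤ k)
    have hz1 := hz0.2.trans (T.crudeLoss_le_sq _)
    calc U * (1 + Λz) * (1 + r ^ 2 / 2) ≤ U * (1 + 0.4 * r ^ 2) * (1 + r ^ 2 / 2) := by gcongr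
      _ ≤ (1 - r ^ 2) * (1 + 0.4 * r ^ 2) * (1 + r ^ 2 / 2) := by gcongr
      _ ≤ 1 := by
          have : 0 ≤ r ^ 2 * r ^ 2 := by positivity
          have : 0 ≤ r ^ 2 * r ^ 2 * r ^ 2 := by positivity
          nlinarith [sq_nonneg r]
  rw [e1, e0, eΛ, nodeUncut_succ, ← hU]
  refine root_arith hr hlt hU0 hlim hWr hmy0.1 hz0.1 hUz hUzr hP0n hqz hA0 hE h3 h4 ?_
  exact h5

end IsLossyTree

end Canonical

/-! ### Correlated bits -/

section Bits

variable {V ι : Type} [Fintype V] [DecidableEq V] [Fintype ι] [DecidableEq ι]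

/-- Expansion of a product over disjoint blocks. -/
theorem prod_one_add_blocks {B : ι → Finset V} (hB : Pairwise fun i j => Disjoint (B i) (B j))
    (c : ι → ℝ) (f : V → ℝ) :
    ∏ i, (1 + c i * ∏ u ∈ B i, f u) =
      ∑ T : Finset ι, (∏ i ∈ T, c i) * ∏ u, if u ∈ T.biUnion B then f u else 1 := by
  rw [Finset.prod_one_add, Finset.powerset_univ]
  refine Finset.sum_congr rfl fun T _ => ?_
  rw [Finset.prod_mul_distrib, ← Finset.prod_biUnion (fun i _ j _ hij => hB hij),
    Finset.prod_ite_mem, Finset.univ_inter]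

/-- The weight of a bit vector: independent bits with weights `ω`, and a correlation inside every
block. -/
def bitWeight (ω Φ : V → Bool → ℝ) (B : ι → Finset V) (c : ι → ℝ) (J : V → Bool) : ℝ :=
  (∏ u, ω u (J u)) * ∏ i, (1 + c i * ∏ u ∈ B i, Φ u (J u))

/-- Each term of the expansion over subsets of blocks is a product over the variables, so its sum
factors. -/
theorem sum_bitWeight {ω Φ : V → Bool → ℝ} {B : ι → Finset V}
    (hB : Pairwise fun i j => Disjoint (B i) (B j)) (c : ι → ℝ) {A μ : V → ℝ}
    (hA : ∀ u, ∑ t, ω u t = A u) (hμ : ∀ i, ∀ u ∈ B i, ∑ t, ω u t * Φ u t = A u * μ u) :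
    ∑ J, bitWeight ω Φ B c J = (∏ u, A u) * ∏ i, (1 + c i * ∏ u ∈ B i, μ u) := by
  simp only [bitWeight, prod_one_add_blocks hB, Finset.mul_sum]
  rw [Finset.sum_comm]
  refine Finset.sum_congr rfl fun T _ => ?_
  have h1 : ∀ J : V → Bool, (∏ u, ω u (J u)) * ((∏ i ∈ T, c i) *
      ∏ u, if u ∈ T.biUnion B then Φ u (J u) else 1) = (∏ i ∈ T, c i) *
      ∏ u, ω u (J u) * if u ∈ T.biUnion B then Φ u (J u) else 1 := by
    intro J
    rw [Finset.prod_mul_distrib]; ring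
  rw [Finset.sum_congr rfl fun J _ => h1 J, ← Finset.mul_sum, mul_left_comm,
    ← Finset.prod_mul_distrib]
  congr 1
  rw [← Fintype.piFinset_univ, ← Finset.prod_univ_sum (fun _ : V => (Finset.univ : Finset Bool))
    (fun u t => ω u t * if u ∈ T.biUnion B then Φ u t else 1)]
  refine Finset.prod_congr rfl fun u _ => ?_
  split_ifs with hu
  · obtain ⟨i, -, hi⟩ := Finset.mem_biUnion.1 hu
    exact hμ i u hi
  · simpa using hA u

/-- The bits of the labels in `p` are forced to be `false`. -/
def restrictFalse (ω : V → Bool → ℝ) (p : List V) (u : V) (t : Bool) : ℝ :=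
  if u ∈ p ∧ t = true then 0 else ω u t

/-- The conditional probability that the bit of `a` is `false`, given that the bits of the labels in
`q` are. -/
noncomputable def lateProb (ω Φ : V → Bool → ℝ) (B : ι → Finset V) (c : ι → ℝ) : List V → ℝ
  | [] => 1
  | a :: q => ω a false * ∏ i, if a ∈ B i then
      1 + c i * ∏ u ∈ B i, (if u ∈ a :: q then Φ u false else 0) else 1

/-- Product weights for bits with a nonnegative correlation inside every block. -/
structure IsBitSystem (x : V) (ω Φ : V → Bool → ℝ) (B : ι → Finset V) (c : ι → ℝ) : Prop where
  disjoint : Pairwise fun i j => Disjoint (B i) (B j)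
  card : ∀ i, (B i).card = 2
  coeff_nonneg : ∀ i, 0 ≤ c i
  nonneg : ∀ u t, 0 ≤ ω u t
  mono : ∀ u, Φ u false ≤ Φ u true
  factor_nonneg : ∀ (i : ι) (J : V → Bool), 0 ≤ 1 + c i * ∏ u ∈ B i, Φ u (J u)
  sum_one : ∀ u, ω u true + ω u false = 1
  mean_zero : ∀ i, ∀ u ∈ B i, u ≠ x → ω u true * Φ u true + ω u false * Φ u false = 0

variable {x : V} {ω Φ : V → Bool → ℝ} {B : ι → Finset V} {c : ι → ℝ}

namespace IsBitSystem

theorem restrictFalse_nonneg (S : IsBitSystem x ω Φ B c) (p : List V) (u : V) (t : Bool) :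
    0 ≤ restrictFalse ω p u t := by
  unfold restrictFalse
  split_ifs
  · exact le_rfl
  · exact S.nonneg u t

theorem bitWeight_nonneg (S : IsBitSystem x ω Φ B c) (p : List V) (J : V → Bool) :
    0 ≤ bitWeight (restrictFalse ω p) Φ B c J :=
  mul_nonneg (Finset.prod_nonneg fun u _ => S.restrictFalse_nonneg p u _)
    (Finset.prod_nonneg fun i _ => S.factor_nonneg i J)

/-- A free label of a block has mean zero and kills the correlation of its block; only blocks inside
`p` contribute. The root label has a fixed value whose mean need not vanish, hence the assumption
that it lies on `p`. -/
theorem sum_restrict (S : IsBitSystem x ω Φ B c) {p : List V} (hx : x ∈ p) :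
    ∑ J, bitWeight (restrictFalse ω p) Φ B c J =
      (∏ u, if u ∈ p then ω u false else 1) *
        ∏ i, (1 + c i * ∏ u ∈ B i, if u ∈ p then Φ u false else 0) := by
  refine sum_bitWeight S.disjoint c (fun u => ?_) (fun i u hu => ?_)
  · rw [Fintype.sum_bool]
    by_cases h : u ∈ p
    · simp [restrictFalse, h]
    · simpa [restrictFalse, h] using S.sum_one u
  · rw [Fintype.sum_bool]
    by_cases h : u ∈ p
    · simp [restrictFalse, h]
    · simpa [restrictFalse, h] using S.mean_zero i u hu (fun hux => h (hux ▸ hx))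

theorem sum_restrict_cons (S : IsBitSystem x ω Φ B c) {p : List V} (hx : x ∈ p) {a : V}
    (ha : a ∉ p) :
    ∑ J, bitWeight (restrictFalse ω (a :: p)) Φ B c J =
      (∑ J, bitWeight (restrictFalse ω p) Φ B c J) * lateProb ω Φ B c (a :: p) := by
  rw [S.sum_restrict hx, S.sum_restrict (List.mem_cons_of_mem _ hx), lateProb]
  rw [mul_mul_mul_comm, ← Finset.prod_mul_distrib]
  congr 1
  · rw [← Finset.mul_prod_erase _ _ (Finset.mem_univ a),
      ← Finset.mul_prod_erase Finset.univ (fun u => if u ∈ p then ω u false else 1)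
        (Finset.mem_univ a)]
    rw [if_pos (List.mem_cons_self ..), if_neg ha, one_mul, mul_comm]
    congr 1
    refine Finset.prod_congr rfl fun u hu => ?_
    simp [Finset.ne_of_mem_erase hu]
  · refine Finset.prod_congr rfl fun i _ => ?_
    split_ifs with hai
    · rw [Finset.prod_eq_zero (f := fun u => if u ∈ p then Φ u false else 0) hai (by simp [ha])]
      simp
    · rw [mul_one]
      congr 2
      refine Finset.prod_congr rfl fun u hu => ?_
      have : u ≠ a := fun h => hai (h ▸ hu)
      simp [this]

/-- The FKG condition in one block. Only bit vectors that are incomparable on the block matter, and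
then the difference of the two sides is `c i` times the product of the two increments of Φ. -/
theorem factor_mul_le (S : IsBitSystem x ω Φ B c) (i : ι) (J K : V → Bool) :
    (1 + c i * ∏ u ∈ B i, Φ u (J u)) * (1 + c i * ∏ u ∈ B i, Φ u (K u)) ≤
      (1 + c i * ∏ u ∈ B i, Φ u ((J ⊓ K) u)) * (1 + c i * ∏ u ∈ B i, Φ u ((J ⊔ K) u)) := by
  obtain ⟨a, b, hab, hB⟩ := Finset.card_eq_two.1 (S.card i)
  have hc := S.coeff_nonneg i
  have ha := S.mono a
  have hb := S.mono b
  simp only [hB, Finset.prod_pair hab, Pi.inf_apply, Pi.sup_apply]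
  have key : 0 ≤ c i * ((Φ a true - Φ a false) * (Φ b true - Φ b false)) :=
    mul_nonneg hc (mul_nonneg (by linarith) (by linarith))
  have e1 : (true ⊓ true : Bool) = true := rfl
  have e2 : (true ⊓ false : Bool) = false := rfl
  have e3 : (false ⊓ true : Bool) = false := rfl
  have e4 : (false ⊓ false : Bool) = false := rfl
  have e5 : (true ⊔ true : Bool) = true := rfl
  have e6 : (true ⊔ false : Bool) = true := rfl
  have e7 : (false ⊔ true : Bool) = true := rfl
  have e8 : (false ⊔ false : Bool) = false := rfl
  cases J a <;> cases K a <;> cases J b <;> cases K b <;>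
    simp only [e1, e2, e3, e4, e5, e6, e7, e8] <;> nlinarith

theorem bitWeight_mul_le (S : IsBitSystem x ω Φ B c) (p : List V) (J K : V → Bool) :
    bitWeight (restrictFalse ω p) Φ B c J * bitWeight (restrictFalse ω p) Φ B c K ≤
      bitWeight (restrictFalse ω p) Φ B c (J ⊓ K) *
        bitWeight (restrictFalse ω p) Φ B c (J ⊔ K) := by
  unfold bitWeight
  rw [mul_mul_mul_comm, mul_mul_mul_comm (∏ u, restrictFalse ω p u ((J ⊓ K) u))]
  simp only [← Finset.prod_mul_distrib]
  refine mul_le_mul (le_of_eq ?_) ?_ ?_ ?_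
  · refine Finset.prod_congr rfl fun u _ => ?_
    simp only [Pi.inf_apply, Pi.sup_apply]
    cases J u <;> cases K u <;> simp [mul_comm]
  · exact Finset.prod_le_prod
      (fun i _ => mul_nonneg (S.factor_nonneg i J) (S.factor_nonneg i K))
      fun i _ => S.factor_mul_le i J K
  · exact Finset.prod_nonneg fun i _ => mul_nonneg (S.factor_nonneg i J) (S.factor_nonneg i K)
  · exact Finset.prod_nonneg fun u _ =>
      mul_nonneg (S.restrictFalse_nonneg p u _) (S.restrictFalse_nonneg p u _)

/-- The correlation inequality for several events. -/
theorem mul_prod_le (S : IsBitSystem x ω Φ B c) (p : List V) (s : Finset V)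
    (f : V → (V → Bool) → ℝ) (t : V → ℝ) (hf0 : ∀ a ∈ s, 0 ≤ f a) (hf : ∀ a ∈ s, Monotone (f a))
    (ht : ∀ a ∈ s, 0 ≤ t a)
    (h : ∀ a ∈ s, (∑ J, bitWeight (restrictFalse ω p) Φ B c J) * t a ≤
      ∑ J, bitWeight (restrictFalse ω p) Φ B c J * f a J) :
    (∑ J, bitWeight (restrictFalse ω p) Φ B c J) * ∏ a ∈ s, t a ≤
      ∑ J, bitWeight (restrictFalse ω p) Φ B c J * ∏ a ∈ s, f a J := by
  induction s using Finset.induction_on with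
  | empty => simp
  | insert a s ha ih =>
    have h0 := S.bitWeight_nonneg p
    set Z := ∑ J, bitWeight (restrictFalse ω p) Φ B c J with hZ
    have hZ0 : 0 ≤ Z := Finset.sum_nonneg fun J _ => h0 J
    simp only [Finset.prod_insert ha]
    have hs0 : ∀ J, 0 ≤ ∏ b ∈ s, f b J := fun J =>
      Finset.prod_nonneg fun b hb => hf0 b (Finset.mem_insert_of_mem hb) J
    rcases hZ0.eq_or_lt with hZz | hZp
    · rw [← hZz, zero_mul]
      exact Finset.sum_nonneg fun J _ => mul_nonneg (h0 J)
        (mul_nonneg (hf0 a (Finset.mem_insert_self _ _) J) (hs0 J))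
    · have ih' := ih (fun b hb => hf0 b (Finset.mem_insert_of_mem hb))
        (fun b hb => hf b (Finset.mem_insert_of_mem hb))
        (fun b hb => ht b (Finset.mem_insert_of_mem hb))
        (fun b hb => h b (Finset.mem_insert_of_mem hb))
      have hfkg := fkg (f a) (fun J => ∏ b ∈ s, f b J)
        (fun J => bitWeight (restrictFalse ω p) Φ B c J) h0
        (hf0 a (Finset.mem_insert_self _ _)) hs0
        (hf a (Finset.mem_insert_self _ _))
        (fun J K hJK => Finset.prod_le_prod
          (fun b hb => hf0 b (Finset.mem_insert_of_mem hb) J)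
          fun b hb => hf b (Finset.mem_insert_of_mem hb) hJK)
        (S.bitWeight_mul_le p)
      have h1 := mul_le_mul (h a (Finset.mem_insert_self _ _)) ih'
        (mul_nonneg hZ0 (Finset.prod_nonneg fun b hb => ht b (Finset.mem_insert_of_mem hb)))
        (Finset.sum_nonneg fun J _ => mul_nonneg (h0 J) (hf0 a (Finset.mem_insert_self _ _) J))
      have h2 := h1.trans hfkg
      rw [← hZ] at h2
      refine le_of_mul_le_mul_left ?_ hZp
      calc Z * (Z * (t a * ∏ b ∈ s, t b)) = Z * t a * (Z * ∏ b ∈ s, t b) := by ring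
        _ ≤ _ := h2

end IsBitSystem

/-- The subtree of height `k` below a node is cut by the labels whose bit is `true`. -/
def bitCut (sel : List V → Clause V) : ℕ → List V → (V → Bool) → Prop
  | 0, _, _ => False
  | k + 1, p, J => ∀ a ∈ childLabels sel p, J a = true ∨ bitCut sel k (a :: p) J

theorem bitCut_mono (sel : List V → Clause V) (k : ℕ) (p : List V) {J K : V → Bool} (h : J ≤ K)
    (hJ : bitCut sel k p J) : bitCut sel k p K := by
  induction k generalizing p with
  | zero => exact hJ
  | succ k ih =>
    intro a ha
    rcases hJ a ha with h1 | h1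
    · have := h a
      rw [h1] at this
      exact Or.inl (top_le_iff.1 this)
    · exact Or.inr (ih _ h1)

open Classical in
-- Condition on all labels of `p` being late. The events at the children are increasing, so FKG
-- separates siblings. For one child, split by its bit: if it is late, the condition is that of the
-- longer path, and the induction applies. Enlarging the late probability to `q` is allowed because
-- being cut off is at least as good as having the subtree cut.
theorem IsBitSystem.mul_treeVal_le (S : IsBitSystem x ω Φ B c) {F : Finset (Clause V)}
    {canon : V → Clause V} {sel : List V → Clause V} (hs : IsClauseLabelling F canon sel)
    {q : List V → ℝ}
    (hq : ∀ a p, a ≠ x → lateProb ω Φ B c (a :: p) ≤ q (a :: p))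
    (h01 : ∀ a p, 0 ≤ q (a :: p) ∧ q (a :: p) ≤ 1) (k : ℕ)
    {p : List V} (hx : x ∈ p) :
    (∑ J, bitWeight (restrictFalse ω p) Φ B c J) * treeVal sel (fun p => 1 - q p) q k p ≤
      ∑ J, bitWeight (restrictFalse ω p) Φ B c J * if bitCut sel k p J then 1 else 0 := by
  have hT : ∀ k p, 0 ≤ treeVal sel (fun p => 1 - q p) q k p ∧
      treeVal sel (fun p => 1 - q p) q k p ≤ 1 :=
    treeVal_mem fun a p _ => ⟨by linarith [h01 a p], (h01 a p).1, by linarith⟩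
  induction k generalizing p with
  | zero => simp [treeVal, bitCut]
  | succ k ih =>
    have hone : ∀ J, (if bitCut sel (k + 1) p J then (1 : ℝ) else 0) =
        ∏ a ∈ childLabels sel p, if J a = true ∨ bitCut sel k (a :: p) J then 1 else 0 := by
      intro J
      rw [Finset.prod_ite_zero, Finset.prod_const_one]
      by_cases h : ∀ a ∈ childLabels sel p, J a = true ∨ bitCut sel k (a :: p) J
      · rw [if_pos h, if_pos (show bitCut sel (k + 1) p J from h)]
      · rw [if_neg h, if_neg (show ¬ bitCut sel (k + 1) p J from h)]
    simp only [hone, treeVal]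
    refine S.mul_prod_le p (childLabels sel p)
      (fun a J => if J a = true ∨ bitCut sel k (a :: p) J then 1 else 0)
      (fun a => 1 - q (a :: p) + q (a :: p) * treeVal sel (fun p => 1 - q p) q k (a :: p))
      (fun a _ J => by simp only [Pi.zero_apply]; split_ifs <;> norm_num)
      (fun a _ J K hJK => ?_) (fun a _ => ?_) (fun a ha => ?_)
    · by_cases h1 : J a = true ∨ bitCut sel k (a :: p) J
      · have h2 : K a = true ∨ bitCut sel k (a :: p) K := by
          rcases h1 with h1 | h1
          · have := hJK a
            rw [h1] at this
            exact Or.inl (top_le_iff.1 this)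
          · exact Or.inr (bitCut_mono sel k _ hJK h1)
        simp only [if_pos h1, if_pos h2, le_refl]
      · simp only [if_neg h1]
        split_ifs <;> norm_num
    · have h1 := h01 a p
      have h2 := (hT k (a :: p)).1
      have h3 := h1.1
      have h4 : 0 ≤ 1 - q (a :: p) := by linarith
      positivity
    · have hap : a ∉ p := hs.not_mem_of_mem_childLabels (List.ne_nil_of_mem hx) ha
      have hcons := S.sum_restrict_cons hx hap
      set Z := ∑ J, bitWeight (restrictFalse ω p) Φ B c J with hZ
      have hZ0 : 0 ≤ Z := Finset.sum_nonneg fun J _ => S.bitWeight_nonneg p J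
      have hih := ih (p := a :: p) (List.mem_cons_of_mem _ hx)
      have hw : ∀ J : V → Bool, bitWeight (restrictFalse ω (a :: p)) Φ B c J =
          if J a = true then 0 else bitWeight (restrictFalse ω p) Φ B c J := by
        intro J
        split_ifs with hJ
        · unfold bitWeight
          rw [Finset.prod_eq_zero (Finset.mem_univ a), zero_mul]
          simp [restrictFalse, hJ]
        · unfold bitWeight
          congr 1
          refine Finset.prod_congr rfl fun u _ => ?_
          unfold restrictFalse
          by_cases hu : u = a
          · subst hu
            simp [hJ]
          · simp [hu]
      have hsplit : ∑ J, bitWeight (restrictFalse ω p) Φ B c J *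
          (if J a = true ∨ bitCut sel k (a :: p) J then 1 else 0) =
          (Z - ∑ J, bitWeight (restrictFalse ω (a :: p)) Φ B c J) +
          ∑ J, bitWeight (restrictFalse ω (a :: p)) Φ B c J *
            if bitCut sel k (a :: p) J then 1 else 0 := by
        rw [hZ, ← Finset.sum_sub_distrib, ← Finset.sum_add_distrib]
        refine Finset.sum_congr rfl fun J _ => ?_
        rw [hw]
        by_cases hJ : J a = true
        · simp [hJ]
        · simp [hJ]
      rw [hsplit]
      rw [hcons] at hih ⊢
      have h1 := hq a p (fun h => hap (h ▸ hx))
      have h2 := hT k (a :: p)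
      have h3 : Z * (lateProb ω Φ B c (a :: p) *
          (1 - treeVal sel (fun p => 1 - q p) q k (a :: p))) ≤
          Z * (q (a :: p) * (1 - treeVal sel (fun p => 1 - q p) q k (a :: p))) :=
        mul_le_mul_of_nonneg_left (mul_le_mul_of_nonneg_right h1 (by linarith)) hZ0
      nlinarith

end Bits

/-! ### From placements to bits -/

section Discretization

variable {V ι : Type} [Fintype V] [DecidableEq V] [Fintype ι] [DecidableEq ι]

/-- The continuous counterpart of `sum_bitWeight`: expand over sets of blocks and use Fubini in
every term. -/
theorem integral_prod_blocks (ν : Measure ℝ) [IsProbabilityMeasure ν] {B : ι → Finset V}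
    (hB : Pairwise fun i j => Disjoint (B i) (B j)) (c : ι → ℝ) {h f : V → ℝ → ℝ} {A μ : V → ℝ}
    (hi : ∀ u, Integrable (h u) ν) (hfi : ∀ u, Integrable (fun s => h u s * f u s) ν)
    (hA : ∀ u, ∫ s, h u s ∂ν = A u) (hμ : ∀ i, ∀ u ∈ B i, ∫ s, h u s * f u s ∂ν = A u * μ u) :
    Integrable (fun π : V → ℝ => (∏ u, h u (π u)) * ∏ i, (1 + c i * ∏ u ∈ B i, f u (π u)))
      (Measure.pi fun _ => ν) ∧
    ∫ π : V → ℝ, (∏ u, h u (π u)) * ∏ i, (1 + c i * ∏ u ∈ B i, f u (π u))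
      ∂(Measure.pi fun _ => ν) = (∏ u, A u) * ∏ i, (1 + c i * ∏ u ∈ B i, μ u) := by
  have hT : ∀ (T : Finset ι) (π : V → ℝ), (∏ u, h u (π u)) * ((∏ i ∈ T, c i) *
      ∏ u, if u ∈ T.biUnion B then f u (π u) else 1) = (∏ i ∈ T, c i) *
      ∏ u, (fun s => h u s * if u ∈ T.biUnion B then f u s else 1) (π u) := by
    intro T π
    rw [Finset.prod_mul_distrib]; ring
  have hint : ∀ (T : Finset ι) (u : V),
      Integrable (fun s => h u s * if u ∈ T.biUnion B then f u s else 1) ν := by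
    intro T u
    split_ifs
    · exact hfi u
    · simpa using hi u
  have hint' : ∀ T : Finset ι, Integrable (fun π : V → ℝ => (∏ i ∈ T, c i) *
      ∏ u, (fun s => h u s * if u ∈ T.biUnion B then f u s else 1) (π u))
      (Measure.pi fun _ => ν) :=
    fun T => (Integrable.fintype_prod fun u => hint T u).const_mul _
  simp only [prod_one_add_blocks hB, Finset.mul_sum, hT]
  refine ⟨integrable_finsetSum _ fun T _ => hint' T, ?_⟩
  rw [integral_finsetSum _ fun T _ => hint' T]
  refine Finset.sum_congr rfl fun T _ => ?_
  rw [integral_const_mul, integral_fintype_prod_eq_prod (μ := fun _ : V => ν)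
    (fun u s => h u s * if u ∈ T.biUnion B then f u s else 1), mul_left_comm, ← Finset.prod_mul_distrib]
  congr 1
  refine Finset.prod_congr rfl fun u _ => ?_
  split_ifs with hu
  · obtain ⟨i, -, hi⟩ := Finset.mem_biUnion.1 hu
    exact hμ i u hi
  · simpa using hA u

/-- Resampling one coordinate. -/
theorem measurePreserving_update (ν : Measure ℝ) [IsProbabilityMeasure ν] (x : V) :
    MeasurePreserving (fun a : ℝ × (V → ℝ) => Function.update a.2 x a.1)
      (ν.prod (Measure.pi fun _ => ν)) (Measure.pi fun _ => ν) := by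
  have hm : Measurable (fun a : ℝ × (V → ℝ) => Function.update a.2 x a.1) := by
    refine measurable_pi_iff.2 fun u => ?_
    by_cases hu : u = x
    · subst hu
      simpa using measurable_fst
    · simpa [hu, Function.comp_def] using (measurable_pi_apply u).comp measurable_snd
  refine ⟨hm, (Measure.pi_eq fun s hs => ?_).symm⟩
  rw [Measure.map_apply hm (MeasurableSet.univ_pi hs)]
  have : (fun a : ℝ × (V → ℝ) => Function.update a.2 x a.1) ⁻¹' (Set.univ.pi s) =
      s x ×ˢ Set.univ.pi (Function.update s x Set.univ) := by
    ext ⟨a, π⟩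
    simp only [Set.mem_preimage, Set.mem_pi, Set.mem_univ, true_imp_iff, Set.mem_prod]
    constructor
    · intro h
      refine ⟨by simpa using h x, fun u => ?_⟩
      by_cases hu : u = x
      · subst hu; simp
      · simpa [hu] using h u
    · rintro ⟨h1, h2⟩ u
      by_cases hu : u = x
      · subst hu; simpa using h1
      · simpa [hu] using h2 u
  rw [this, Measure.prod_prod, Measure.pi_pi, ← Finset.mul_prod_erase _ _ (Finset.mem_univ x),
    ← Finset.mul_prod_erase _ _ (Finset.mem_univ x)]
  simp only [Function.update_self, measure_univ, one_mul]
  congr 1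
  exact Finset.prod_congr rfl fun u hu => by simp [Finset.ne_of_mem_erase hu]

theorem bitCut_iff (sel : List V → Clause V) (k : ℕ) {p : List V} {J : V → Bool}
    (hp : ∀ u ∈ p, J u = false) :
    bitCut sel k p J ↔ ∀ q ∈ descendants sel k p, ∃ u ∈ q, J u = true := by
  induction k generalizing p with
  | zero =>
    simp only [bitCut, descendants, Finset.mem_singleton, forall_eq, false_iff]
    rintro ⟨u, hu, h⟩
    simp [hp u hu] at h
  | succ k ih =>
    simp only [bitCut, descendants, Finset.mem_biUnion]
    constructor
    · rintro h q ⟨a, ha, hq⟩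
      by_cases hJ : J a = true
      · obtain ⟨l, -, rfl⟩ := exists_append_of_mem_descendants hq
        exact ⟨a, by simp, hJ⟩
      · refine (ih ?_).1 ((h a ha).resolve_left hJ) q hq
        intro u hu
        rcases List.mem_cons.1 hu with rfl | hu
        · simpa using hJ
        · exact hp u hu
    · intro h a ha
      by_cases hJ : J a = true
      · exact Or.inl hJ
      · refine Or.inr ((ih ?_).2 fun q hq => h q ⟨a, ha, hq⟩)
        intro u hu
        rcases List.mem_cons.1 hu with rfl | hu
        · simpa using hJ
        · exact hp u hu

/-- The bit of `x` is false since π x < π x fails, so the root may be included in the paths. -/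
theorem mem_cut_iff (sel : List V → Clause V) (x : V) (k : ℕ) (π : V → ℝ) :
    π ∈ cut sel x k ↔ bitCut sel k [x] fun u => decide (π u < π x) := by
  rw [bitCut_iff sel k (by simp)]
  simp [cut, level_eq_descendants]

theorem measurableSet_cut (sel : List V → Clause V) (x : V) (k : ℕ) :
    MeasurableSet (cut sel x k) := by
  have : cut sel x k = ⋂ p ∈ level sel x k, ⋃ u ∈ p, {π : V → ℝ | π u < π x} := by
    ext π
    simp [cut]
  rw [this]
  refine Finset.measurableSet_biInter _ fun p _ => ?_
  have : (⋃ u ∈ p, {π : V → ℝ | π u < π x}) = ⋃ u ∈ p.toFinset, {π : V → ℝ | π u < π x} := by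
    simp
  rw [this]
  exact Finset.measurableSet_biUnion _ fun u _ =>
    measurableSet_lt (measurable_pi_apply u) (measurable_pi_apply x)

end Discretization

/-! ### The correlation functions -/

/-- Needed at the junction 1/2, where the square root and the maximum with 0 are not differentiable
although γ and γ_TwoCC are. -/
theorem hasDerivAt_of_eq_sub_mul {f k : ℝ → ℝ} {a : ℝ} (h : ∀ s, f s = (s - a) * k s)
    (hk : ContinuousAt k a) : HasDerivAt f (k a) a := by
  rw [hasDerivAt_iff_tendsto_slope]
  refine (hk.tendsto.mono_left nhdsWithin_le_nhds).congr' ?_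
  filter_upwards [self_mem_nhdsWithin] with s hs
  have : s - a ≠ 0 := sub_ne_zero.2 hs
  rw [slope_def_field, h s, h a]
  field_simp
  simp

/-- The square root of a negative number is 0, so one formula covers both branches. -/
theorem gammaCorr_eq (s : ℝ) : gammaCorr s = s * (1 - 2 * s) * √(1 - 2 * s) := by
  unfold gammaCorr
  split_ifs with h
  · have h0 : 0 < 1 - 2 * s := by linarith
    rw [show (3 / 2 : ℝ) = 1 + 1 / 2 by norm_num, Real.rpow_add h0, Real.rpow_one,
      ← Real.sqrt_eq_rpow, mul_assoc]
  · rw [Real.sqrt_eq_zero_of_nonpos (by linarith), mul_zero]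

theorem hasDerivAt_gammaCorr (s : ℝ) :
    HasDerivAt gammaCorr (√(1 - 2 * s) * (1 - 5 * s)) s := by
  rw [show gammaCorr = fun s => s * (1 - 2 * s) * √(1 - 2 * s) from funext gammaCorr_eq]
  rcases lt_trichotomy s (1 / 2) with h | h | h
  · have h0 : 0 < 1 - 2 * s := by linarith
    have h1 : HasDerivAt (fun s : ℝ => 1 - 2 * s) (-2) s := by
      simpa using ((hasDerivAt_id s).const_mul 2).const_sub 1
    have h2 := ((hasDerivAt_id s).mul h1).mul (h1.sqrt h0.ne')
    refine h2.congr_deriv ?_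
    have hs : √(1 - 2 * s) ≠ 0 := (Real.sqrt_pos.2 h0).ne'
    have hsq : √(1 - 2 * s) ^ 2 = 1 - 2 * s := Real.sq_sqrt h0.le
    simp only [id, one_mul, Pi.mul_apply]
    field_simp
    rw [hsq]
    ring
  · subst h
    have := hasDerivAt_of_eq_sub_mul (f := fun s => s * (1 - 2 * s) * √(1 - 2 * s))
      (k := fun s => -2 * s * √(1 - 2 * s)) (a := 1 / 2) (fun s => by ring)
      (by fun_prop)
    convert this using 1
    norm_num
  · have : (fun _ : ℝ => (0 : ℝ)) =ᶠ[𝓝 s] fun s => s * (1 - 2 * s) * √(1 - 2 * s) := by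
      filter_upwards [lt_mem_nhds h] with t ht
      rw [Real.sqrt_eq_zero_of_nonpos (by linarith), mul_zero]
    rw [Real.sqrt_eq_zero_of_nonpos (by linarith), zero_mul]
    exact (hasDerivAt_const s (0 : ℝ)).congr_of_eventuallyEq this.symm

theorem phiCorr_eq : phiCorr = fun s => √(1 - 2 * s) * (1 - 5 * s) :=
  funext fun s => (hasDerivAt_gammaCorr s).deriv

theorem continuous_phiCorr : Continuous phiCorr := by
  rw [phiCorr_eq]
  fun_prop

theorem gammaTwoCC_eq (s : ℝ) : gammaTwoCC s = 25 * s ^ 3 * (max 0 (1 - 2 * s)) ^ 2 := by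
  unfold gammaTwoCC
  split_ifs with h
  · rw [max_eq_right (by linarith)]
  · rw [max_eq_left (by linarith)]
    simp

theorem hasDerivAt_gammaTwoCC (s : ℝ) :
    HasDerivAt gammaTwoCC (25 * s ^ 2 * max 0 (1 - 2 * s) * (3 - 10 * s)) s := by
  rcases lt_trichotomy s (1 / 2) with h | h | h
  · have : (fun s : ℝ => 25 * s ^ 3 * (1 - 2 * s) ^ 2) =ᶠ[𝓝 s] gammaTwoCC := by
      filter_upwards [gt_mem_nhds h] with t ht
      rw [gammaTwoCC, if_pos ht]
    refine HasDerivAt.congr_of_eventuallyEq ?_ this.symm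
    have h1 : HasDerivAt (fun s : ℝ => 1 - 2 * s) (-2) s := by
      simpa using ((hasDerivAt_id s).const_mul 2).const_sub 1
    have h2 := ((hasDerivAt_pow 3 s).const_mul 25).mul (h1.pow 2)
    refine h2.congr_deriv ?_
    rw [max_eq_right (by linarith)]
    simp
    ring
  · subst h
    have := hasDerivAt_of_eq_sub_mul (f := gammaTwoCC)
      (k := fun s => -50 * s ^ 3 * max 0 (1 - 2 * s)) (a := 1 / 2) (fun s => ?_)
      (by fun_prop)
    · convert this using 1
      norm_num
    · rw [gammaTwoCC_eq]
      rcases le_total 0 (1 - 2 * s) with h | h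
      · rw [max_eq_right h]; ring
      · rw [max_eq_left h]; ring
  · have : (fun _ : ℝ => (0 : ℝ)) =ᶠ[𝓝 s] gammaTwoCC := by
      filter_upwards [lt_mem_nhds h] with t ht
      rw [gammaTwoCC, if_neg (by linarith)]
    rw [max_eq_left (by linarith)]
    simpa using (hasDerivAt_const s (0 : ℝ)).congr_of_eventuallyEq this.symm

theorem phiTwoCC_eq : phiTwoCC = fun s => 25 * s ^ 2 * max 0 (1 - 2 * s) * (3 - 10 * s) :=
  funext fun s => (hasDerivAt_gammaTwoCC s).deriv

theorem continuous_phiTwoCC : Continuous phiTwoCC := by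
  rw [phiTwoCC_eq]
  fun_prop

theorem gammaCorr_nonneg {s : ℝ} (h : 0 ≤ s) : 0 ≤ gammaCorr s := by
  unfold gammaCorr
  split_ifs with h1
  · have : 0 ≤ 1 - 2 * s := by linarith
    positivity
  · exact le_rfl

theorem gammaTwoCC_nonneg {s : ℝ} (h : 0 ≤ s) : 0 ≤ gammaTwoCC s := by
  rw [gammaTwoCC_eq]
  positivity

/-- The uniform distribution on the unit interval. -/
noncomputable abbrev unitMeasure : Measure ℝ := (volume : Measure ℝ).restrict (Icc 0 1)

instance : IsProbabilityMeasure unitMeasure := ⟨by simp⟩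

/-- The integral of a derivative over the points on one side of `r`. -/
theorem integral_side {G f : ℝ → ℝ} (hG : ∀ s, HasDerivAt G (f s) s) (hf : Continuous f)
    {r : ℝ} (h0 : 0 ≤ r) (h1 : r ≤ 1) (t : Bool) :
    Integrable (fun s => (if decide (s < r) = t then 1 else 0) * f s) unitMeasure ∧
    ∫ s, (if decide (s < r) = t then 1 else 0) * f s ∂unitMeasure =
      if t then G r - G 0 else G 1 - G r := by
  have hint : Integrable f unitMeasure := hf.integrableOn_Icc
  cases t
  · have e : (fun s => (if decide (s < r) = false then 1 else 0) * f s) =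
        (Ici r).indicator f := by
      ext s
      by_cases hs : s < r
      · simp [hs]
      · simp [hs, not_lt.1 hs]
    rw [e]
    refine ⟨hint.indicator measurableSet_Ici, ?_⟩
    rw [integral_indicator measurableSet_Ici, Measure.restrict_restrict measurableSet_Ici,
      show Ici r ∩ Icc 0 1 = Icc r 1 by
        ext s
        simp only [mem_inter_iff, mem_Ici, mem_Icc]
        exact ⟨fun h => ⟨h.1, h.2.2⟩, fun h => ⟨h.1, h0.trans h.1, h.2⟩⟩,
      integral_Icc_eq_integral_Ioc, ← intervalIntegral.integral_of_le h1,
      intervalIntegral.integral_eq_sub_of_hasDerivAt (fun s _ => hG s)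
        (hf.intervalIntegrable _ _)]
    simp
  · have e : (fun s => (if decide (s < r) = true then 1 else 0) * f s) =
        (Iio r).indicator f := by
      ext s
      by_cases hs : s < r
      · simp [hs]
      · simp [hs]
    rw [e]
    refine ⟨hint.indicator measurableSet_Iio, ?_⟩
    rw [integral_indicator measurableSet_Iio, Measure.restrict_restrict measurableSet_Iio,
      show Iio r ∩ Icc 0 1 = Ico 0 r by
        ext s
        simp only [mem_inter_iff, mem_Iio, mem_Icc, mem_Ico]
        exact ⟨fun h => ⟨h.2.1, h.1⟩, fun h => ⟨h.2, h.1, h.2.le.trans h1⟩⟩,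
      integral_Ico_eq_integral_Ioc, ← intervalIntegral.integral_of_le h0,
      intervalIntegral.integral_eq_sub_of_hasDerivAt (fun s _ => hG s)
        (hf.intervalIntegrable _ _)]
    simp

/-! ### The mixture of matchings -/

section Mixture

variable {V : Type} [Fintype V] [DecidableEq V]

/-- The connected components that have edges. -/
abbrev EdgeComp (G : SimpleGraph V) : Type :=
  {C : G.ConnectedComponent // (componentEdges C).Nonempty}

open Classical in
noncomputable instance (G : SimpleGraph V) : Fintype (EdgeComp G) := Subtype.fintype _

open Classical in
noncomputable instance (G : SimpleGraph V) : DecidableEq (EdgeComp G) := Classical.decEq _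

/-- The choices of one edge of every component. -/
noncomputable def edgeChoices (G : SimpleGraph V) : Finset (EdgeComp G → Sym2 V) :=
  Fintype.piFinset fun i => componentEdges i.1

/-- The endpoints of the chosen edges. -/
def block {ι : Type} (M : ι → Sym2 V) (i : ι) : Finset V := (M i).toFinset

/-- The correlation coefficient of the chosen edge. -/
noncomputable def blockCoeff (ε : ℝ) {G : SimpleGraph V} (i : EdgeComp G) : ℝ :=
  ε * (componentEdges i.1).card

theorem mem_componentEdges {G : SimpleGraph V} {C : G.ConnectedComponent} {e : Sym2 V} :
    e ∈ componentEdges C ↔ e ∈ G.edgeSet ∧ ∀ v ∈ e, v ∈ C.supp := by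
  simp [componentEdges]

theorem mul_map_eq_prod {e : Sym2 V} (he : ¬ e.IsDiag) (f : V → ℝ) :
    (e.map f).mul = ∏ u ∈ e.toFinset, f u := by
  induction e with
  | h a b =>
    have hab : a ≠ b := by simpa using he
    rw [Sym2.map_mk, Sym2.mul_mk, Sym2.toFinset_mk_eq, Finset.prod_pair hab]

theorem edgeChoices_card_pos (G : SimpleGraph V) : 0 < (edgeChoices G).card :=
  Finset.card_pos.2 (Fintype.piFinset_nonempty.2 fun i => i.2)

/-- In a component with m edges, 1 + ε Σ φφ is the average over the edges of 1 + εm φφ. Multiplying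
out gives the uniform average over the choices of one edge from every component. Components without
edges contribute the factor 1. -/
theorem densityD_eq (ε : ℝ) (G : SimpleGraph V) (two : Finset V) (π : V → ℝ) :
    densityD ε G two π = ((edgeChoices G).card : ℝ)⁻¹ * ∑ M ∈ edgeChoices G,
      (∏ i, (1 + blockCoeff ε i * ∏ u ∈ block M i, phiCorr (π u))) *
        ∏ v ∈ two, (1 + ε * phiTwoCC (π v)) := by
  classical
  unfold densityD
  rw [← Finset.sum_mul, ← mul_assoc]
  congr 1
  have h1 : ∏ c : G.ConnectedComponent,
      (1 + ε * ∑ e ∈ componentEdges c, (e.map fun v => phiCorr (π v)).mul) =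
      ∏ i : EdgeComp G,
        (1 + ε * ∑ e ∈ componentEdges i.1, (e.map fun v => phiCorr (π v)).mul) := by
    rw [← Finset.prod_subtype (p := fun C : G.ConnectedComponent => (componentEdges C).Nonempty)
      (Finset.univ.filter fun C : G.ConnectedComponent => (componentEdges C).Nonempty)
      (fun C => by simp)
      (fun c => (1 + ε * ∑ e ∈ componentEdges c, (e.map fun v => phiCorr (π v)).mul))]
    symm
    refine Finset.prod_subset (Finset.filter_subset _ _) fun C _ hC => ?_
    have : componentEdges C = ∅ := by simpa using hC
    rw [this, Finset.sum_empty, mul_zero, add_zero]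
  have h2 : ∀ i : EdgeComp G,
      1 + ε * ∑ e ∈ componentEdges i.1, (e.map fun v => phiCorr (π v)).mul =
      ((componentEdges i.1).card : ℝ)⁻¹ *
        ∑ e ∈ componentEdges i.1, (1 + blockCoeff ε i * ∏ u ∈ e.toFinset, phiCorr (π u)) := by
    intro i
    have hpos : ((componentEdges i.1).card : ℝ) ≠ 0 := by
      simpa using i.2.ne_empty
    rw [Finset.sum_add_distrib, ← Finset.mul_sum, Finset.sum_const, nsmul_eq_mul, mul_one,
      blockCoeff]
    rw [Finset.sum_congr rfl fun e he => mul_map_eq_prod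
      (G.not_isDiag_of_mem_edgeSet (mem_componentEdges.1 he).1) fun v => phiCorr (π v)]
    field_simp
  calc _ = ∏ i : EdgeComp G,
        (1 + ε * ∑ e ∈ componentEdges i.1, (e.map fun v => phiCorr (π v)).mul) := by convert h1
    _ = _ := by
        rw [Finset.prod_congr rfl fun i _ => h2 i, Finset.prod_mul_distrib, Finset.prod_univ_sum]
        congr 1
        rw [Finset.prod_inv_distrib, edgeChoices, Fintype.card_piFinset, Nat.cast_prod]

theorem edgeChoices_disjoint {G : SimpleGraph V} {M : EdgeComp G → Sym2 V}
    (hM : M ∈ edgeChoices G) : Pairwise fun i j => Disjoint (block M i) (block M j) := by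
  intro i j hij
  rw [Finset.disjoint_left]
  intro u hu hu'
  have h1 := (mem_componentEdges.1 (Fintype.mem_piFinset.1 hM i)).2 u (Sym2.mem_toFinset.1 hu)
  have h2 := (mem_componentEdges.1 (Fintype.mem_piFinset.1 hM j)).2 u (Sym2.mem_toFinset.1 hu')
  rw [SimpleGraph.ConnectedComponent.mem_supp_iff] at h1 h2
  exact hij (Subtype.ext (h1.symm.trans h2))

theorem edgeChoices_card_block {G : SimpleGraph V} {M : EdgeComp G → Sym2 V}
    (hM : M ∈ edgeChoices G) (i : EdgeComp G) : (block M i).card = 2 := by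
  have h1 := (mem_componentEdges.1 (Fintype.mem_piFinset.1 hM i)).1
  exact Sym2.card_toFinset_of_not_isDiag _ (G.not_isDiag_of_mem_edgeSet h1)

theorem exists_adj_of_mem_block {G : SimpleGraph V} {M : EdgeComp G → Sym2 V}
    (hM : M ∈ edgeChoices G) {i : EdgeComp G} {u : V} (hu : u ∈ block M i) :
    ∃ b, G.Adj u b ∧ M i = s(u, b) := by
  have h1 := (mem_componentEdges.1 (Fintype.mem_piFinset.1 hM i)).1
  obtain ⟨b, hb⟩ := Sym2.mem_iff_exists.1 (Sym2.mem_toFinset.1 hu)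
  rw [hb] at h1
  exact ⟨b, h1, hb⟩

/-- The weights of the bits `π u < r`, given `π x = r`. -/
noncomputable def bitMass (ε : ℝ) (two : Finset V) (x : V) (r : ℝ) (u : V) (t : Bool) : ℝ :=
  if u = x then (if t then 0 else 1) else
    (if t then r else 1 - r) + if u ∈ two then (if t then 1 else -1) * (ε * gammaTwoCC r) else 0

/-- The conditional means of `phiCorr`, given the bits. -/
noncomputable def bitPhi (x : V) (r : ℝ) (u : V) (t : Bool) : ℝ :=
  if u = x then phiCorr r else if t then gammaCorr r / r else -gammaCorr r / (1 - r)

theorem integral_bitMass (ε : ℝ) (two : Finset V) (x : V) {r : ℝ} (h0 : 0 ≤ r) (h1 : r ≤ 1) (u : V)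
    (t : Bool) :
    Integrable (fun s => (if (if u = x then false else decide (s < r)) = t then (1 : ℝ) else 0) *
      if u ∈ two ∧ u ≠ x then 1 + ε * phiTwoCC s else 1) unitMeasure ∧
    ∫ s, (if (if u = x then false else decide (s < r)) = t then (1 : ℝ) else 0) *
      (if u ∈ two ∧ u ≠ x then 1 + ε * phiTwoCC s else 1) ∂unitMeasure = bitMass ε two x r u t := by
  unfold bitMass
  by_cases hx : u = x
  · cases t <;> simp [hx]
  · simp only [hx, if_false, ne_eq, not_false_eq_true, and_true]
    have hg0 : gammaTwoCC 0 = 0 := by simp [gammaTwoCC]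
    have hg1 : gammaTwoCC 1 = 0 := by simp [gammaTwoCC]; norm_num
    by_cases h2 : u ∈ two
    · simp only [h2, if_true]
      have hd : ∀ s, HasDerivAt (fun s => s + ε * gammaTwoCC s) (1 + ε * phiTwoCC s) s := by
        intro s
        rw [phiTwoCC_eq]
        exact (hasDerivAt_id s).add ((hasDerivAt_gammaTwoCC s).const_mul ε)
      have := integral_side hd (continuous_const.add (continuous_const.mul continuous_phiTwoCC))
        h0 h1 t
      refine ⟨this.1, this.2.trans ?_⟩
      cases t
      · simp [hg1]; ring
      · simp [hg0]
    · simp only [h2, if_false, add_zero]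
      have := integral_side (fun s => hasDerivAt_id s) continuous_const h0 h1 t
      refine ⟨this.1, this.2.trans ?_⟩
      cases t <;> simp

theorem hasDerivAt_phiCorr (s : ℝ) : HasDerivAt gammaCorr (phiCorr s) s := by
  rw [phiCorr_eq]
  exact hasDerivAt_gammaCorr s

theorem integral_bitPhi (ε : ℝ) {two : Finset V} (x : V) {r : ℝ} (h0 : 0 < r) (h1 : r < 1) {u : V}
    (t : Bool) :
    Integrable (fun s => ((if (if u = x then false else decide (s < r)) = t then (1 : ℝ) else 0) *
      if u ∈ two ∧ u ≠ x then 1 + ε * phiTwoCC s else 1) * if u = x then phiCorr r else phiCorr s)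
      unitMeasure ∧
    (u ∉ two → ∫ s, ((if (if u = x then false else decide (s < r)) = t then (1 : ℝ) else 0) *
      (if u ∈ two ∧ u ≠ x then 1 + ε * phiTwoCC s else 1)) *
        (if u = x then phiCorr r else phiCorr s) ∂unitMeasure =
      bitMass ε two x r u t * bitPhi x r u t) := by
  by_cases hx : u = x
  · have := integral_bitMass ε two x h0.le h1.le u t
    simp only [hx, if_true] at this ⊢
    refine ⟨this.1.mul_const _, fun _ => ?_⟩
    rw [integral_mul_const, this.2, bitPhi, if_pos rfl]
  · simp only [hx, if_false, ne_eq, not_false_eq_true, and_true]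
    constructor
    · by_cases h2 : u ∈ two
      · simp only [h2, if_true, mul_assoc]
        have hc : Continuous fun s => (1 + ε * phiTwoCC s) * phiCorr s :=
          (continuous_const.add (continuous_const.mul continuous_phiTwoCC)).mul continuous_phiCorr
        exact (integral_side (fun s => (hc.integral_hasStrictDerivAt 0 s).hasDerivAt) hc
          h0.le h1.le t).1
      · simp only [h2, if_false, mul_one]
        exact (integral_side (hasDerivAt_phiCorr) continuous_phiCorr
          h0.le h1.le t).1
    · intro h2
      simp only [h2, if_false, mul_one]
      rw [(integral_side (hasDerivAt_phiCorr) continuous_phiCorr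
          h0.le h1.le t).2]
      have hg0 : gammaCorr 0 = 0 := by simp [gammaCorr]
      have hg1 : gammaCorr 1 = 0 := by simp [gammaCorr]; norm_num
      have h1' : 1 - r ≠ 0 := by linarith
      simp only [bitMass, bitPhi, hx, h2, if_false, add_zero]
      cases t
      · simp [hg1]; field_simp
      · simp [hg0]; field_simp

/-- The density of one matching. -/
noncomputable def matchDensity (ε : ℝ) {G : SimpleGraph V} (two : Finset V)
    (M : EdgeComp G → Sym2 V) (π : V → ℝ) : ℝ :=
  (∏ i, (1 + blockCoeff ε i * ∏ u ∈ block M i, phiCorr (π u))) *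
    ∏ v ∈ two, (1 + ε * phiTwoCC (π v))

open Classical in
-- The event depends only on the bits. On the set with given bits the density is a product over
-- disjoint blocks, and its integral is given by the masses `bitMass` and the conditional means
-- `bitPhi`, which come from integrating φ and φ_TwoCC to γ and γ_TwoCC.
theorem integral_matchDensity (ε : ℝ) {G : SimpleGraph V} {two : Finset V}
    (hG : ∀ a b, G.Adj a b → a ∉ two) {M : EdgeComp G → Sym2 V} (hM : M ∈ edgeChoices G)
    {x : V} (hx : x ∉ two) {r : ℝ} (h0 : 0 < r) (h1 : r < 1) (sel : List V → Clause V) (k : ℕ) :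
    Integrable (fun π => (cut sel x k).indicator (matchDensity ε two M) (Function.update π x r))
      (Measure.pi fun _ : V => unitMeasure) ∧
    ∫ π, (cut sel x k).indicator (matchDensity ε two M) (Function.update π x r)
      ∂(Measure.pi fun _ : V => unitMeasure) =
    ∑ J, bitWeight (bitMass ε two x r) (bitPhi x r) (block M) (blockCoeff ε) J *
      if bitCut sel k [x] J then 1 else 0 := by
  have key := fun J : V → Bool => integral_prod_blocks unitMeasure (edgeChoices_disjoint hM)
    (blockCoeff ε)
    (fun u => (integral_bitMass ε two x h0.le h1.le u (J u)).1)
    (fun u => (integral_bitPhi ε x h0 h1 (two := two) (u := u) (J u)).1)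
    (fun u => (integral_bitMass ε two x h0.le h1.le u (J u)).2)
    (fun i u hu => (integral_bitPhi ε x h0 h1 (two := two) (u := u) (J u)).2 (by
      obtain ⟨b, hb, -⟩ := exists_adj_of_mem_block hM hu
      exact hG u b hb))
  have e : ∀ π : V → ℝ, (cut sel x k).indicator (matchDensity ε two M) (Function.update π x r) =
      ∑ J : V → Bool, (if bitCut sel k [x] J then 1 else 0) *
        ((∏ u, (if (if u = x then false else decide (π u < r)) = J u then (1 : ℝ) else 0) *
          if u ∈ two ∧ u ≠ x then 1 + ε * phiTwoCC (π u) else 1) *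
        ∏ i, (1 + blockCoeff ε i * ∏ u ∈ block M i, if u = x then phiCorr r else phiCorr (π u))) := by
    intro π
    set J₀ : V → Bool := fun u => if u = x then false else decide (π u < r) with hJ₀
    -- Only the bit vector of the placement itself survives; every other one meets a vanishing
    -- indicator.
    rw [Finset.sum_eq_single J₀]
    · have hmem : Function.update π x r ∈ cut sel x k ↔ bitCut sel k [x] J₀ := by
        rw [mem_cut_iff]
        have : (fun u => decide (Function.update π x r u < Function.update π x r x)) = J₀ := by
          ext u
          by_cases hu : u = x
          · simp [hJ₀, hu]
          · simp [hJ₀, hu]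
        rw [this]
      have hone : ∏ u, ((if (if u = x then false else decide (π u < r)) = J₀ u then (1 : ℝ) else 0) *
          if u ∈ two ∧ u ≠ x then 1 + ε * phiTwoCC (π u) else 1) =
          ∏ v ∈ two, (1 + ε * phiTwoCC (Function.update π x r v)) := by
        simp only [hJ₀, if_true, one_mul]
        rw [← Finset.prod_filter]
        have hf : (Finset.univ.filter fun u => u ∈ two ∧ u ≠ x) = two := by
          ext u
          simp only [Finset.mem_filter, Finset.mem_univ, true_and, and_iff_left_iff_imp]
          rintro hu rfl
          exact hx hu
        rw [hf]
        refine Finset.prod_congr rfl fun v hv => ?_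
        rw [Function.update_of_ne (ne_of_mem_of_not_mem hv hx)]
      have hphi : ∀ u, (if u = x then phiCorr r else phiCorr (π u)) =
          phiCorr (Function.update π x r u) := by
        intro u
        by_cases hu : u = x
        · simp [hu]
        · simp [hu]
      rw [hone, Set.indicator_apply]
      simp only [hmem, hphi, matchDensity]
      split_ifs
      · ring
      · ring
    · intro J _ hJ
      obtain ⟨u, hu⟩ := Function.ne_iff.1 hJ
      rw [Finset.prod_eq_zero (Finset.mem_univ u), zero_mul, mul_zero]
      rw [if_neg, zero_mul]
      exact fun h => hu h.symm
    · simp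
  simp only [e]
  refine ⟨integrable_finsetSum _ fun J _ => (key J).1.const_mul _, ?_⟩
  rw [integral_finsetSum _ fun J _ => (key J).1.const_mul _]
  refine Finset.sum_congr rfl fun J _ => ?_
  rw [integral_const_mul, (key J).2, bitWeight, mul_comm]

/-- The probability that the tree is cut, given `π x = r` and the matching. -/
noncomputable def bitCutProb (ε : ℝ) {G : SimpleGraph V} (two : Finset V)
    (M : EdgeComp G → Sym2 V) (sel : List V → Clause V) (x : V) (k : ℕ) (r : ℝ) : ℝ := by
  classical exact ∑ J, bitWeight (bitMass ε two x r) (bitPhi x r) (block M) (blockCoeff ε) J *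
    if bitCut sel k [x] J then 1 else 0

theorem continuous_densityD (ε : ℝ) (G : SimpleGraph V) (two : Finset V) :
    Continuous (densityD ε G two) := by
  rw [show densityD ε G two = _ from funext (densityD_eq ε G two)]
  have := continuous_phiCorr
  have := continuous_phiTwoCC
  fun_prop

theorem integrable_densityD (ε : ℝ) (G : SimpleGraph V) (two : Finset V) :
    Integrable (densityD ε G two) (Measure.pi fun _ : V => unitMeasure) := by
  rw [unitMeasure, ← Measure.restrict_pi_pi]
  exact (continuous_densityD ε G two).continuousOn.integrableOn_compact
    (isCompact_univ_pi fun _ => isCompact_Icc)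

/-- Lower bounds for the conditional probabilities give a lower bound for the probability of the
event. -/
theorem integral_le_distD_cut (ε : ℝ) {G : SimpleGraph V} {two : Finset V}
    (hG : ∀ a b, G.Adj a b → a ∉ two) {x : V} (hx : x ∉ two) (sel : List V → Clause V) (k : ℕ)
    {L : ℝ → ℝ} (hL : Integrable L unitMeasure)
    (h : ∀ r, 0 < r → r < 1 → L r ≤ ((edgeChoices G).card : ℝ)⁻¹ *
      ∑ M ∈ edgeChoices G, bitCutProb ε two M sel x k r) :
    ∫ r, L r ∂unitMeasure ≤ (distD ε G two).real (cut sel x k) := by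
  classical
  have hcut := measurableSet_cut sel x k
  have hint := (integrable_densityD ε G two).indicator hcut
  have hmp := measurePreserving_update (V := V) unitMeasure x
  have hint' := hmp.integrable_comp_of_integrable hint
  have hae : ∀ᵐ r ∂unitMeasure, 0 < r ∧ r < 1 := by
    rw [unitMeasure, ← restrict_Ioo_eq_restrict_Icc]
    exact ae_restrict_mem measurableSet_Ioo
  calc ∫ r, L r ∂unitMeasure
      ≤ ∫ r, (∫ π, (cut sel x k).indicator (densityD ε G two) (Function.update π x r)
          ∂(Measure.pi fun _ : V => unitMeasure)) ∂unitMeasure := by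
        refine integral_mono_ae hL hint'.integral_prod_left ?_
        filter_upwards [hae] with r hr
        refine (h r hr.1 hr.2).trans (le_of_eq ?_)
        have e : ∀ π : V → ℝ, (cut sel x k).indicator (densityD ε G two) (Function.update π x r) =
            ((edgeChoices G).card : ℝ)⁻¹ * ∑ M ∈ edgeChoices G,
              (cut sel x k).indicator (matchDensity ε two M) (Function.update π x r) := by
          intro π
          by_cases hπ : Function.update π x r ∈ cut sel x k
          · simp only [Set.indicator_of_mem hπ, densityD_eq, matchDensity]
          · simp only [Set.indicator_of_notMem hπ, Finset.sum_const_zero, mul_zero]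
        simp only [e]
        rw [integral_const_mul, integral_finsetSum _ fun M hM =>
          (integral_matchDensity ε hG hM hx hr.1 hr.2 sel k).1]
        congr 1
        refine Finset.sum_congr rfl fun M hM => ?_
        rw [(integral_matchDensity ε hG hM hx hr.1 hr.2 sel k).2, bitCutProb]
    _ = ∫ π, (cut sel x k).indicator (densityD ε G two) π
          ∂(Measure.pi fun _ : V => unitMeasure) := by
        have h1 := integral_map hmp.measurable.aemeasurable
          (f := (cut sel x k).indicator (densityD ε G two))
          (by rw [hmp.map_eq]; exact hint.aestronglyMeasurable)
        rw [hmp.map_eq] at h1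
        rw [h1]
        exact (integral_prod _ hint').symm
    _ = ∫ π in cut sel x k, densityD ε G two π ∂(Measure.pi fun _ : V => unitMeasure) :=
        integral_indicator hcut
    -- Truncation of negative values by `ENNReal.ofReal` can only increase the measure, so the sign
    -- of the density need not be known.
    _ ≤ _ := by
        have hi := (integrable_densityD ε G two).integrableOn (s := cut sel x k)
        rw [integral_eq_lintegral_pos_part_sub_lintegral_neg_part hi, Measure.real, distD,
          withDensity_apply _ hcut]
        linarith [ENNReal.toReal_nonneg (a := ∫⁻ π in cut sel x k, ENNReal.ofReal
          (-densityD ε G two π) ∂(Measure.pi fun _ : V => unitMeasure))]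

end Mixture

/-! ### Geometric means -/

section GeometricMean

variable {α : Type} {S : Finset α} {X Y : α → ℝ}

/-- The geometric mean over a finite set. -/
noncomputable def gmean (S : Finset α) (X : α → ℝ) : ℝ := (∏ M ∈ S, X M) ^ ((S.card : ℝ)⁻¹)

theorem gmean_nonneg (hX : ∀ M ∈ S, 0 ≤ X M) : 0 ≤ gmean S X :=
  Real.rpow_nonneg (Finset.prod_nonneg hX) _

theorem gmean_mul (hX : ∀ M ∈ S, 0 ≤ X M) (hY : ∀ M ∈ S, 0 ≤ Y M) :
    gmean S (fun M => X M * Y M) = gmean S X * gmean S Y := by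
  unfold gmean
  rw [Finset.prod_mul_distrib, Real.mul_rpow (Finset.prod_nonneg hX) (Finset.prod_nonneg hY)]

theorem gmean_const (hS : S.Nonempty) {c : ℝ} (hc : 0 ≤ c) : gmean S (fun _ => c) = c := by
  unfold gmean
  rw [Finset.prod_const, Real.pow_rpow_inv_natCast hc (Finset.card_pos.2 hS).ne']

theorem gmean_congr (h : ∀ M ∈ S, X M = Y M) : gmean S X = gmean S Y := by
  unfold gmean
  rw [Finset.prod_congr rfl h]

theorem gmean_le_avg (hS : S.Nonempty) (hX : ∀ M ∈ S, 0 ≤ X M) :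
    gmean S X ≤ (S.card : ℝ)⁻¹ * ∑ M ∈ S, X M := by
  have hpos : (0 : ℝ) < S.card := by exact_mod_cast Finset.card_pos.2 hS
  have := Real.geom_mean_le_arith_mean S (fun _ => 1) X (fun _ _ => zero_le_one) (by simpa using hS)
    hX
  simp only [Real.rpow_one, Finset.sum_const, nsmul_eq_mul, mul_one, one_mul] at this
  rw [gmean, mul_comm, ← div_eq_mul_inv]
  exact this

/-- Mahler's inequality: apply the inequality of the means to X/(X+Y) and Y/(X+Y), whose averages
sum to 1. -/
theorem gmean_add_le (hS : S.Nonempty) (hX : ∀ M ∈ S, 0 ≤ X M) (hY : ∀ M ∈ S, 0 ≤ Y M) :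
    gmean S X + gmean S Y ≤ gmean S fun M => X M + Y M := by
  have hpos : (0 : ℝ) < S.card := by exact_mod_cast Finset.card_pos.2 hS
  by_cases h : ∃ M ∈ S, X M + Y M = 0
  · obtain ⟨M, hM, h0⟩ := h
    have hx : X M = 0 := by linarith [hX M hM, hY M hM]
    have hy : Y M = 0 := by linarith [hX M hM, hY M hM]
    unfold gmean
    rw [Finset.prod_eq_zero hM hx, Finset.prod_eq_zero hM hy, Finset.prod_eq_zero hM h0,
      Real.zero_rpow (inv_ne_zero hpos.ne'), add_zero]
  · push Not at h
    have hp : ∀ M ∈ S, 0 < X M + Y M := fun M hM =>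
      lt_of_le_of_ne (add_nonneg (hX M hM) (hY M hM)) (h M hM).symm
    have hsplit : ∀ Z : α → ℝ, (∀ M ∈ S, 0 ≤ Z M) → gmean S Z =
        gmean S (fun M => Z M / (X M + Y M)) * gmean S fun M => X M + Y M := by
      intro Z hZ
      rw [← gmean_mul (fun M hM => div_nonneg (hZ M hM) (hp M hM).le) fun M hM => (hp M hM).le]
      exact gmean_congr fun M hM => (div_mul_cancel₀ _ (h M hM)).symm
    rw [hsplit X hX, hsplit Y hY, ← add_mul]
    refine mul_le_of_le_one_left (gmean_nonneg fun M hM => (hp M hM).le) ?_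
    have h1 := gmean_le_avg (X := fun M => X M / (X M + Y M)) hS
      fun M hM => div_nonneg (hX M hM) (hp M hM).le
    have h2 := gmean_le_avg (X := fun M => Y M / (X M + Y M)) hS
      fun M hM => div_nonneg (hY M hM) (hp M hM).le
    refine (add_le_add h1 h2).trans (le_of_eq ?_)
    rw [← mul_add, ← Finset.sum_add_distrib, Finset.sum_congr rfl fun M hM =>
      (add_div (X M) (Y M) (X M + Y M)).symm.trans (div_self (h M hM))]
    rw [Finset.sum_const, nsmul_eq_mul, mul_one, inv_mul_cancel₀ hpos.ne']

theorem gmean_prod {κ : Type} (s : Finset κ) (f : κ → α → ℝ) (hS : S.Nonempty)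
    (hf : ∀ a ∈ s, ∀ M ∈ S, 0 ≤ f a M) :
    gmean S (fun M => ∏ a ∈ s, f a M) = ∏ a ∈ s, gmean S (f a) := by
  classical
  induction s using Finset.induction_on with
  | empty => simpa using gmean_const hS zero_le_one
  | insert a s ha ih =>
    have hs : ∀ b ∈ s, ∀ M ∈ S, 0 ≤ f b M := fun b hb => hf b (Finset.mem_insert_of_mem hb)
    rw [Finset.prod_insert ha, ← ih hs, ← gmean_mul (hf a (Finset.mem_insert_self _ _))
      fun M hM => Finset.prod_nonneg fun b hb => hs b hb M hM]
    exact gmean_congr fun M _ => Finset.prod_insert ha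

/-- The geometric mean is the exponential of the average logarithm, and exp t ≥ 1 + t. -/
theorem one_add_avg_log_le_gmean (hX : ∀ M ∈ S, 0 < X M) :
    1 + (S.card : ℝ)⁻¹ * ∑ M ∈ S, Real.log (X M) ≤ gmean S X := by
  unfold gmean
  rw [Real.rpow_def_of_pos (Finset.prod_pos hX), Real.log_prod fun M hM => (hX M hM).ne',
    mul_comm (∑ M ∈ S, _), add_comm]
  exact Real.add_one_le_exp _

/-- The recursion uses only sums and products of nonnegative numbers: products commute with the
geometric mean, sums become inequalities in the required direction. -/
theorem treeVal_gmean_le {V : Type} [Fintype V] [DecidableEq V] {sel : List V → Clause V}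
    (hS : S.Nonempty) {q : α → List V → ℝ} (hq : ∀ M ∈ S, ∀ p, 0 ≤ q M p ∧ q M p ≤ 1) (k : ℕ)
    (p : List V) :
    treeVal sel (fun p => gmean S fun M => 1 - q M p) (fun p => gmean S fun M => q M p) k p ≤
      gmean S fun M => treeVal sel (fun p => 1 - q M p) (q M) k p := by
  have h0 : ∀ M ∈ S, ∀ p, 0 ≤ 1 - q M p := fun M hM p => by linarith [(hq M hM p).2]
  have hT : ∀ M ∈ S, ∀ k p, 0 ≤ treeVal sel (fun p => 1 - q M p) (q M) k p := fun M hM k p =>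
    (treeVal_mem (fun a p _ => ⟨h0 M hM _, (hq M hM _).1, by linarith⟩) k p).1
  induction k generalizing p with
  | zero => exact gmean_nonneg fun M hM => hT M hM 0 p
  | succ k ih =>
    simp only [treeVal]
    rw [gmean_prod _ _ hS fun a _ M hM =>
      add_nonneg (h0 M hM _) (mul_nonneg (hq M hM _).1 (hT M hM _ _))]
    have hq0 : ∀ a, 0 ≤ gmean S fun M => q M (a :: p) := fun a =>
      gmean_nonneg fun M hM => (hq M hM _).1
    have hp0 : ∀ a, 0 ≤ gmean S fun M => 1 - q M (a :: p) := fun a =>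
      gmean_nonneg fun M hM => h0 M hM _
    have hall : ∀ k p, 0 ≤ treeVal sel (fun p => gmean S fun M => 1 - q M p)
        (fun p => gmean S fun M => q M p) k p := fun k p =>
      (treeVal_mem (fun a p _ => ⟨gmean_nonneg fun M hM => h0 M hM _,
        gmean_nonneg fun M hM => (hq M hM _).1, by
          refine (gmean_add_le hS (fun M hM => h0 M hM _) fun M hM => (hq M hM _).1).trans ?_
          rw [gmean_congr (Y := fun _ => 1) fun M _ => by ring, gmean_const hS zero_le_one]⟩) k p).1
    refine Finset.prod_le_prod (fun a _ => add_nonneg (hp0 a) (mul_nonneg (hq0 a) (hall k _)))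
      fun a _ => ?_
    refine le_trans ?_ (gmean_add_le hS (fun M hM => h0 M hM _)
      fun M hM => mul_nonneg (hq M hM _).1 (hT M hM _ _))
    rw [gmean_mul (fun M hM => (hq M hM _).1) fun M hM => hT M hM _ _]
    gcongr
    · exact hq0 a
    · exact ih _

end GeometricMean

/-! ### The bit system of a matching -/

section Matching

variable {V : Type} [Fintype V] [DecidableEq V] {G : SimpleGraph V} {two : Finset V}
  {M : EdgeComp G → Sym2 V} {x z : V} {ε r ζ : ℝ}

/-- The relative loss at a label whose partner is on the path. -/
noncomputable def pathCorr (r : ℝ) : ℝ := r * (max 0 (1 - 2 * r)) ^ 3 / (1 - r)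

/-- The relative loss at a label whose partner is the root label. -/
noncomputable def rootCorr (r : ℝ) : ℝ := max 0 (5 * r - 1) * (max 0 (1 - 2 * r)) ^ 2

theorem gammaCorr_eq_max (r : ℝ) : gammaCorr r = r * max 0 (1 - 2 * r) * √(1 - 2 * r) := by
  rw [gammaCorr_eq]
  rcases le_total 0 (1 - 2 * r) with h | h
  · rw [max_eq_right h]
  · rw [Real.sqrt_eq_zero_of_nonpos h, mul_zero, mul_zero]

theorem sqrt_mul_sqrt_eq_max (r : ℝ) : √(1 - 2 * r) * √(1 - 2 * r) = max 0 (1 - 2 * r) := by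
  rcases le_total 0 (1 - 2 * r) with h | h
  · rw [max_eq_right h, Real.mul_self_sqrt h]
  · rw [Real.sqrt_eq_zero_of_nonpos h, mul_zero, max_eq_left h]

theorem gammaCorr_mul_self (r : ℝ) :
    gammaCorr r * gammaCorr r = r ^ 2 * (max 0 (1 - 2 * r)) ^ 3 := by
  rw [gammaCorr_eq_max]
  linear_combination r ^ 2 * (max 0 (1 - 2 * r)) ^ 2 * sqrt_mul_sqrt_eq_max r

theorem gammaCorr_mul_phiCorr (r : ℝ) :
    gammaCorr r * phiCorr r = r * (1 - 5 * r) * (max 0 (1 - 2 * r)) ^ 2 := by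
  rw [gammaCorr_eq_max, phiCorr_eq]
  linear_combination r * max 0 (1 - 2 * r) * (1 - 5 * r) * sqrt_mul_sqrt_eq_max r

theorem pathCorr_mem (h0 : 0 < r) (h1 : r < 1) : 0 ≤ pathCorr r ∧ pathCorr r ≤ 0.07 := by
  have h2 : 0 < 1 - r := by linarith
  unfold pathCorr
  refine ⟨by positivity, ?_⟩
  rw [div_le_iff₀ h2]
  rcases le_total 0 (1 - 2 * r) with h | h
  · rw [max_eq_right h]
    nlinarith [mul_nonneg h0.le (sq_nonneg (r - 0.14)), mul_nonneg h0.le (mul_nonneg h (sq_nonneg (r - 0.14))),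
      sq_nonneg (r - 0.14), mul_nonneg (mul_nonneg h0.le h) h]
  · rw [max_eq_left h]
    norm_num
    linarith

theorem rootCorr_mem (r : ℝ) : 0 ≤ rootCorr r ∧ rootCorr r ≤ 0.08 := by
  unfold rootCorr
  refine ⟨by positivity, ?_⟩
  rcases le_total 0 (1 - 2 * r) with h | h
  · rw [max_eq_right h]
    rcases le_total 0 (5 * r - 1) with h' | h'
    · rw [max_eq_right h']
      nlinarith [mul_nonneg h' (sq_nonneg (r - 0.3)), sq_nonneg (r - 0.3)]
    · rw [max_eq_left h']
      norm_num
  · rw [max_eq_left h]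
    norm_num

/-- The data of the construction that are fixed when `π x = r` is given; `ζ` is the probability that
`z` comes late. -/
structure IsCorrelation (ε : ℝ) (G : SimpleGraph V) (two : Finset V) (x z : V) (r ζ : ℝ) :
    Prop where
  eps_nonneg : 0 ≤ ε
  eps_le : ε ≤ 1 / 10
  pos : 0 < r
  lt_one : r < 1
  late_nonneg : 0 ≤ ζ
  late_le : ζ ≤ 1
  adj_not_two : ∀ a b, G.Adj a b → a ∉ two
  isolated : ∀ a, ¬ G.Adj z a
  root_not_two : x ∉ two
  not_two : z ∉ two
  ne_root : z ≠ x
  card_le : ∀ C : G.ConnectedComponent, (componentEdges C).card ≤ 22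

/-- The bit weights if `z` comes late with probability `ζ`. -/
noncomputable def bitMassAt (ε : ℝ) (two : Finset V) (x z : V) (r ζ : ℝ) (u : V) (t : Bool) : ℝ :=
  if u = z then (if t then 1 - ζ else ζ) else bitMass ε two x r u t

/-- The correlation coefficient of the component of a vertex. -/
noncomputable def vertexCoeff (ε : ℝ) (G : SimpleGraph V) (a : V) : ℝ :=
  ε * (componentEdges (G.connectedComponentMk a)).card

/-- The relative loss at a label whose partner is `b`. -/
noncomputable def partnerCorr (x : V) (r : ℝ) (q : List V) (b : V) : ℝ :=
  if b = x then rootCorr r else if b ∈ q then pathCorr r else 0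

open Classical in
/-- The neighbours of a vertex. -/
noncomputable def nbrs (G : SimpleGraph V) (a : V) : Finset V := Finset.univ.filter (G.Adj a)

theorem mem_nbrs {a b : V} : b ∈ nbrs G a ↔ G.Adj a b := by simp [nbrs]

open Classical in
/-- The relative loss at a node for a matching. -/
noncomputable def matchLoss (ε : ℝ) {G : SimpleGraph V} (M : EdgeComp G → Sym2 V) (x : V) (r : ℝ)
    (a : V) (q : List V) : ℝ :=
  ∑ b ∈ nbrs G a,
    if ∃ i, M i = s(a, b) then vertexCoeff ε G a * partnerCorr x r q b else 0

/-- A bound for the probability that a label comes late, for a matching. -/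
noncomputable def matchLate (ε : ℝ) {G : SimpleGraph V} (two : Finset V) (M : EdgeComp G → Sym2 V)
    (x z : V) (r ζ : ℝ) : List V → ℝ
  | [] => 0
  | a :: q => if a = z then ζ else if a ∈ two then 1 - r - ε * gammaTwoCC r else
      1 - r * (1 - matchLoss ε M x r a q)

theorem partnerCorr_mem (h0 : 0 < r) (h1 : r < 1) (q : List V) (b : V) :
    0 ≤ partnerCorr x r q b ∧ partnerCorr x r q b ≤ 0.08 := by
  have h2 := rootCorr_mem r
  have h3 := pathCorr_mem h0 h1
  unfold partnerCorr
  split_ifs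
  · exact h2
  · exact ⟨h3.1, by linarith⟩
  · norm_num

theorem gammaTwoCC_le (h0 : 0 < r) : gammaTwoCC r ≤ 1 - r ∨ 1 / 2 ≤ r := by
  unfold gammaTwoCC
  split_ifs with h
  · left
    have h1 : 0 < 1 - 2 * r := by linarith
    have h2 : r * (1 - 2 * r) ≤ 1 / 8 := by nlinarith [sq_nonneg (r - 1 / 4)]
    have h3 : 0 ≤ r * (1 - 2 * r) := by positivity
    calc 25 * r ^ 3 * (1 - 2 * r) ^ 2 = 25 * r * (r * (1 - 2 * r)) ^ 2 := by ring
      _ ≤ 25 * r * (1 / 8) ^ 2 := by gcongr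
      _ ≤ 1 - r := by linarith
  · right; linarith

theorem exists_block_iff {G : SimpleGraph V} {M : EdgeComp G → Sym2 V} (hM : M ∈ edgeChoices G)
    {i : EdgeComp G} {a : V} (ha : a ∈ block M i) :
    i.1 = G.connectedComponentMk a := by
  have h1 := (mem_componentEdges.1 (Fintype.mem_piFinset.1 hM i)).2 a (Sym2.mem_toFinset.1 ha)
  rw [SimpleGraph.ConnectedComponent.mem_supp_iff] at h1
  exact h1.symm

namespace IsCorrelation

theorem coeff_mem (S : IsCorrelation ε G two x z r ζ) (C : G.ConnectedComponent) :
    0 ≤ ε * (componentEdges C).card ∧ ε * (componentEdges C).card ≤ 2.2 := by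
  have h1 : ((componentEdges C).card : ℝ) ≤ 22 := by exact_mod_cast S.card_le C
  have := S.eps_nonneg
  have := S.eps_le
  constructor
  · positivity
  · nlinarith

theorem gain_mem (S : IsCorrelation ε G two x z r ζ) :
    0 ≤ ε * gammaTwoCC r ∧ ε * gammaTwoCC r ≤ 1 - r := by
  have h1 := gammaTwoCC_nonneg S.pos.le
  have h2 := S.lt_one
  have := S.eps_nonneg
  have := S.eps_le
  refine ⟨by positivity, ?_⟩
  rcases gammaTwoCC_le S.pos with h | h
  · nlinarith
  · rw [gammaTwoCC, if_neg (by linarith)]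
    linarith

/-- A coefficient is at most 22/10 = 2.2, and 2.2 · 0.4 < 1. The products that can be negative are
-γ(r)²/(r(1-r)) for bits of opposite sign, and φ(r) times a conditional mean if one label is the
root label. -/
theorem factor_nonneg_aux (S : IsCorrelation ε G two x z r ζ) {a b : V} (hab : a ≠ b) (s t : Bool)
    {c : ℝ} (hc0 : 0 ≤ c) (hc : c ≤ 2.2) : 0 ≤ 1 + c * (bitPhi x r a s * bitPhi x r b t) := by
  have h0 := S.pos
  have h2 : 0 < 1 - r := by linarith [S.lt_one]
  suffices h : -(0.4) ≤ bitPhi x r a s * bitPhi x r b t by nlinarith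
  have hg := gammaCorr_nonneg h0.le
  set w := max 0 (1 - 2 * r) with hw
  have hw0 : 0 ≤ w := le_max_left _ _
  have hw1 : w ≤ 1 := max_le zero_le_one (by linarith)
  have hrw : r * w ≤ 1 / 8 := by
    rcases le_total 0 (1 - 2 * r) with h | h
    · rw [hw, max_eq_right h]; nlinarith [sq_nonneg (r - 1 / 4)]
    · rw [hw, max_eq_left h]; norm_num
  have hrw' : w ≤ 1 - r := max_le h2.le (by linarith)
  have hroot : ∀ t : Bool, -(0.4) ≤
      phiCorr r * (if t then gammaCorr r / r else -gammaCorr r / (1 - r)) := by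
    intro t
    cases t
    · rw [if_neg (by simp), mul_div_assoc', le_div_iff₀ h2]
      have := gammaCorr_mul_phiCorr r
      have h3 : r * w * (w * (1 - 5 * r)) ≤ 1 / 8 * (1 - r) := by
        rcases le_total 0 (1 - 5 * r) with h | h
        · calc r * w * (w * (1 - 5 * r)) ≤ 1 / 8 * (1 * (1 - 5 * r)) := by gcongr
            _ ≤ _ := by linarith
        · have : r * w * (w * (1 - 5 * r)) ≤ 0 := by
            rw [← mul_assoc]
            exact mul_nonpos_of_nonneg_of_nonpos (by positivity) h
          linarith
      nlinarith
    · rw [if_pos rfl, mul_div_assoc', mul_comm, gammaCorr_mul_phiCorr]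
      have h3 := (rootCorr_mem r).2
      unfold rootCorr at h3
      rw [mul_assoc, mul_div_cancel_left₀ _ h0.ne']
      have h4 : (5 * r - 1) * w ^ 2 ≤ max 0 (5 * r - 1) * w ^ 2 :=
        mul_le_mul_of_nonneg_right (le_max_right _ _) (by positivity)
      linarith
  have hpath : 0.4 * (r * (1 - r)) ≥ gammaCorr r * gammaCorr r := by
    rw [gammaCorr_mul_self, ← hw]
    have : r ^ 2 * w ^ 3 = r * ((r * w) * (w * w)) := by ring
    rw [this]
    have h4 : (r * w) * (w * w) ≤ 1 / 8 * (1 * (1 - r)) := by gcongr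
    nlinarith
  unfold bitPhi
  by_cases ha : a = x
  · have hb : b ≠ x := fun h => hab (ha.trans h.symm)
    rw [if_pos ha, if_neg hb]
    exact hroot t
  · rw [if_neg ha]
    by_cases hb : b = x
    · rw [if_pos hb, mul_comm]
      exact hroot s
    · rw [if_neg hb]
      have e1 : (0 : ℝ) ≤ gammaCorr r / r * (gammaCorr r / r) := by positivity
      have e2 : (0 : ℝ) ≤ -gammaCorr r / (1 - r) * (-gammaCorr r / (1 - r)) := mul_self_nonneg _
      have e3 : -(0.4) ≤ gammaCorr r / r * (-gammaCorr r / (1 - r)) := by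
        rw [div_mul_div_comm, le_div_iff₀ (by positivity)]
        linarith
      cases s <;> cases t <;> simp only [if_true, Bool.false_eq_true, if_false] <;> linarith

theorem isBitSystem (S : IsCorrelation ε G two x z r ζ) (hM : M ∈ edgeChoices G) :
    IsBitSystem x (bitMassAt ε two x z r ζ) (bitPhi x r) (block M) (blockCoeff ε) where
  disjoint := edgeChoices_disjoint hM
  card := edgeChoices_card_block hM
  coeff_nonneg i := (S.coeff_mem i.1).1
  nonneg u t := by
    have h0 := S.pos
    have h1 := S.lt_one
    have h2 := S.gain_mem
    have h3 := S.late_nonneg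
    have h4 := S.late_le
    unfold bitMassAt bitMass
    cases t <;> simp only [if_true, Bool.false_eq_true, if_false] <;> split_ifs <;> linarith
  mono u := by
    have h0 := S.pos
    have h1 : 0 < 1 - r := by linarith [S.lt_one]
    have hg := gammaCorr_nonneg h0.le
    unfold bitPhi
    by_cases hu : u = x
    · simp only [hu, if_true, le_refl]
    · have e1 : 0 ≤ gammaCorr r / r := by positivity
      have e2 : -gammaCorr r / (1 - r) ≤ 0 := div_nonpos_of_nonpos_of_nonneg (by linarith) h1.le
      simp only [hu, Bool.false_eq_true, if_false, if_true]
      linarith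
  factor_nonneg i J := by
    obtain ⟨a, b, hab, hB⟩ := Finset.card_eq_two.1 (edgeChoices_card_block hM i)
    rw [hB, Finset.prod_pair hab]
    exact S.factor_nonneg_aux hab _ _ (S.coeff_mem i.1).1 (S.coeff_mem i.1).2
  sum_one u := by
    unfold bitMassAt bitMass
    simp only [if_true, Bool.false_eq_true, if_false]
    split_ifs <;> ring
  mean_zero i u hu hux := by
    obtain ⟨b, hb, -⟩ := exists_adj_of_mem_block hM hu
    have hz : u ≠ z := fun h => S.isolated b (h ▸ hb)
    have h2 := S.adj_not_two u b hb
    have h0 := S.pos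
    have h1 : 1 - r ≠ 0 := by linarith [S.lt_one]
    simp only [bitMassAt, bitMass, bitPhi, hz, hux, h2, if_true, Bool.false_eq_true, if_false]
    field_simp
    ring

open Classical in
-- Only the block of `a` matters. A partner off the path has conditional mean 0. A partner on the
-- path adds cγ²/(1-r) to the late probability, which is r c `pathCorr r`. For the root label as
-- partner the change is -cγ(r)φ(r); it is favourable for r < 1/5, and the maximum in `rootCorr`
-- discards that benefit.
theorem lateProb_le (S : IsCorrelation ε G two x z r ζ) (hM : M ∈ edgeChoices G) {a : V}
    (ha : a ≠ x) (q : List V) :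
    lateProb (bitMassAt ε two x z r ζ) (bitPhi x r) (block M) (blockCoeff ε) (a :: q) ≤
      matchLate ε two M x z r ζ (a :: q) := by
  have h0 := S.pos
  have h1 : 0 < 1 - r := by linarith [S.lt_one]
  rw [lateProb, matchLate]
  have hnone : (∀ b, ¬ G.Adj a b) → (∏ i, if a ∈ block M i then 1 + blockCoeff ε i *
      ∏ u ∈ block M i, (if u ∈ a :: q then bitPhi x r u false else 0) else 1) = 1 := by
    intro h
    refine Finset.prod_eq_one fun i _ => if_neg fun hi => ?_
    obtain ⟨b, hb, -⟩ := exists_adj_of_mem_block hM hi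
    exact h b hb
  by_cases hz : a = z
  · rw [hnone fun b => hz ▸ S.isolated b]
    simp [bitMassAt, hz]
  by_cases h2 : a ∈ two
  · rw [hnone fun b hb => S.adj_not_two a b hb h2]
    simp [bitMassAt, bitMass, hz, ha, h2]
  have hmass : bitMassAt ε two x z r ζ a false = 1 - r := by
    simp [bitMassAt, bitMass, hz, ha, h2]
  rw [if_neg hz, if_neg h2, hmass]
  have hcoeff : 0 ≤ vertexCoeff ε G a := (S.coeff_mem _).1
  have hterm : ∀ b, 0 ≤ if ∃ i, M i = s(a, b) then
      vertexCoeff ε G a * partnerCorr x r q b else 0 := by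
    intro b
    have := (partnerCorr_mem (x := x) h0 S.lt_one q b).1
    split_ifs <;> positivity
  have hloss0 : 0 ≤ matchLoss ε M x r a q := Finset.sum_nonneg fun b _ => hterm b
  by_cases hblock : ∃ i, a ∈ block M i
  · obtain ⟨i, hi⟩ := hblock
    obtain ⟨b, hb, hMi⟩ := exists_adj_of_mem_block hM hi
    have hab : a ≠ b := hb.ne
    have hbz : block M i = {a, b} := by rw [block, hMi, Sym2.toFinset_mk_eq]
    rw [Finset.prod_eq_single i (fun j _ hji => if_neg fun hj =>
      Finset.disjoint_left.1 (edgeChoices_disjoint hM hji) hj hi) (by simp), if_pos hi, hbz,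
      Finset.prod_pair hab]
    have hc : blockCoeff ε i = vertexCoeff ε G a := by
      rw [blockCoeff, vertexCoeff, exists_block_iff hM hi]
    rw [hc]
    set c := vertexCoeff ε G a with hcdef
    have hl : c * partnerCorr x r q b ≤ matchLoss ε M x r a q := by
      have := Finset.single_le_sum (f := fun b => if ∃ i, M i = s(a, b) then
        vertexCoeff ε G a * partnerCorr x r q b else 0) (fun b _ => hterm b)
        (mem_nbrs.2 hb)
      rw [if_pos ⟨i, hMi⟩] at this
      exact this
    have hl' : r * (c * partnerCorr x r q b) ≤ r * matchLoss ε M x r a q :=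
      mul_le_mul_of_nonneg_left hl h0.le
    have hpa : (if a ∈ a :: q then bitPhi x r a false else 0) = -gammaCorr r / (1 - r) := by
      simp [bitPhi, ha]
    rw [hpa]
    by_cases hbq : b ∈ a :: q
    · have hbq' : b ∈ q := by simpa [hab.symm] using hbq
      rw [if_pos hbq]
      by_cases hbx : b = x
      · have e1 : bitPhi x r b false = phiCorr r := by simp [bitPhi, hbx]
        have e2 : partnerCorr x r q b = rootCorr r := by simp [partnerCorr, hbx]
        rw [e2] at hl'
        rw [e1]
        have e3 : (1 - r) * (1 + c * (-gammaCorr r / (1 - r) * phiCorr r)) =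
            1 - r - c * (gammaCorr r * phiCorr r) := by
          field_simp
          ring
        rw [e3, gammaCorr_mul_phiCorr]
        have e4 : c * (r * ((5 * r - 1) * (max 0 (1 - 2 * r)) ^ 2)) ≤ c * (r * rootCorr r) := by
          unfold rootCorr
          gcongr
          exact le_max_right _ _
        linarith
      · have e1 : bitPhi x r b false = -gammaCorr r / (1 - r) := by simp [bitPhi, hbx]
        have e2 : partnerCorr x r q b = pathCorr r := by simp [partnerCorr, hbx, hbq']
        rw [e2] at hl'
        rw [e1]
        have e3 : (1 - r) * (1 + c * (-gammaCorr r / (1 - r) * (-gammaCorr r / (1 - r)))) =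
            1 - r + c * (gammaCorr r * gammaCorr r) / (1 - r) := by
          field_simp
        rw [e3, gammaCorr_mul_self]
        have e4 : c * (r ^ 2 * max 0 (1 - 2 * r) ^ 3) / (1 - r) = r * (c * pathCorr r) := by
          unfold pathCorr
          field_simp
        linarith
    · rw [if_neg hbq]
      have := mul_nonneg h0.le hloss0
      simp
      linarith
  · push Not at hblock
    rw [Finset.prod_eq_one fun i _ => if_neg (hblock i)]
    have := mul_nonneg h0.le hloss0
    linarith

end IsCorrelation

end Matching

/-! ### Averages over the matchings and conditioning on the bit of z. -/

section Averages

variable {V : Type} [Fintype V] [DecidableEq V] {G : SimpleGraph V} {two : Finset V}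
  {M : EdgeComp G → Sym2 V} {x z : V} {ε r ζ : ℝ}

theorem sum_ite_unique {s : Finset V} {P : V → Prop} [DecidablePred P]
    (h : ∀ b ∈ s, ∀ b' ∈ s, P b → P b' → b = b') :
    (∀ b ∈ s, ¬ P b) ∨ ∃ b ∈ s, P b ∧ ∀ v : V → ℝ, ∑ b ∈ s, (if P b then v b else 0) = v b := by
  by_cases hP : ∃ b ∈ s, P b
  · obtain ⟨b, hb, hPb⟩ := hP
    refine Or.inr ⟨b, hb, hPb, fun v => ?_⟩
    rw [Finset.sum_eq_single b (fun c hc hcb => if_neg fun hPc => hcb (h c hc b hb hPc hPb))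
      (fun hb' => absurd hb hb'), if_pos hPb]
  · push Not at hP
    exact Or.inl hP

theorem partner_unique (hM : M ∈ edgeChoices G) {a b b' : V} (h : ∃ i, M i = s(a, b))
    (h' : ∃ i, M i = s(a, b')) : b = b' := by
  obtain ⟨i, hi⟩ := h
  obtain ⟨j, hj⟩ := h'
  have hij : i = j := by
    by_contra hne
    have h1 : a ∈ block M i := by
      rw [block, hi, Sym2.mem_toFinset]
      exact Sym2.mem_mk_left a b
    have h2 : a ∈ block M j := by
      rw [block, hj, Sym2.mem_toFinset]
      exact Sym2.mem_mk_left a b'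
    exact Finset.disjoint_left.1 (edgeChoices_disjoint hM hne) h1 h2
  subst hij
  exact Sym2.congr_right.1 (hi.symm.trans hj)

open Classical in
-- At most one neighbour is the partner in `M`, so at most one term of the sum is nonzero and f can
-- be applied termwise.
theorem map_matchLoss (hM : M ∈ edgeChoices G) (f : ℝ → ℝ) (hf : f 0 = 0) (a : V) (q : List V) :
    f (matchLoss ε M x r a q) = ∑ b ∈ nbrs G a,
      if ∃ i, M i = s(a, b) then f (vertexCoeff ε G a * partnerCorr x r q b) else 0 := by
  unfold matchLoss
  rcases sum_ite_unique (s := nbrs G a) (P := fun b => ∃ i, M i = s(a, b))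
    (fun b _ b' _ h h' => partner_unique hM h h') with h | ⟨b, -, -, h⟩
  · rw [Finset.sum_eq_zero fun b hb => if_neg (h b hb),
      Finset.sum_eq_zero fun b hb => if_neg (h b hb), hf]
  · rw [h, h]

theorem IsCorrelation.matchLoss_mem (S : IsCorrelation ε G two x z r ζ) (hM : M ∈ edgeChoices G)
    (a : V) (q : List V) : 0 ≤ matchLoss ε M x r a q ∧ matchLoss ε M x r a q ≤ 0.176 := by
  classical
  have hc := S.coeff_mem (G.connectedComponentMk a)
  have hp := fun b => partnerCorr_mem (x := x) S.pos S.lt_one q b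
  have h1 : ∀ b, 0 ≤ vertexCoeff ε G a * partnerCorr x r q b ∧
      vertexCoeff ε G a * partnerCorr x r q b ≤ 0.176 := by
    intro b
    unfold vertexCoeff
    refine ⟨mul_nonneg hc.1 (hp b).1, ?_⟩
    calc _ ≤ 2.2 * 0.08 := mul_le_mul hc.2 (hp b).2 (hp b).1 (by norm_num)
      _ ≤ 0.176 := by norm_num
  unfold matchLoss
  rcases sum_ite_unique (s := nbrs G a) (P := fun b => ∃ i, M i = s(a, b))
    (fun b _ b' _ h h' => partner_unique hM h h') with h | ⟨b, -, -, h⟩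
  · rw [Finset.sum_eq_zero fun b hb => if_neg (h b hb)]
    norm_num
  · rw [h]
    exact h1 b

theorem IsCorrelation.matchLate_mem (S : IsCorrelation ε G two x z r ζ) (hM : M ∈ edgeChoices G)
    (p : List V) : 0 ≤ matchLate ε two M x z r ζ p ∧ matchLate ε two M x z r ζ p ≤ 1 := by
  have h0 := S.pos
  have h1 := S.lt_one
  cases p with
  | nil => simp [matchLate]
  | cons a q =>
    have h2 := S.gain_mem
    have h3 := S.late_nonneg
    have h4 := S.late_le
    have h5 := S.matchLoss_mem hM a q
    rw [matchLate]
    split_ifs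
    · exact ⟨h3, h4⟩
    · constructor <;> linarith
    · constructor <;> nlinarith

/-- The probability that the tree is cut, given `π x = r`, the matching, and the probability that
`z` comes late. -/
noncomputable def bitCutProbAt (ε : ℝ) {G : SimpleGraph V} (two : Finset V)
    (M : EdgeComp G → Sym2 V) (sel : List V → Clause V) (x z : V) (k : ℕ) (r ζ : ℝ) : ℝ := by
  classical exact ∑ J, bitWeight (bitMassAt ε two x z r ζ) (bitPhi x r) (block M) (blockCoeff ε) J *
    if bitCut sel k [x] J then 1 else 0

theorem bitMassAt_self (hz : z ∉ two) (hzx : z ≠ x) :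
    bitMassAt ε two x z r (1 - r) = bitMass ε two x r := by
  funext u t
  unfold bitMassAt
  split_ifs with h1 h2
  · simp [bitMass, h1, hzx, hz, h2]
  · simp [bitMass, h1, hzx, hz, h2]
  · rfl

theorem bitCutProb_eq (hz : z ∉ two) (hzx : z ≠ x) (sel : List V → Clause V) (k : ℕ) :
    bitCutProb ε two M sel x k r = bitCutProbAt ε two M sel x z k r (1 - r) := by
  rw [bitCutProb, bitCutProbAt, bitMassAt_self hz hzx]

/-- The weight is affine in ζ, because ζ enters only through the mass of the bit of `z`. For ζ = 1 -
r this is conditioning on that bit. -/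
theorem bitCutProbAt_eq_add (sel : List V → Clause V) (k : ℕ) :
    bitCutProbAt ε two M sel x z k r ζ = (1 - ζ) * bitCutProbAt ε two M sel x z k r 0 +
      ζ * bitCutProbAt ε two M sel x z k r 1 := by
  unfold bitCutProbAt
  rw [Finset.mul_sum, Finset.mul_sum, ← Finset.sum_add_distrib]
  refine Finset.sum_congr rfl fun J _ => ?_
  have h : ∀ ζ, bitWeight (bitMassAt ε two x z r ζ) (bitPhi x r) (block M) (blockCoeff ε) J =
      (if J z then 1 - ζ else ζ) * ((∏ u ∈ Finset.univ.erase z, bitMass ε two x r u (J u)) *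
        ∏ i, (1 + blockCoeff ε i * ∏ u ∈ block M i, bitPhi x r u (J u))) := by
    intro ζ
    rw [bitWeight, ← Finset.mul_prod_erase _ _ (Finset.mem_univ z), mul_assoc]
    congr 1
    · simp [bitMassAt]
    · congr 1
      exact Finset.prod_congr rfl fun u hu => by simp [bitMassAt, Finset.ne_of_mem_erase hu]
  rw [h ζ, h 0, h 1]
  split_ifs <;> ring

theorem IsCorrelation.treeVal_le_bitCutProbAt (S : IsCorrelation ε G two x z r ζ)
    (hM : M ∈ edgeChoices G) {F : Finset (Clause V)} {canon : V → Clause V}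
    {sel : List V → Clause V} (hs : IsClauseLabelling F canon sel) (k : ℕ) :
    treeVal sel (fun p => 1 - matchLate ε two M x z r ζ p) (matchLate ε two M x z r ζ) k [x] ≤
      bitCutProbAt ε two M sel x z k r ζ := by
  classical
  have hB := S.isBitSystem hM
  have h1 := hB.mul_treeVal_le hs (q := matchLate ε two M x z r ζ)
    (fun a p ha => S.lateProb_le hM ha p) (fun a p => S.matchLate_mem hM _) k
    (List.mem_singleton_self x)
  have hres : restrictFalse (bitMassAt ε two x z r ζ) [x] = bitMassAt ε two x z r ζ := by
    funext u t
    unfold restrictFalse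
    split_ifs with h
    · obtain ⟨h2, h3⟩ := h
      rw [List.mem_singleton] at h2
      subst h2
      simp [bitMassAt, bitMass, h3, S.ne_root.symm]
    · rfl
  have hZ := hB.sum_restrict (List.mem_singleton_self x)
  have e1 : (∏ u, if u ∈ [x] then bitMassAt ε two x z r ζ u false else 1) = 1 := by
    refine Finset.prod_eq_one fun u _ => ?_
    split_ifs with h
    · rw [List.mem_singleton] at h
      simp [bitMassAt, bitMass, h, S.ne_root.symm]
    · rfl
  have e2 : ∏ i, (1 + blockCoeff ε i * ∏ u ∈ block M i,
      if u ∈ [x] then bitPhi x r u false else 0) = 1 := by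
    refine Finset.prod_eq_one fun i _ => ?_
    have : ∃ b ∈ block M i, b ≠ x := by
      by_contra! h
      have := Finset.card_le_card (s := block M i) (t := {x})
        fun b hb => Finset.mem_singleton.2 (h b hb)
      rw [edgeChoices_card_block hM, Finset.card_singleton] at this
      omega
    obtain ⟨b, hb, hbx⟩ := this
    rw [Finset.prod_eq_zero hb (by simp [hbx])]
    ring
  rw [e1, e2, one_mul] at hZ
  rw [hZ, one_mul, hres] at h1
  exact h1

/-- The averaged probabilities. -/
noncomputable def avgEarly (ε : ℝ) (G : SimpleGraph V) (two : Finset V) (x z : V) (r ζ : ℝ)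
    (p : List V) : ℝ :=
  gmean (edgeChoices G) fun M => 1 - matchLate ε two M x z r ζ p

/-- Early and late averages sum to at most 1, usually not to 1; the missing mass is a second-order
loss. -/
noncomputable def avgLate (ε : ℝ) (G : SimpleGraph V) (two : Finset V) (x z : V) (r ζ : ℝ)
    (p : List V) : ℝ :=
  gmean (edgeChoices G) fun M => matchLate ε two M x z r ζ p

theorem edgeChoices_nonempty (G : SimpleGraph V) : (edgeChoices G).Nonempty :=
  Finset.card_pos.1 (edgeChoices_card_pos G)

theorem IsCorrelation.treeVal_le_avg (S : IsCorrelation ε G two x z r ζ)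
    {F : Finset (Clause V)} {canon : V → Clause V} {sel : List V → Clause V}
    (hs : IsClauseLabelling F canon sel) (k : ℕ) :
    treeVal sel (avgEarly ε G two x z r ζ) (avgLate ε G two x z r ζ) k [x] ≤
      ((edgeChoices G).card : ℝ)⁻¹ *
        ∑ M ∈ edgeChoices G, bitCutProbAt ε two M sel x z k r ζ := by
  have hT : ∀ M ∈ edgeChoices G, 0 ≤ treeVal sel (fun p => 1 - matchLate ε two M x z r ζ p)
      (matchLate ε two M x z r ζ) k [x] := fun M hM =>
    (treeVal_mem (fun a p _ => ⟨by linarith [(S.matchLate_mem hM (a :: p)).2],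
      (S.matchLate_mem hM _).1, by linarith⟩) k [x]).1
  calc _ ≤ gmean (edgeChoices G) fun M => treeVal sel (fun p => 1 - matchLate ε two M x z r ζ p)
        (matchLate ε two M x z r ζ) k [x] :=
        treeVal_gmean_le (edgeChoices_nonempty G) (fun M hM p => S.matchLate_mem hM p) k [x]
    _ ≤ _ := gmean_le_avg (edgeChoices_nonempty G) hT
    _ ≤ _ := by
        refine mul_le_mul_of_nonneg_left ?_ (by positivity)
        exact Finset.sum_le_sum fun M hM => S.treeVal_le_bitCutProbAt hM hs k

/-- In the full binary tree all probabilities are equal. -/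
theorem one_sub_nomUncut_le_treeVal {F : Finset (Clause V)} {canon : V → Clause V}
    {sel : List V → Clause V} (hF : IsUnique3CNF F) (hs : IsClauseLabelling F canon sel)
    {ph qh : List V → ℝ} (hr0 : 0 ≤ r) (hr1 : r ≤ 1) (hp : ∀ a q, ph (a :: q) = r)
    (hq : ∀ a q, qh (a :: q) = 1 - r) (k : ℕ) {p : List V} (hne : p ≠ []) :
    1 - nomUncut r k ≤ treeVal sel ph qh k p := by
  induction k generalizing p with
  | zero => simp [nomUncut, treeVal]
  | succ k ih =>
    have hU := nomUncut_mem hr0 hr1 k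
    have h0 : 0 ≤ 1 - (1 - r) * nomUncut r k := by nlinarith
    have h1 : 1 - (1 - r) * nomUncut r k ≤ 1 := by nlinarith
    rw [nomUncut, treeVal, sub_sub_cancel]
    calc _ ≤ (1 - (1 - r) * nomUncut r k) ^ (childLabels sel p).card :=
          pow_le_pow_of_le_one h0 h1 (hs.card_childLabels_le hF hne)
      _ = ∏ c ∈ childLabels sel p, (1 - (1 - r) * nomUncut r k) := by rw [Finset.prod_const]
      _ ≤ _ := by
          refine Finset.prod_le_prod (fun _ _ => h0) fun c _ => ?_
          rw [hp, hq]
          have := ih (p := c :: p) (by simp)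
          nlinarith

/-- For r ≥ 1/2 all correlation terms vanish, and every label is late with probability exactly 1 -
r. -/
theorem IsCorrelation.one_sub_nomUncut_le (S : IsCorrelation ε G two x z r (1 - r))
    (hr : 1 / 2 ≤ r)
    {F : Finset (Clause V)} {canon : V → Clause V} {sel : List V → Clause V}
    (hF : IsUnique3CNF F) (hs : IsClauseLabelling F canon sel) (k : ℕ) :
    1 - nomUncut r k ≤ ((edgeChoices G).card : ℝ)⁻¹ *
      ∑ M ∈ edgeChoices G, bitCutProb ε two M sel x k r := by
  have hw : max 0 (1 - 2 * r) = 0 := max_eq_left (by linarith)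
  have hlate : ∀ M ∈ edgeChoices G, ∀ a q, matchLate ε two M x z r (1 - r) (a :: q) = 1 - r := by
    intro M _ a q
    have h1 : gammaTwoCC r = 0 := by rw [gammaTwoCC_eq, hw]; simp
    have h2 : ∀ q b, partnerCorr x r q b = 0 := by
      intro q b
      simp [partnerCorr, rootCorr, pathCorr, hw]
    rw [matchLate, h1]
    simp [matchLoss, h2]
  have h := S.treeVal_le_avg hs k
  simp only [← bitCutProb_eq S.not_two S.ne_root] at h
  refine le_trans ?_ h
  refine one_sub_nomUncut_le_treeVal hF hs S.pos.le S.lt_one.le (fun a q => ?_) (fun a q => ?_) k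
    (by simp)
  · rw [avgEarly, gmean_congr (Y := fun _ => r) fun M hM => by rw [hlate M hM]; ring]
    exact gmean_const (edgeChoices_nonempty G) S.pos.le
  · rw [avgLate, gmean_congr (Y := fun _ => 1 - r) fun M hM => hlate M hM a q]
    exact gmean_const (edgeChoices_nonempty G) S.late_nonneg

end Averages

/-! ### The losses of the averaged probabilities -/

/-- The constant 0.6 exceeds 1/2 + 0.176/3 + 0.0378, for the quadratic term, the cubic term and the
remainder. -/
theorem neg_le_log_one_sub {v : ℝ} (h0 : 0 ≤ v) (h1 : v ≤ 0.176) :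
    -(v + 0.6 * v ^ 2) ≤ Real.log (1 - v) := by
  have h := Real.abs_log_sub_add_sum_range_le (x := v) (by rw [abs_of_nonneg h0]; linarith) 3
  rw [abs_of_nonneg h0] at h
  have h2 := (abs_le.1 h).1
  simp only [Finset.sum_range_succ, Finset.sum_range_zero] at h2
  norm_num at h2
  have h3 : v ^ 4 / (1 - v) ≤ 0.0378 * v ^ 2 := by
    rw [div_le_iff₀ (by linarith)]
    have h5 : v ^ 2 ≤ 0.0378 * (1 - v) := by nlinarith
    have h4 : v ^ 2 * v ^ 2 ≤ 0.0378 * (1 - v) * v ^ 2 :=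
      mul_le_mul_of_nonneg_right h5 (sq_nonneg v)
    nlinarith
  have h4 : v ^ 3 ≤ 0.176 * v ^ 2 := by
    have := mul_le_mul_of_nonneg_right h1 (sq_nonneg v)
    nlinarith
  nlinarith [sq_nonneg v]

theorem sub_sq_le_log_one_add {v : ℝ} (h0 : 0 ≤ v) : v - v ^ 2 / 2 ≤ Real.log (1 + v) := by
  refine le_trans ?_ (Real.le_log_one_add_of_nonneg h0)
  rw [le_div_iff₀ (by linarith)]
  nlinarith [mul_nonneg h0 (sq_nonneg v)]

/-- The relative loss at a label with a neighbour on the path. -/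
noncomputable def pathLoss (ε r : ℝ) : ℝ := 1.09 * ε * r ^ 2 * (1 - 2 * r) ^ 3 / (1 - r) ^ 2

/-- The relative loss at a neighbour of the root label. -/
noncomputable def rootLoss (ε r : ℝ) : ℝ := 1.15 * ε * r * rootCorr r / (1 - r)

/-! ### Numerical bounds for the losses. -/

section Numeric

variable {ε r : ℝ}

theorem rootCorr_le (h : r ≤ 1 / 2) : rootCorr r ≤ 6.25 * r ^ 2 * (1 - 2 * r) ^ 2 := by
  unfold rootCorr
  rw [max_eq_right (by linarith : 0 ≤ 1 - 2 * r)]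
  refine mul_le_mul_of_nonneg_right (max_le (by positivity) ?_) (sq_nonneg _)
  nlinarith [sq_nonneg (5 * r - 2)]

/-- The coefficients are 2.02 · 1.09 and 1.01 · 1.15 · 6.25, rounded up. -/
theorem maxLoss_le_poly (hε : 0 ≤ ε) (h0 : 0 < r) (h1 : r < 1 / 2) :
    maxLoss r (pathLoss ε r) (rootLoss ε r) ≤
      ε * (r ^ 2 * (1 - 2 * r) ^ 2 * (2.21 + 7.27 * r)) / (1 - r) ^ 2 := by
  have h2 : 0 < 1 - r := by linarith
  have h3 : 0 < 1 - 2 * r := by linarith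
  have hx := rootCorr_le h1.le
  have e1 : 2.02 * pathLoss ε r / (1 - 2 * r) =
      ε * (2.2018 * r ^ 2 * (1 - 2 * r) ^ 2) / (1 - r) ^ 2 := by
    unfold pathLoss
    field_simp
    ring
  have e2 : 1.01 * rootLoss ε r / (1 - r) = ε * (1.1615 * r * rootCorr r) / (1 - r) ^ 2 := by
    unfold rootLoss
    field_simp
    ring
  rw [maxLoss, e1, e2, ← add_div, ← mul_add]
  gcongr
  have : 1.1615 * r * rootCorr r ≤ 1.1615 * r * (6.25 * r ^ 2 * (1 - 2 * r) ^ 2) := by gcongr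
  have h4 : 0 ≤ r ^ 2 * (1 - 2 * r) ^ 2 := by positivity
  have h5 : 0 ≤ r ^ 2 * (1 - 2 * r) ^ 2 * r := by positivity
  nlinarith

theorem maxLoss_le_sq (hε : 0 ≤ ε) (hε' : ε ≤ 1 / 10) (h0 : 0 < r) (h1 : r < 1 / 2) :
    maxLoss r (pathLoss ε r) (rootLoss ε r) ≤ 0.4 * r ^ 2 := by
  have h2 : 0 < 1 - r := by linarith
  have h3 : 0 < 1 - 2 * r := by linarith
  refine (maxLoss_le_poly hε h0 h1).trans ?_
  rw [div_le_iff₀ (by positivity)]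
  calc ε * (r ^ 2 * (1 - 2 * r) ^ 2 * (2.21 + 7.27 * r))
      ≤ 1 / 10 * (r ^ 2 * (1 - 2 * r) ^ 2 * (2.21 + 7.27 * r)) := by gcongr
    _ = r ^ 2 * ((1 - 2 * r) ^ 2 * (0.221 + 0.727 * r)) := by ring
    _ ≤ r ^ 2 * (0.4 * (1 - r) ^ 2) := by
        refine mul_le_mul_of_nonneg_left ?_ (sq_nonneg r)
        nlinarith [mul_nonneg h0.le h3.le, mul_nonneg (mul_nonneg h0.le h3.le) h0.le]
    _ = _ := by ring

theorem maxLoss_small (hε : 0 ≤ ε) (hε' : ε ≤ 1 / 10) (h0 : 0 < r) (h1 : r < 1 / 2) :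
    2 * r * maxLoss r (pathLoss ε r) (rootLoss ε r) ≤ 0.01 := by
  have h2 : 0 < 1 - r := by linarith
  have h3 : 0 < 1 - 2 * r := by linarith
  have h := maxLoss_le_poly hε h0 h1
  rw [le_div_iff₀ (by positivity)] at h
  have key : 2 * r * (1 / 10 * (r ^ 2 * (1 - 2 * r) ^ 2 * (2.21 + 7.27 * r))) ≤
      0.01 * (1 - r) ^ 2 := by
    set P := 2.21 * r + 7.27 * r ^ 2 with hP
    have hP0 : 0 ≤ P := by positivity
    have h5 : 0 ≤ r * (1 - 2 * r) := by positivity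
    -- After taking roots the claim reads r(1-2r)√P ≤ √0.05 (1-r). To keep it polynomial, √P is
    -- replaced by 0.4055 P + 0.6166, a line just above it.
    have h4 : r * (1 - 2 * r) * (0.4055 * P + 0.6166) ≤ 0.2236 * (1 - r) := by
      nlinarith [sq_nonneg (r - 0.335), mul_nonneg h0.le (sq_nonneg (r - 0.335)),
        mul_nonneg h3.le (sq_nonneg (r - 0.335)),
        mul_nonneg (mul_nonneg h0.le h3.le) (sq_nonneg (r - 0.335)), mul_nonneg h0.le h3.le]
    have h6 : P ≤ (0.4055 * P + 0.6166) ^ 2 := by nlinarith [sq_nonneg (0.4055 * P - 0.6166)]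
    calc 2 * r * (1 / 10 * (r ^ 2 * (1 - 2 * r) ^ 2 * (2.21 + 7.27 * r)))
        = 0.2 * (P * (r * (1 - 2 * r)) ^ 2) := by rw [hP]; ring
      _ ≤ 0.2 * ((0.4055 * P + 0.6166) ^ 2 * (r * (1 - 2 * r)) ^ 2) := by gcongr
      _ = 0.2 * (r * (1 - 2 * r) * (0.4055 * P + 0.6166)) ^ 2 := by ring
      _ ≤ 0.2 * (0.2236 * (1 - r)) ^ 2 := by gcongr
      _ ≤ _ := by nlinarith [sq_nonneg (1 - r)]
  have h7 : maxLoss r (pathLoss ε r) (rootLoss ε r) * (1 - r) ^ 2 ≤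
      1 / 10 * (r ^ 2 * (1 - 2 * r) ^ 2 * (2.21 + 7.27 * r)) := h.trans (by gcongr)
  have h8 : 0 < (1 - r) ^ 2 := by positivity
  refine le_of_mul_le_mul_right ?_ h8
  nlinarith

/-- The shape of γ_TwoCC serves this estimate: r³(1-2r)² matches the order of the losses, and the
coefficient 25 exceeds what 2(2.21 + 7.27 r) ≤ 25(1-r) requires. -/
theorem maxLoss_le_gain (hε : 0 ≤ ε) (h0 : 0 < r) (h1 : r < 1 / 2) :
    2 * r * maxLoss r (pathLoss ε r) (rootLoss ε r) ≤ ε * gammaTwoCC r / (1 - r) := by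
  have h2 : 0 < 1 - r := by linarith
  have h3 : 0 < 1 - 2 * r := by linarith
  rw [gammaTwoCC, if_pos h1]
  have h := mul_le_mul_of_nonneg_left (maxLoss_le_poly hε h0 h1) (by positivity : 0 ≤ 2 * r)
  refine h.trans ?_
  rw [mul_div_assoc', div_le_div_iff₀ (by positivity) h2]
  have h4 : 0 ≤ ε * r ^ 3 * (1 - 2 * r) ^ 2 * (1 - r) := by positivity
  have h5 : 2 * (2.21 + 7.27 * r) ≤ 25 * (1 - r) := by linarith
  nlinarith [mul_le_mul_of_nonneg_left h5 h4]

/-- The second-order terms of the logarithms add at most 15 percent to the first-order loss, whence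
the constant 1.15 in `rootLoss`. The factor 2.2 bounds the correlation coefficient. -/
theorem rootCorr_error (h0 : 0 < r) (h1 : r < 1 / 2) :
    (0.6 + (r / (1 - r)) ^ 3 / 2) * (2.2 * rootCorr r) ≤ 0.15 * limUncut r := by
  have h2 : 0 < 1 - r := by linarith
  have h3 : 0 < 1 - 2 * r := by linarith
  unfold rootCorr limUncut
  rw [max_eq_right h3.le]
  rcases le_total (5 * r - 1) 0 with h | h
  · rw [max_eq_left h, zero_mul, mul_zero, mul_zero]
    positivity
  · rw [max_eq_right h, mul_div_assoc', le_div_iff₀ (by positivity)]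
    have e : (0.6 + (r / (1 - r)) ^ 3 / 2) * (1 - r) ^ 2 =
        0.6 * (1 - r) ^ 2 + r ^ 3 / (2 * (1 - r)) := by
      field_simp
    have h4 : r ^ 3 / (2 * (1 - r)) ≤ r ^ 3 :=
      div_le_self (by positivity) (by linarith)
    have h5 : 2.2 * ((5 * r - 1) * (1 - 2 * r)) * (0.6 * (1 - r) ^ 2 + r ^ 3) ≤ 0.15 := by
      nlinarith [mul_nonneg h (sq_nonneg (r - 0.335)), mul_nonneg h3.le (sq_nonneg (r - 0.335)),
        mul_nonneg (mul_nonneg h h3.le) (sq_nonneg (r - 0.335)), sq_nonneg (r - 0.335),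
        mul_nonneg h0.le (sq_nonneg (r - 0.335)), mul_nonneg (mul_nonneg h h0.le) (sq_nonneg (r - 0.335)),
        mul_nonneg (mul_nonneg (mul_nonneg h h3.le) h0.le) (sq_nonneg (r - 0.335))]
    have h6 : 0 ≤ 2.2 * ((5 * r - 1) * (1 - 2 * r)) := by positivity
    calc (0.6 + (r / (1 - r)) ^ 3 / 2) * (2.2 * ((5 * r - 1) * (1 - 2 * r) ^ 2)) * (1 - r) ^ 2
        = 2.2 * ((5 * r - 1) * (1 - 2 * r)) * ((0.6 + (r / (1 - r)) ^ 3 / 2) * (1 - r) ^ 2) *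
          (1 - 2 * r) := by ring
      _ ≤ 2.2 * ((5 * r - 1) * (1 - 2 * r)) * (0.6 * (1 - r) ^ 2 + r ^ 3) * (1 - 2 * r) := by
          rw [e]; gcongr
      _ ≤ _ := by gcongr

/-- The analogous 9 percent behind the constant 1.09 in `pathLoss`. -/
theorem pathCorr_error (h0 : 0 < r) (h1 : r < 1 / 2) :
    (0.6 + (r / (1 - r)) ^ 3 / 2) * (2.2 * pathCorr r) ≤ 0.09 * limUncut r := by
  have h2 : 0 < 1 - r := by linarith
  have h3 : 0 < 1 - 2 * r := by linarith
  unfold pathCorr limUncut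
  rw [max_eq_right h3.le]
  have e : (0.6 + (r / (1 - r)) ^ 3 / 2) * (1 - r) = 0.6 * (1 - r) + r ^ 3 / (2 * (1 - r) ^ 2) := by
    field_simp
  have h4 : r ^ 3 / (2 * (1 - r) ^ 2) ≤ 2 * r ^ 3 := by
    rw [div_le_iff₀ (by positivity)]
    have : 1 ≤ 4 * (1 - r) ^ 2 := by nlinarith
    have h5 : 0 < r ^ 3 := by positivity
    nlinarith
  have h5 : 2.2 * (r * (1 - 2 * r) ^ 2) * (0.6 * (1 - r) + 2 * r ^ 3) ≤ 0.09 := by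
    have h6 : r * (1 - 2 * r) ^ 2 ≤ 0.0741 := by
      nlinarith [mul_nonneg h0.le (sq_nonneg (r - 1 / 6)), sq_nonneg (r - 1 / 6)]
    have h7 : 0.6 * (1 - r) + 2 * r ^ 3 ≤ 0.6 := by nlinarith [mul_nonneg h0.le h0.le]
    have h8 : r * (1 - 2 * r) ^ 2 * (0.6 * (1 - r) + 2 * r ^ 3) ≤ 0.0405 := by
      nlinarith [mul_nonneg h0.le (sq_nonneg (r - 1 / 6)), sq_nonneg (r - 1 / 6),
        mul_nonneg (mul_nonneg h0.le h3.le) (sq_nonneg (r - 1 / 6)),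
        mul_nonneg h3.le (sq_nonneg (r - 1 / 6)), mul_nonneg h0.le h3.le]
    linarith
  rw [← mul_div_assoc 0.09, le_div_iff₀ (by positivity)]
  calc (0.6 + (r / (1 - r)) ^ 3 / 2) * (2.2 * (r * (1 - 2 * r) ^ 3 / (1 - r))) * (1 - r) ^ 2
      = 2.2 * (r * (1 - 2 * r) ^ 2) * ((0.6 + (r / (1 - r)) ^ 3 / 2) * (1 - r)) * (1 - 2 * r) := by
        field_simp
    _ ≤ 2.2 * (r * (1 - 2 * r) ^ 2) * (0.6 * (1 - r) + 2 * r ^ 3) * (1 - 2 * r) := by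
        rw [e]; gcongr
    _ ≤ _ := by gcongr

end Numeric

/-! ### The averaged probabilities satisfy the hypotheses on a lossy tree. -/

section Lossy

variable {V : Type} [Fintype V] [DecidableEq V] {G : SimpleGraph V} {two : Finset V}
  {x z : V} {ε r ζ : ℝ}

open Classical in
/-- Every edge of a component is chosen with the same probability. -/
theorem avg_edgeChoices {a b : V} (hab : G.Adj a b) (t : ℝ) :
    ((edgeChoices G).card : ℝ)⁻¹ * ∑ M ∈ edgeChoices G, (if ∃ i, M i = s(a, b) then t else 0) =
      t / (componentEdges (G.connectedComponentMk a)).card := by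
  have hmem : s(a, b) ∈ componentEdges (G.connectedComponentMk a) := by
    rw [mem_componentEdges]
    refine ⟨hab, fun v hv => ?_⟩
    rw [SimpleGraph.ConnectedComponent.mem_supp_iff]
    rcases Sym2.mem_iff.1 hv with rfl | rfl
    · rfl
    · exact SimpleGraph.ConnectedComponent.sound hab.symm.reachable
  set i₀ : EdgeComp G := ⟨G.connectedComponentMk a, ⟨_, hmem⟩⟩ with hi₀
  have hiff : ∀ M ∈ edgeChoices G, ((∃ i, M i = s(a, b)) ↔ M i₀ = s(a, b)) := by
    intro M hM
    refine ⟨?_, fun h => ⟨_, h⟩⟩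
    rintro ⟨i, hi⟩
    have : i = i₀ := Subtype.ext (exists_block_iff hM (i := i) (a := a) (by
      rw [block, hi, Sym2.mem_toFinset]
      exact Sym2.mem_mk_left a b))
    rw [← this, hi]
  have hcard : ((edgeChoices G).filter fun M => M i₀ = s(a, b)).card *
      (componentEdges (G.connectedComponentMk a)).card = (edgeChoices G).card := by
    rw [edgeChoices, Fintype.card_filter_piFinset_eq_of_mem (fun i : EdgeComp G => componentEdges i.1) i₀ hmem, Fintype.card_piFinset,
      ← Finset.prod_erase_mul _ _ (Finset.mem_univ i₀)]
  rw [Finset.sum_congr rfl fun M hM => by rw [if_congr (hiff M hM) rfl rfl], ← Finset.sum_filter,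
    Finset.sum_const, nsmul_eq_mul]
  have h1 : (0 : ℝ) < (edgeChoices G).card := by exact_mod_cast edgeChoices_card_pos G
  have h2 : (0 : ℝ) < (componentEdges (G.connectedComponentMk a)).card := by
    exact_mod_cast Finset.card_pos.2 ⟨_, hmem⟩
  have h3 : (((edgeChoices G).filter fun M => M i₀ = s(a, b)).card : ℝ) *
      (componentEdges (G.connectedComponentMk a)).card = (edgeChoices G).card := by
    exact_mod_cast hcard
  rw [← h3] at h1 ⊢
  have h4 : (((edgeChoices G).filter fun M => M i₀ = s(a, b)).card : ℝ) ≠ 0 := by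
    rintro h
    rw [h, zero_mul] at h1
    exact lt_irrefl _ h1
  field_simp

theorem avg_map_matchLoss (f : ℝ → ℝ) (hf : f 0 = 0) (a : V) (q : List V) :
    ((edgeChoices G).card : ℝ)⁻¹ * ∑ M ∈ edgeChoices G, f (matchLoss ε M x r a q) =
      ∑ b ∈ nbrs G a,
        f (vertexCoeff ε G a * partnerCorr x r q b) /
          (componentEdges (G.connectedComponentMk a)).card := by
  classical
  rw [Finset.sum_congr rfl fun M hM => map_matchLoss hM f hf a q, Finset.sum_comm, Finset.mul_sum]
  exact Finset.sum_congr rfl fun b hb => avg_edgeChoices (mem_nbrs.1 hb) _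

theorem gmean_const_mul {α : Type} {S : Finset α} {X : α → ℝ} (hS : S.Nonempty) {c : ℝ}
    (hc : 0 ≤ c) (hX : ∀ M ∈ S, 0 ≤ X M) : gmean S (fun M => c * X M) = c * gmean S X := by
  rw [gmean_mul (fun _ _ => hc) hX, gmean_const hS hc]

/-- An edge of a component with m edges is chosen with probability 1/m and then has coefficient εm.
To first order the averaged loss is therefore ε times `partnerCorr`, whatever m is; the size of the
component enters only in the second-order terms. -/
theorem IsCorrelation.bounds (S : IsCorrelation ε G two x z r ζ) (h2 : r < 1 / 2) {c : V}
    (hz : c ≠ z) (hc : c ∉ two) (q : List V) :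
    r * (1 - ∑ b ∈ nbrs G c, ε * partnerCorr x r q b *
        (1 + 0.6 * (vertexCoeff ε G c * partnerCorr x r q b))) ≤
      avgEarly ε G two x z r ζ (c :: q) ∧
    (1 - r) * (1 + ∑ b ∈ nbrs G c, ε * partnerCorr x r q b * (r / (1 - r) *
        (1 - r / (1 - r) * (vertexCoeff ε G c * partnerCorr x r q b) / 2))) ≤
      avgLate ε G two x z r ζ (c :: q) := by
  have h0 := S.pos
  have h1 : 0 < 1 - r := by linarith
  have hS := edgeChoices_nonempty G
  have hm := fun M hM => S.matchLoss_mem (M := M) hM c q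
  have hv : ∀ b, 0 ≤ vertexCoeff ε G c * partnerCorr x r q b ∧
      vertexCoeff ε G c * partnerCorr x r q b ≤ 0.176 := by
    intro b
    have hc := S.coeff_mem (G.connectedComponentMk c)
    have hp := partnerCorr_mem (x := x) S.pos S.lt_one q b
    refine ⟨mul_nonneg hc.1 hp.1, ?_⟩
    calc _ ≤ 2.2 * 0.08 := mul_le_mul hc.2 hp.2 hp.1 (by norm_num)
      _ ≤ 0.176 := by norm_num
  have hmc : ∀ b ∈ nbrs G c, ∀ t : ℝ, vertexCoeff ε G c * t /
      (componentEdges (G.connectedComponentMk c)).card = ε * t := by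
    intro b hb t
    have hmem : s(c, b) ∈ componentEdges (G.connectedComponentMk c) := by
      rw [mem_componentEdges]
      refine ⟨mem_nbrs.1 hb, fun v hv => ?_⟩
      rw [SimpleGraph.ConnectedComponent.mem_supp_iff]
      rcases Sym2.mem_iff.1 hv with rfl | rfl
      · rfl
      · exact SimpleGraph.ConnectedComponent.sound (mem_nbrs.1 hb).symm.reachable
    have : ((componentEdges (G.connectedComponentMk c)).card : ℝ) ≠ 0 := by
      exact_mod_cast (Finset.card_pos.2 ⟨_, hmem⟩).ne'
    unfold vertexCoeff
    field_simp
  set ρ := r / (1 - r) with hρ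
  have hρ0 : 0 ≤ ρ := by positivity
  constructor
  · have e : avgEarly ε G two x z r ζ (c :: q) =
        r * gmean (edgeChoices G) fun M => 1 - matchLoss ε M x r c q := by
      rw [avgEarly, ← gmean_const_mul hS h0.le fun M hM => by linarith [(hm M hM).2]]
      exact gmean_congr fun M _ => by rw [matchLate, if_neg hz, if_neg hc]; ring
    rw [e]
    refine mul_le_mul_of_nonneg_left ?_ h0.le
    refine le_trans ?_ (one_add_avg_log_le_gmean fun M hM => by linarith [(hm M hM).2])
    rw [avg_map_matchLoss (fun t => Real.log (1 - t)) (by simp) c q, sub_eq_add_neg,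
      ← Finset.sum_neg_distrib]
    refine add_le_add_right (Finset.sum_le_sum fun b hb => ?_) 1
    have h3 := neg_le_log_one_sub (hv b).1 (hv b).2
    refine le_trans (le_of_eq ?_) (div_le_div_of_nonneg_right h3 (Nat.cast_nonneg _))
    rw [show -(vertexCoeff ε G c * partnerCorr x r q b +
      0.6 * (vertexCoeff ε G c * partnerCorr x r q b) ^ 2) = vertexCoeff ε G c *
        -(partnerCorr x r q b * (1 + 0.6 * (vertexCoeff ε G c * partnerCorr x r q b))) by ring,
      hmc b hb]
    ring
  · have e : avgLate ε G two x z r ζ (c :: q) =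
        (1 - r) * gmean (edgeChoices G) fun M => 1 + ρ * matchLoss ε M x r c q := by
      rw [avgLate, ← gmean_const_mul hS h1.le fun M hM => by
        have := mul_nonneg hρ0 (hm M hM).1; linarith]
      refine gmean_congr fun M _ => ?_
      rw [matchLate, if_neg hz, if_neg hc, hρ]
      field_simp
      ring
    rw [e]
    refine mul_le_mul_of_nonneg_left ?_ h1.le
    refine le_trans ?_ (one_add_avg_log_le_gmean fun M hM => by
      have := mul_nonneg hρ0 (hm M hM).1; linarith)
    rw [avg_map_matchLoss (fun t => Real.log (1 + ρ * t)) (by simp) c q]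
    refine add_le_add_right (Finset.sum_le_sum fun b hb => ?_) 1
    have h3 := sub_sq_le_log_one_add (mul_nonneg hρ0 (hv b).1)
    refine le_trans (le_of_eq ?_) (div_le_div_of_nonneg_right h3 (Nat.cast_nonneg _))
    rw [show ρ * (vertexCoeff ε G c * partnerCorr x r q b) -
      (ρ * (vertexCoeff ε G c * partnerCorr x r q b)) ^ 2 / 2 = vertexCoeff ε G c *
        (partnerCorr x r q b * (ρ *
          (1 - ρ * (vertexCoeff ε G c * partnerCorr x r q b) / 2))) by ring,
      hmc b hb]
    ring

/-- To first order the probability r ε `partnerCorr` moves from early to late. Late nodes are still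
cut with probability q₀, so only the fraction 1 - q₀ of it is lost. The second-order terms are
compared with `limUncut r ≤ 1 - q₀`. -/
theorem IsCorrelation.ordinary (S : IsCorrelation ε G two x z r ζ) (h2 : r < 1 / 2) {c : V}
    (hz : c ≠ z) (hc : c ∉ two) (q : List V) :
    0 ≤ avgEarly ε G two x z r ζ (c :: q) ∧ 1 - r ≤ avgLate ε G two x z r ζ (c :: q) ∧
    avgEarly ε G two x z r ζ (c :: q) + avgLate ε G two x z r ζ (c :: q) ≤ 1 ∧
    ∀ q₀, 0 ≤ q₀ → q₀ ≤ 1 - limUncut r →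
      1 - avgEarly ε G two x z r ζ (c :: q) - avgLate ε G two x z r ζ (c :: q) * q₀ ≤
        (1 - r) * (1 - q₀) * (1 + nodeLoss (nbrs G) x (pathLoss ε r) (rootLoss ε r) (c :: q)) := by
  have h0 := S.pos
  have h1 : 0 < 1 - r := by linarith
  have h3 : 0 < 1 - 2 * r := by linarith
  have hε := S.eps_nonneg
  have hS := edgeChoices_nonempty G
  obtain ⟨b1, b2⟩ := S.bounds h2 hz hc q
  have hcf : 0 ≤ vertexCoeff ε G c ∧ vertexCoeff ε G c ≤ 2.2 := S.coeff_mem _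
  have hp := fun b => partnerCorr_mem (x := x) h0 S.lt_one q b
  have hv : ∀ b, 0 ≤ vertexCoeff ε G c * partnerCorr x r q b ∧
      vertexCoeff ε G c * partnerCorr x r q b ≤ 2.2 * partnerCorr x r q b := fun b =>
    ⟨mul_nonneg hcf.1 (hp b).1, mul_le_mul_of_nonneg_right hcf.2 (hp b).1⟩
  set ρ := r / (1 - r) with hρ
  have hρ0 : 0 ≤ ρ := by positivity
  have hρ1 : ρ ≤ 1 := by rw [hρ, div_le_one h1]; linarith
  have hρr : (1 - r) * ρ = r := by rw [hρ]; field_simp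
  refine ⟨gmean_nonneg fun M hM => by linarith [(S.matchLate_mem hM (c :: q)).2], ?_, ?_, ?_⟩
  · refine le_trans ?_ b2
    have : 0 ≤ ∑ b ∈ nbrs G c, ε * partnerCorr x r q b * (ρ *
        (1 - ρ * (vertexCoeff ε G c * partnerCorr x r q b) / 2)) := by
      refine Finset.sum_nonneg fun b _ => mul_nonneg (mul_nonneg hε (hp b).1) (mul_nonneg hρ0 ?_)
      have h4 : ρ * (vertexCoeff ε G c * partnerCorr x r q b) ≤ 1 * (2.2 * 0.08) :=
        mul_le_mul hρ1 ((hv b).2.trans (by linarith [(hp b).2])) (hv b).1 zero_le_one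
      linarith
    nlinarith
  · refine (gmean_add_le hS (fun M hM => by linarith [(S.matchLate_mem hM (c :: q)).2])
      fun M hM => (S.matchLate_mem hM (c :: q)).1).trans ?_
    rw [gmean_congr (Y := fun _ => 1) fun M _ => by ring, gmean_const hS zero_le_one]
  · intro q₀ hq0 hq
    have hq2 : q₀ ≤ ρ ^ 2 := by
      refine hq.trans (le_of_eq ?_)
      rw [hρ, limUncut]
      field_simp
      ring
    have hlim0 := limUncut_nonneg h2.le
    have hterm : ∀ b, r * (ε * partnerCorr x r q b *
        (1 + 0.6 * (vertexCoeff ε G c * partnerCorr x r q b))) -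
        (1 - r) * (ε * partnerCorr x r q b * (ρ *
          (1 - ρ * (vertexCoeff ε G c * partnerCorr x r q b) / 2))) * q₀ ≤
        (1 - r) * (1 - q₀) *
          (if b = x then rootLoss ε r else if b ∈ q then pathLoss ε r else 0) := by
      intro b
      set v := vertexCoeff ε G c * partnerCorr x r q b with hvdef
      have e : r * (ε * partnerCorr x r q b * (1 + 0.6 * v)) -
          (1 - r) * (ε * partnerCorr x r q b * (ρ * (1 - ρ * v / 2))) * q₀ =
          r * ε * partnerCorr x r q b * ((1 - q₀) + (0.6 + q₀ * ρ / 2) * v) := by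
        linear_combination -ε * partnerCorr x r q b * (1 - ρ * v / 2) * q₀ * hρr
      rw [e]
      have h5 : (0.6 + q₀ * ρ / 2) * v ≤ (0.6 + ρ ^ 3 / 2) * (2.2 * partnerCorr x r q b) := by
        refine mul_le_mul ?_ (hv b).2 (hv b).1 (by positivity)
        have := mul_le_mul_of_nonneg_right hq2 hρ0
        nlinarith
      have hpre : 0 ≤ r * ε * partnerCorr x r q b := mul_nonneg (by positivity) (hp b).1
      by_cases hbx : b = x
      · have e2 : partnerCorr x r q b = rootCorr r := by simp [partnerCorr, hbx]
        rw [if_pos hbx]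
        have h6 := rootCorr_error h0 h2
        rw [← hρ, ← e2] at h6
        have e3 : (1 - r) * (1 - q₀) * rootLoss ε r =
            r * ε * partnerCorr x r q b * (1.15 * (1 - q₀)) := by
          rw [rootLoss, e2]
          field_simp
        rw [e3]
        refine mul_le_mul_of_nonneg_left ?_ hpre
        linarith
      · rw [if_neg hbx]
        by_cases hbq : b ∈ q
        · have e2 : partnerCorr x r q b = pathCorr r := by simp [partnerCorr, hbx, hbq]
          rw [if_pos hbq]
          have h6 := pathCorr_error h0 h2
          rw [← hρ, ← e2] at h6
          have e3 : (1 - r) * (1 - q₀) * pathLoss ε r =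
              r * ε * partnerCorr x r q b * (1.09 * (1 - q₀)) := by
            rw [pathLoss, e2, pathCorr, max_eq_right h3.le]
            field_simp
          rw [e3]
          refine mul_le_mul_of_nonneg_left ?_ hpre
          linarith
        · have e2 : partnerCorr x r q b = 0 := by simp [partnerCorr, hbx, hbq]
          rw [if_neg hbq, e2]
          simp
    have hsum := Finset.sum_le_sum fun b (_ : b ∈ nbrs G c) => hterm b
    rw [Finset.sum_sub_distrib, ← Finset.mul_sum, ← Finset.sum_mul, ← Finset.mul_sum,
      ← Finset.mul_sum] at hsum
    have b2' := mul_le_mul_of_nonneg_right b2 hq0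
    rw [nodeLoss]
    linarith

theorem IsCorrelation.isLossyTree {F : Finset (Clause V)} {canon : V → Clause V}
    {sel : List V → Clause V} (S : ∀ ζ, 0 ≤ ζ → ζ ≤ 1 → IsCorrelation ε G (twoCC F) x z r ζ)
    (h2 : r < 1 / 2) (hF : IsUnique3CNF F) (hc : IsCanonicalChoice F canon)
    (hs : IsClauseLabelling F canon sel) (hdeg : ∀ a, (nbrs G a).card ≤ 2) :
    IsLossyTree F canon sel (nbrs G) x z r (pathLoss ε r) (rootLoss ε r)
      (ε * gammaTwoCC r / (1 - r)) (fun i => avgEarly ε G (twoCC F) x z r (if i then 0 else 1))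
      (fun i => avgLate ε G (twoCC F) x z r (if i then 0 else 1)) := by
  have S0 := S 0 le_rfl zero_le_one
  have h0 := S0.pos
  have h1 : 0 < 1 - r := by linarith
  have h3 : 0 < 1 - 2 * r := by linarith
  have hε := S0.eps_nonneg
  have hS := edgeChoices_nonempty G
  have Si : ∀ i : Bool, IsCorrelation ε G (twoCC F) x z r (if i then 0 else 1) := fun i => by
    cases i
    · exact S 1 zero_le_one le_rfl
    · exact S0
  exact
  { unique := hF
    choice := hc
    labelling := hs
    pos := h0
    lt_half := h2
    symm := fun a b h => mem_nbrs.2 (mem_nbrs.1 h).symm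
    card_le := hdeg
    isolated := fun a h => S0.isolated a (mem_nbrs.1 h).symm
    not_two := S0.not_two
    lossN_nonneg := by unfold pathLoss; positivity
    lossX_nonneg := by
      have := (rootCorr_mem r).1
      unfold rootLoss
      positivity
    maxLoss_le := maxLoss_le_sq hε S0.eps_le h0 h2
    maxLoss_small := maxLoss_small hε S0.eps_le h0 h2
    le_gain := maxLoss_le_gain hε h0 h2
    gain_le := by
      rw [div_le_one h1]
      exact S0.gain_mem.2
    early := fun q => by
      simp only [avgEarly, avgLate, matchLate, if_true]
      exact ⟨by rw [gmean_const hS (by norm_num)]; norm_num, gmean_const hS le_rfl⟩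
    late := fun q => by
      simp only [avgEarly, avgLate, matchLate, if_true, Bool.false_eq_true, if_false]
      exact ⟨by rw [gmean_const hS (by norm_num)]; norm_num, gmean_const hS zero_le_one⟩
    same := fun c q hcz => by simp [avgEarly, avgLate, matchLate, hcz]
    gain := fun i c q hc2 => by
      have hcz : c ≠ z := fun h => S0.not_two (h ▸ hc2)
      have := S0.gain_mem
      simp only [avgEarly, avgLate, matchLate, if_neg hcz, if_pos hc2]
      rw [gmean_const hS (by linarith), gmean_const hS (by linarith)]
      constructor <;> field_simp ; ring
    ordinary := fun i c q hcz hc2 => (Si i).ordinary h2 hcz hc2 q }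

end Lossy

/-! ### The losses in terms of label densities -/

section Expansion

variable {V : Type} [Fintype V] [DecidableEq V] {F : Finset (Clause V)} {canon : V → Clause V}
  {sel : List V → Clause V} {two : Finset V} {N : V → Finset V} {x : V} {r σn σx : ℝ}

/-- The discounted number of proper canonical descendants with label `b` up to relative depth `n`.
-/
noncomputable def canonSum (canon : V → Clause V) (sel : List V → Clause V) (two : Finset V)
    (r : ℝ) (b : V) (n : ℕ) (p : List V) : ℝ :=
  ∑ d ∈ Finset.range n, (canonCount canon sel two b (d + 1) p : ℝ) * r ^ (d + 1)

theorem canonSum_nonneg (h0 : 0 ≤ r) (b : V) (n : ℕ) (p : List V) :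
    0 ≤ canonSum canon sel two r b n p :=
  Finset.sum_nonneg fun d _ => by positivity

theorem canonSum_succ_of_eq {a : V} {q : List V} (h : sel (a :: q) = canon a) (b : V) (n : ℕ) :
    canonSum canon sel two r b (n + 1) (a :: q) =
      r * ∑ c ∈ (childLabels sel (a :: q)).filter (· ∉ two),
        ((if c = b then 1 else 0) + canonSum canon sel two r b n (c :: a :: q)) := by
  have e : ∀ d, (canonCount canon sel two b (d + 1) (a :: q) : ℝ) * r ^ (d + 1) =
      r * ∑ c ∈ (childLabels sel (a :: q)).filter (· ∉ two),
        (canonCount canon sel two b d (c :: a :: q) : ℝ) * r ^ d := by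
    intro d
    rw [canonCount, if_pos h, Nat.cast_sum, Finset.sum_mul, Finset.mul_sum]
    exact Finset.sum_congr rfl fun c _ => by ring
  unfold canonSum
  rw [Finset.sum_congr rfl fun d _ => e d, ← Finset.mul_sum, Finset.sum_comm]
  congr 1
  refine Finset.sum_congr rfl fun c _ => ?_
  rw [Finset.sum_range_succ', add_comm]
  congr 1
  simp [canonCount]

theorem canonSum_of_ne {a : V} {q : List V} (h : sel (a :: q) ≠ canon a) (b : V) (n : ℕ) :
    canonSum canon sel two r b n (a :: q) = 0 :=
  Finset.sum_eq_zero fun d _ => by rw [canonCount, if_neg h]; simp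

theorem canonSum_le (hs : IsClauseLabelling F canon sel) (hc : IsCanonicalChoice F canon)
    (h0 : 0 ≤ r) (b c : V) (q : List V) {k n : ℕ} (hk : k ≤ n) :
    canonSum canon sel two r b k (c :: q) ≤ canonSum canon sel two r b n [c] := by
  refine le_trans (Finset.sum_le_sum fun d _ => ?_) (Finset.sum_le_sum_of_subset_of_nonneg
    (Finset.range_mono hk) fun d _ _ => by positivity)
  have := canonCount_append_le hs hc two b (d + 1) [c] q (by simp)
  gcongr
  exact this

/-- The discounted number of pairs of neighbouring labels at canonical nodes below a node. -/
noncomputable def pairSum (canon : V → Clause V) (sel : List V → Clause V) (two : Finset V)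
    (N : V → Finset V) (r : ℝ) : ℕ → List V → ℝ
  | 0, _ => 0
  | _ + 1, [] => 0
  | k + 1, a :: q => if sel (a :: q) = canon a then
      r * ∑ c ∈ (childLabels sel (a :: q)).filter (· ∉ two),
        (pairSum canon sel two N r k (c :: a :: q) +
          ∑ b ∈ N c, canonSum canon sel two r b k (c :: a :: q))
      else 0

/-- By symmetry of N, a neighbour of `c` on the path is a label on the path that has `c` as a
neighbour; this form can be summed ancestor by ancestor. -/
theorem nodeLoss_eq (hN : ∀ a b, b ∈ N a → a ∈ N b) (c : V) {p : List V} :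
    nodeLoss N x σn σx (c :: p) = σx * (∑ b ∈ N x, if c = b then 1 else 0) +
      σn * ∑ u ∈ p.toFinset.erase x, ∑ b ∈ N u, if c = b then 1 else 0 := by
  have e : ∀ b, (if b = x then σx else if b ∈ p then σn else 0) =
      (if b = x then σx else 0) + σn * if b ∈ p.toFinset.erase x then 1 else 0 := by
    intro b
    by_cases hb : b = x <;> by_cases hp : b ∈ p <;> simp [hb, hp]
  have hiff : ∀ a b, b ∈ N a ↔ a ∈ N b := fun a b => ⟨hN a b, hN b a⟩
  rw [nodeLoss, Finset.sum_congr rfl fun b _ => e b, Finset.sum_add_distrib, ← Finset.mul_sum]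
  congr 1
  · rw [Finset.sum_ite_eq', Finset.sum_ite_eq]
    simp only [hiff x c]
    split_ifs <;> simp
  · congr 1
    simp only [Finset.sum_ite_eq]
    rw [← Finset.sum_filter, ← Finset.sum_filter, Finset.sum_const, Finset.sum_const]
    congr 2
    ext b
    simp only [Finset.mem_filter, hiff b c]
    tauto

/-- Every loss is charged to the upper label of its pair. Labels already on `p` have sums of their
own, and `pairSum` collects the pairs whose two members both lie below `p`. The root label is kept
apart because its cost is σx. -/
theorem lossSum_le_pairSum (hN : ∀ a b, b ∈ N a → a ∈ N b) (h0 : 0 ≤ r) (hn : 0 ≤ σn)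
    (k : ℕ) {p : List V} (hx : x ∈ p) :
    lossSum canon sel two r (nodeLoss N x σn σx) k p ≤
      1.01 * (σx * (∑ b ∈ N x, canonSum canon sel two r b k p) +
        σn * ((∑ u ∈ p.toFinset.erase x, ∑ b ∈ N u, canonSum canon sel two r b k p) +
          pairSum canon sel two N r k p)) := by
  induction k generalizing p with
  | zero => simp [lossSum, canonSum, pairSum]
  | succ k ih =>
    obtain ⟨a, q, rfl⟩ := List.exists_cons_of_ne_nil (List.ne_nil_of_mem hx)
    by_cases hsel : sel (a :: q) = canon a
    · rw [lossSum, if_pos hsel, pairSum, if_pos hsel]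
      simp only [canonSum_succ_of_eq hsel]
      set S := (childLabels sel (a :: q)).filter (· ∉ two)
      set D := (a :: q).toFinset.erase x with hD
      have e1 : ∀ s : Finset V, ∑ b ∈ s, r * ∑ c ∈ S, ((if c = b then (1 : ℝ) else 0) +
          canonSum canon sel two r b k (c :: a :: q)) = r * ∑ c ∈ S,
            ((∑ b ∈ s, if c = b then (1 : ℝ) else 0) +
              ∑ b ∈ s, canonSum canon sel two r b k (c :: a :: q)) := by
        intro s
        rw [← Finset.mul_sum, Finset.sum_comm]
        simp only [Finset.sum_add_distrib]
      simp only [e1]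
      rw [← Finset.mul_sum, Finset.sum_comm (s := D), ← mul_add, ← Finset.sum_add_distrib,
        mul_left_comm σx, mul_left_comm σn, ← mul_add, mul_left_comm (1.01 : ℝ)]
      refine mul_le_mul_of_nonneg_left ?_ h0
      rw [Finset.mul_sum, Finset.mul_sum, ← Finset.sum_add_distrib, Finset.mul_sum]
      refine Finset.sum_le_sum fun c _ => ?_
      have h1 := ih (p := c :: a :: q) (List.mem_cons_of_mem _ hx)
      have h2 : ∑ u ∈ (c :: a :: q).toFinset.erase x, ∑ b ∈ N u,
            canonSum canon sel two r b k (c :: a :: q) ≤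
          ∑ b ∈ N c, canonSum canon sel two r b k (c :: a :: q) +
            ∑ u ∈ D, ∑ b ∈ N u, canonSum canon sel two r b k (c :: a :: q) := by
        have hnn : ∀ u, 0 ≤ ∑ b ∈ N u, canonSum canon sel two r b k (c :: a :: q) :=
          fun u => Finset.sum_nonneg fun b _ => canonSum_nonneg h0 b k _
        have hsub : (c :: a :: q).toFinset.erase x ⊆ insert c D := by
          intro u hu
          simp only [hD, Finset.mem_insert, Finset.mem_erase, List.mem_toFinset,
            List.mem_cons] at hu ⊢
          tauto
        refine (Finset.sum_le_sum_of_subset_of_nonneg hsub fun u _ _ => hnn u).trans ?_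
        by_cases hcD : c ∈ D
        · rw [Finset.insert_eq_of_mem hcD]
          linarith [hnn c]
        · rw [Finset.sum_insert hcD]
      have h3 := mul_le_mul_of_nonneg_left h2 hn
      rw [nodeLoss_eq hN c]
      simp only [← hD, Finset.sum_add_distrib]
      linarith
    · simp [lossSum, pairSum, hsel, canonSum_of_ne hsel]

/-- The weight of label densities. -/
noncomputable def densWeight (r : ℝ) : ℝ := (1 - 2 * r) ^ 2 / (1 - r) ^ 3

/-- The count below a node labelled `u` is at most the count in T_u. By `hf` the remaining factors
are bounded by `densWeight r * r` times a weight free of r, so that integration over r produces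
label densities. At relative depth i there are at most 2^i nodes with at most two neighbours each,
which cancels the powers of 1/2; then 1/((j+2.5)(j+3.5)) = 1/(j+2.5) - 1/(j+3.5) telescopes. -/
theorem exists_pairSum_weights (hF : IsUnique3CNF F) (hs : IsClauseLabelling F canon sel)
    (hc : IsCanonicalChoice F canon) (hcard : ∀ a, (N a).card ≤ 2) {f : ℝ → ℝ} {κ : ℝ}
    (hκ : 0 ≤ κ) (hf0 : ∀ r, 0 < r → r < 1 / 2 → 0 ≤ f r)
    (hf : ∀ (j : ℕ) (r : ℝ), 0 < r → r < 1 / 2 → f r * r ^ (j + 1) ≤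
      κ * (1 / 2) ^ (j + 1) / ((j + 2.5) * (j + 3.5)) * (densWeight r * r))
    (n k : ℕ) (hk : k ≤ n) (p : List V) (j : ℕ) :
    ∃ w : V → V → ℝ, (∀ u b, 0 ≤ w u b) ∧
      (∑ u, ∑ b ∈ N u, w u b ≤ (1 / 2) ^ j * (2 * κ / (j + 2.5))) ∧
      ∀ r, 0 < r → r < 1 / 2 → f r * r ^ j * pairSum canon sel two N r k p ≤
        ∑ u, ∑ b ∈ N u, w u b * (densWeight r * r * canonSum canon sel two r b n [u]) := by
  induction k generalizing p j with
  | zero => exact ⟨fun _ _ => 0, by simp, by simp; positivity, by simp [pairSum]⟩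
  | succ k ih =>
    cases p with
    | nil => exact ⟨fun _ _ => 0, by simp, by simp; positivity, by simp [pairSum]⟩
    | cons a q =>
      by_cases hsel : sel (a :: q) = canon a
      swap
      · exact ⟨fun _ _ => 0, by simp, by simp; positivity, by simp [pairSum, hsel]⟩
      choose w hw0 hw1 hw2 using fun c => ih (by omega) (c :: a :: q) (j + 1)
      set S := (childLabels sel (a :: q)).filter (· ∉ two) with hS
      have hScard : (S.card : ℝ) ≤ 2 := by
        exact_mod_cast (Finset.card_filter_le _ _).trans (hs.card_childLabels_le hF (by simp))
      set t : ℝ := κ * (1 / 2) ^ (j + 1) / ((j + 2.5) * (j + 3.5)) with ht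
      have ht0 : 0 ≤ t := by positivity
      refine ⟨fun u b => ∑ c ∈ S, (w c u b + if u = c then t else 0), fun u b =>
        Finset.sum_nonneg fun c _ => add_nonneg (hw0 c u b) (by split_ifs <;> simp [ht0]), ?_, ?_⟩
      · have e : ∑ u, ∑ b ∈ N u, ∑ c ∈ S, (w c u b + if u = c then t else 0) =
            ∑ c ∈ S, ((∑ u, ∑ b ∈ N u, w c u b) + (N c).card * t) := by
          rw [Finset.sum_congr rfl fun u _ => Finset.sum_comm, Finset.sum_comm]
          refine Finset.sum_congr rfl fun c _ => ?_
          simp only [Finset.sum_add_distrib, Finset.sum_const, nsmul_eq_mul, mul_ite, mul_zero]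
          rw [Finset.sum_ite_eq' Finset.univ c]
          simp
        rw [e]
        have hb : ∀ c ∈ S, (∑ u, ∑ b ∈ N u, w c u b) + (N c).card * t ≤
            (1 / 2) ^ (j + 1) * (2 * κ / ((j + 1 : ℕ) + 2.5)) + 2 * t := by
          intro c _
          refine add_le_add (hw1 c) (mul_le_mul_of_nonneg_right ?_ ht0)
          exact_mod_cast hcard c
        refine (Finset.sum_le_sum hb).trans ?_
        rw [Finset.sum_const, nsmul_eq_mul]
        refine (mul_le_mul_of_nonneg_right hScard (by positivity)).trans (le_of_eq ?_)
        rw [ht]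
        push_cast
        field_simp
        ring
      · intro r h0 h1
        rw [pairSum, if_pos hsel]
        have hW : 0 ≤ densWeight r * r := by
          have : 0 < 1 - r := by linarith
          unfold densWeight
          positivity
        have e : ∑ u, ∑ b ∈ N u, (∑ c ∈ S, (w c u b + if u = c then t else 0)) *
              (densWeight r * r * canonSum canon sel two r b n [u]) =
            ∑ c ∈ S, ((∑ u, ∑ b ∈ N u, w c u b *
              (densWeight r * r * canonSum canon sel two r b n [u])) +
                ∑ b ∈ N c, t * (densWeight r * r * canonSum canon sel two r b n [c])) := by
          simp only [Finset.sum_mul]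
          rw [Finset.sum_congr rfl fun u _ => Finset.sum_comm, Finset.sum_comm]
          refine Finset.sum_congr rfl fun c _ => ?_
          simp only [add_mul, Finset.sum_add_distrib, ite_mul, zero_mul]
          congr 1
          rw [Finset.sum_eq_single c (fun u _ hu => by simp [hu]) (by simp)]
          simp
        rw [e, ← mul_assoc, Finset.mul_sum]
        refine Finset.sum_le_sum fun c _ => ?_
        rw [mul_add]
        refine add_le_add ?_ ?_
        · refine le_trans (le_of_eq ?_) (hw2 c r h0 h1)
          ring
        · rw [Finset.mul_sum]
          refine Finset.sum_le_sum fun b _ => ?_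
          have h3 := canonSum_le (two := two) hs hc h0.le b c (a :: q)
            (Nat.le_of_succ_le hk : k ≤ n)
          have h4 : 0 ≤ canonSum canon sel two r b n [c] := canonSum_nonneg h0.le b n _
          calc f r * r ^ j * r * canonSum canon sel two r b k (c :: a :: q)
              ≤ f r * r ^ j * r * canonSum canon sel two r b n [c] :=
                mul_le_mul_of_nonneg_left h3 (by have := hf0 r h0 h1; positivity)
            _ = f r * r ^ (j + 1) * canonSum canon sel two r b n [c] := by ring
            _ ≤ t * (densWeight r * r) * canonSum canon sel two r b n [c] :=
                mul_le_mul_of_nonneg_right (hf j r h0 h1) h4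
            _ = _ := by ring

end Expansion

/-! ### Numerical bounds for the weights of label densities. -/

section Constants

variable {ε r : ℝ}

/-- Equivalent to log((1+t)/(1-t)) ≥ 2t. -/
theorem one_sub_mul_exp_le {t : ℝ} (h0 : 0 ≤ t) (h1 : t < 1) :
    1 - t ≤ (1 + t) * Real.exp (-(2 * t)) := by
  have h2 : 0 < 1 - t := by linarith
  have h := Real.le_log_one_add_of_nonneg (x := 2 * t / (1 - t)) (by positivity)
  have e1 : 2 * (2 * t / (1 - t)) / (2 * t / (1 - t) + 2) = 2 * t := by
    field_simp
    ring
  have e2 : 1 + 2 * t / (1 - t) = (1 + t) / (1 - t) := by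
    field_simp
    ring
  rw [e1, e2, Real.le_log_iff_exp_le (by positivity), le_div_iff₀ h2] at h
  rw [Real.exp_neg, ← div_eq_mul_inv, le_div_iff₀ (Real.exp_pos _)]
  linarith

/-- The maximum is 4/e², attained at y = 2. -/
theorem sq_mul_exp_neg_le {y : ℝ} (h0 : 0 ≤ y) : y ^ 2 * Real.exp (-y) ≤ 0.5414 := by
  have h := Real.add_one_le_exp (y / 2 - 1)
  have h1 : y / 2 ≤ Real.exp (y / 2 - 1) := by linarith
  have h2 : (y / 2) ^ 2 ≤ Real.exp (y - 2) := by
    calc (y / 2) ^ 2 ≤ Real.exp (y / 2 - 1) ^ 2 := by gcongr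
      _ = Real.exp (y - 2) := by rw [← Real.exp_nat_mul]; congr 1; push_cast; ring
  have h3 : Real.exp 1 ^ 2 * 0.5414 ≥ 4 := by
    have := Real.exp_one_gt_d9
    nlinarith
  have e : Real.exp (y - 2) * Real.exp 1 ^ 2 = Real.exp y := by
    rw [← Real.exp_nat_mul, ← Real.exp_add]
    congr 1
    push_cast
    ring
  rw [Real.exp_neg, ← div_eq_mul_inv, div_le_iff₀ (Real.exp_pos _), ← e]
  nlinarith [Real.exp_pos (y - 2)]

/-- With t = 1-s one has s^(j+2) ≤ (1+t) exp(-(j+3)t), so t² s^(j+2) is controlled by y² e^(-y) at y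
= (j+3)t. Replacing (j+3)² by the smaller (j+2.5)(j+3.5) makes the weights telescope. The factor 2-s
absorbs an extra 1/(1-r) when s = 2r. -/
theorem pow_mul_sq_le {s : ℝ} (h0 : 0 < s) (h1 : s ≤ 1) (j : ℕ) :
    s ^ (j + 2) * (1 - s) ^ 2 ≤ 0.5414 / ((j + 2.5) * (j + 3.5)) * (2 - s) := by
  set t := 1 - s with ht
  have hs : s = 1 - t := by rw [ht]; ring
  have ht0 : 0 ≤ t := by linarith
  have ht1 : t < 1 := by linarith
  have h2 : s ^ (j + 2) ≤ (2 - s) * Real.exp (-((j + 3) * t)) := by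
    have h3 : s ^ (j + 1) ≤ Real.exp (-((j + 1) * t)) := by
      calc s ^ (j + 1) ≤ Real.exp (-t) ^ (j + 1) := by
            gcongr
            rw [hs]
            linarith [Real.add_one_le_exp (-t)]
        _ = _ := by rw [← Real.exp_nat_mul]; congr 1; push_cast; ring
    have h4 := one_sub_mul_exp_le ht0 ht1
    rw [← hs] at h4
    calc s ^ (j + 2) = s ^ (j + 1) * s := pow_succ _ _
      _ ≤ Real.exp (-((j + 1) * t)) * ((1 + t) * Real.exp (-(2 * t))) := by gcongr
      _ = (1 + t) * (Real.exp (-((j + 1) * t)) * Real.exp (-(2 * t))) := by ring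
      _ = _ := by
          rw [← Real.exp_add, show 1 + t = 2 - s by rw [ht]; ring,
            show -((j + 1) * t) + -(2 * t) = -((j + 3) * t) by ring]
  have h5 := sq_mul_exp_neg_le (y := (j + 3) * t) (by positivity)
  have h6 : 0 < 2 - s := by linarith
  calc s ^ (j + 2) * t ^ 2 ≤ (2 - s) * Real.exp (-((j + 3) * t)) * t ^ 2 := by gcongr
    _ = (((j + 3) * t) ^ 2 * Real.exp (-((j + 3) * t))) / (j + 3) ^ 2 * (2 - s) := by
        field_simp
    _ ≤ 0.5414 / ((j + 2.5) * (j + 3.5)) * (2 - s) := by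
        refine mul_le_mul_of_nonneg_right (div_le_div₀ (by norm_num) h5 (by positivity) ?_) h6.le
        nlinarith

theorem limUncut_mul_pathLoss_le (hε : 0 ≤ ε) (j : ℕ) (h0 : 0 < r) (h1 : r < 1 / 2) :
    limUncut r * pathLoss ε r * r ^ (j + 1) ≤ 0.5414 * 1.09 * ε * (1 / 2) ^ (j + 1) /
      ((j + 2.5) * (j + 3.5)) * (densWeight r * r) := by
  have h2 : 0 < 1 - r := by linarith
  have h3 : 0 < 1 - 2 * r := by linarith
  have h := pow_mul_sq_le (s := 2 * r) (by linarith) (by linarith) j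
  have e : limUncut r * pathLoss ε r * r ^ (j + 1) =
      1.09 * ε * (1 / 2) ^ (j + 1) * (densWeight r * r) *
        ((2 * r) ^ (j + 2) * (1 - 2 * r) ^ 2 / (2 - 2 * r)) := by
    have h4 : 2 - 2 * r = 2 * (1 - r) := by ring
    rw [limUncut, pathLoss, densWeight, h4, mul_pow 2 r, div_pow, one_pow]
    field_simp
    ring
  rw [e]
  have h5 : (2 * r) ^ (j + 2) * (1 - 2 * r) ^ 2 / (2 - 2 * r) ≤
      0.5414 / ((j + 2.5) * (j + 3.5)) := by
    rwa [div_le_iff₀ (by linarith)]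
  have h6 : 0 ≤ 1.09 * ε * (1 / 2) ^ (j + 1) * (densWeight r * r) := by
    unfold densWeight
    positivity
  refine (mul_le_mul_of_nonneg_left h5 h6).trans (le_of_eq ?_)
  ring

/-- (5r-1)(1-2r) has the maximum 0.225 at r = 0.35, and 0.25875 = 1.15 · 0.225. -/
theorem limUncut_mul_rootLoss_le (hε : 0 ≤ ε) (h0 : 0 < r) (h1 : r < 1 / 2) :
    limUncut r * rootLoss ε r ≤ 0.25875 * ε * (densWeight r * r) := by
  have h2 : 0 < 1 - r := by linarith
  have h3 : 0 < 1 - 2 * r := by linarith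
  rw [limUncut, rootLoss, rootCorr, densWeight, max_eq_right h3.le]
  have h4 : max 0 (5 * r - 1) * (1 - 2 * r) ≤ 0.225 := by
    rcases max_cases 0 (5 * r - 1) with ⟨h, -⟩ | ⟨h, -⟩ <;> rw [h]
    · norm_num
    · nlinarith [sq_nonneg (r - 0.35)]
  calc (1 - 2 * r) / (1 - r) ^ 2 * (1.15 * ε * r * (max 0 (5 * r - 1) * (1 - 2 * r) ^ 2) / (1 - r))
      = 1.15 * ε * ((1 - 2 * r) ^ 2 / (1 - r) ^ 3 * r) * (max 0 (5 * r - 1) * (1 - 2 * r)) := by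
        field_simp
    _ ≤ 1.15 * ε * ((1 - 2 * r) ^ 2 / (1 - r) ^ 3 * r) * 0.225 := by gcongr
    _ = _ := by ring

end Constants

/-- The losses in `T_x` are a combination of label densities of neighbours. -/
theorem exists_lossSum_weights {V : Type} [Fintype V] [DecidableEq V] {F : Finset (Clause V)}
    {canon : V → Clause V} {sel : List V → Clause V} {two : Finset V} {N : V → Finset V} {ε : ℝ}
    (hF : IsUnique3CNF F) (hs : IsClauseLabelling F canon sel) (hc : IsCanonicalChoice F canon)
    (hN : ∀ a b, b ∈ N a → a ∈ N b) (hcard : ∀ a, (N a).card ≤ 2) (hε : 0 ≤ ε) (x : V) (n : ℕ) :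
    ∃ w : V → V → ℝ, (∀ u b, 0 ≤ w u b) ∧ (∑ u, ∑ b ∈ N u, w u b ≤ 1.0302 * ε) ∧
      ∀ r, 0 < r → r < 1 / 2 → limUncut r *
          lossSum canon sel two r (nodeLoss N x (pathLoss ε r) (rootLoss ε r)) n [x] ≤
        ∑ u, ∑ b ∈ N u, w u b * (densWeight r * r * canonSum canon sel two r b n [u]) := by
  obtain ⟨w, hw0, hw1, hw2⟩ := exists_pairSum_weights (two := two) hF hs hc hcard
    (f := fun r => limUncut r * pathLoss ε r) (κ := 0.5414 * 1.09 * ε) (by positivity)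
    (fun r h0 h1 => mul_nonneg (limUncut_nonneg h1.le) (by
      have h3 : 0 < 1 - 2 * r := by linarith
      unfold pathLoss
      positivity))
    (fun j r h0 h1 => limUncut_mul_pathLoss_le hε j h0 h1) n n le_rfl [x] 0
  refine ⟨fun u b => 1.01 * (w u b + if u = x then 0.25875 * ε else 0), fun u b => ?_, ?_, ?_⟩
  · have := hw0 u b
    dsimp only
    split_ifs <;> positivity
  · simp only [← Finset.mul_sum, Finset.sum_add_distrib, Finset.sum_const, nsmul_eq_mul, mul_ite,
      mul_zero]
    rw [Finset.sum_ite_eq' Finset.univ x, if_pos (Finset.mem_univ x)]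
    have h2 : ((N x).card : ℝ) ≤ 2 := by exact_mod_cast hcard x
    have h3 : ((N x).card : ℝ) * (0.25875 * ε) ≤ 2 * (0.25875 * ε) := by gcongr
    -- The total is 1.01 (2 · 0.5414 · 1.09/2.5 + 2 · 0.25875) ε, which is below 1.0302 ε.
    norm_num at hw1 ⊢
    linarith
  · intro r h0 h1
    have h3 : 0 < 1 - 2 * r := by linarith
    have h4 : 0 < 1 - r := by linarith
    have hn : 0 ≤ pathLoss ε r := by unfold pathLoss; positivity
    have hl := limUncut_nonneg h1.le
    have h := mul_le_mul_of_nonneg_left (lossSum_le_pairSum (canon := canon) (sel := sel) (σx := rootLoss ε r)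
      (two := two) hN h0.le hn n (List.mem_singleton_self x)) hl
    have he : ([x] : List V).toFinset.erase x = ∅ := by simp
    rw [he, Finset.sum_empty, zero_add] at h
    have h5 := hw2 r h0 h1
    rw [pow_zero, mul_one] at h5
    have h6 : limUncut r * rootLoss ε r * ∑ b ∈ N x, canonSum canon sel two r b n [x] ≤
        ∑ b ∈ N x, 0.25875 * ε * (densWeight r * r * canonSum canon sel two r b n [x]) := by
      rw [Finset.mul_sum]
      refine Finset.sum_le_sum fun b _ => ?_
      rw [← mul_assoc]
      exact mul_le_mul_of_nonneg_right (limUncut_mul_rootLoss_le hε h0 h1)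
        (canonSum_nonneg h0.le b n _)
    have e : ∑ u, ∑ b ∈ N u, 1.01 * (w u b + if u = x then 0.25875 * ε else 0) *
          (densWeight r * r * canonSum canon sel two r b n [u]) =
        1.01 * ((∑ u, ∑ b ∈ N u, w u b * (densWeight r * r * canonSum canon sel two r b n [u])) +
          ∑ b ∈ N x, 0.25875 * ε * (densWeight r * r * canonSum canon sel two r b n [x])) := by
      simp only [mul_assoc (1.01 : ℝ), ← Finset.mul_sum, add_mul, Finset.sum_add_distrib]
      congr 2
      rw [Finset.sum_eq_single x (fun u _ hu => by simp [hu]) (by simp)]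
      simp
    rw [e]
    linarith

/-! ### The gain and the errors at a fixed position of the root label -/

section Gain

variable {ε r : ℝ}

/-- The potential whose derivative compensates the loss in the label density. -/
noncomputable def gainPot (r : ℝ) : ℝ :=
  r ^ 2 * (1 - 2 * r) ^ 5 * (0.221 + 0.727 * r) / (1 - r) ^ 5

/-- The derivative of `gainPot`. -/
noncomputable def gainPotDeriv (r : ℝ) : ℝ :=
  r * (1 - 2 * r) ^ 4 / (1 - r) ^ 6 * ((0.442 + 2.181 * r) * (1 - 2 * r) * (1 - r) -
    10 * r * (0.221 + 0.727 * r) * (1 - r) + 5 * r * (0.221 + 0.727 * r) * (1 - 2 * r))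

theorem hasDerivAt_gainPot (h : r ≠ 1) : HasDerivAt gainPot (gainPotDeriv r) r := by
  have h1 : 1 - r ≠ 0 := sub_ne_zero.2 h.symm
  have d1 : HasDerivAt (fun s : ℝ => 1 - 2 * s) (-2) r := by
    simpa using ((hasDerivAt_id r).const_mul 2).const_sub 1
  have d2 : HasDerivAt (fun s : ℝ => 0.221 + 0.727 * s) 0.727 r := by
    simpa using ((hasDerivAt_id r).const_mul 0.727).const_add 0.221
  have d3 : HasDerivAt (fun s : ℝ => 1 - s) (-1) r := by
    simpa using (hasDerivAt_id r).const_sub 1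
  have := ((((hasDerivAt_id r).pow 2).mul (d1.pow 5)).mul d2).div (d3.pow 5) (pow_ne_zero 5 h1)
  refine this.congr_deriv ?_
  unfold gainPotDeriv
  simp only [Pi.mul_apply, Pi.pow_apply, id_eq]
  rw [div_eq_iff (by positivity)]
  field_simp
  ring

theorem hasDerivAt_gainPot_mul_pow (h : r ≠ 1) (d : ℕ) :
    HasDerivAt (fun s => gainPot s * s ^ (d + 2))
      (gainPotDeriv r * r ^ (d + 2) + gainPot r * ((d + 2) * r ^ (d + 1))) r := by
  refine ((hasDerivAt_gainPot h).mul (hasDerivAt_pow (d + 2) r)).congr_deriv ?_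
  push_cast
  rfl

theorem gainPot_nonneg (h0 : 0 < r) (h1 : r < 1 / 2) : 0 ≤ gainPot r := by
  have h2 : 0 < 1 - r := by linarith
  have h3 : 0 < 1 - 2 * r := by linarith
  unfold gainPot
  positivity

/-- For r ≤ 0.2 the potential is nondecreasing. Beyond that the bracket in its derivative is at
least 1 - 5r, and a tenth of the density weight compensates. -/
theorem densWeight_add_gainPotDeriv_nonneg (h0 : 0 < r) (h1 : r < 1 / 2) :
    0 ≤ 0.1 * densWeight r + gainPotDeriv r := by
  have h2 : 0 < 1 - r := by linarith
  have h3 : 0 < 1 - 2 * r := by linarith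
  have e : 0.1 * densWeight r + gainPotDeriv r = (1 - 2 * r) ^ 2 / (1 - r) ^ 6 *
      (0.1 * (1 - r) ^ 3 + r * (1 - 2 * r) ^ 2 * ((0.442 + 2.181 * r) * (1 - 2 * r) * (1 - r) -
    10 * r * (0.221 + 0.727 * r) * (1 - r) + 5 * r * (0.221 + 0.727 * r) * (1 - 2 * r))) := by
    unfold densWeight gainPotDeriv
    field_simp
  rw [e]
  refine mul_nonneg (by positivity) ?_
  rcases le_total r 0.2 with h | h
  · have h4 : 0 ≤ (0.442 + 2.181 * r) * (1 - 2 * r) * (1 - r) -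
        10 * r * (0.221 + 0.727 * r) * (1 - r) + 5 * r * (0.221 + 0.727 * r) * (1 - 2 * r) := by
      nlinarith [mul_nonneg h0.le (sub_nonneg.2 h),
        mul_nonneg (mul_nonneg h0.le h0.le) (sub_nonneg.2 h)]
    positivity
  · have h4 : 1 - 5 * r ≤ (0.442 + 2.181 * r) * (1 - 2 * r) * (1 - r) -
        10 * r * (0.221 + 0.727 * r) * (1 - r) + 5 * r * (0.221 + 0.727 * r) * (1 - 2 * r) := by
      nlinarith [mul_nonneg (sub_nonneg.2 h) (sub_nonneg.2 h1.le),
        mul_nonneg (mul_nonneg (sub_nonneg.2 h) h0.le) (sub_nonneg.2 h1.le)]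
    have h5 : r * (1 - 2 * r) ^ 2 * (5 * r - 1) ≤ 0.1 * (1 - r) ^ 3 := by
      nlinarith [mul_nonneg (sub_nonneg.2 h) (sub_nonneg.2 h1.le), sq_nonneg (r - 0.35),
        sq_nonneg (r ^ 2 - 0.5 * r), mul_nonneg h0.le (sq_nonneg (r - 0.35)),
        mul_nonneg (mul_nonneg (sub_nonneg.2 h) (sub_nonneg.2 h1.le)) (sq_nonneg (r - 0.35)),
        mul_nonneg (sub_nonneg.2 h1.le) (sq_nonneg (r - 0.35))]
    have h6 := mul_le_mul_of_nonneg_left h4 (by positivity : 0 ≤ r * (1 - 2 * r) ^ 2)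
    linarith

theorem densWeight_le_one (h0 : 0 < r) (h1 : r < 1 / 2) : 0 ≤ densWeight r ∧ densWeight r ≤ 1 := by
  have h2 : 0 < 1 - r := by linarith
  have h3 : 0 < 1 - 2 * r := by linarith
  unfold densWeight
  refine ⟨by positivity, ?_⟩
  rw [div_le_one (by positivity)]
  calc (1 - 2 * r) ^ 2 ≤ ((1 - r) ^ 2) ^ 2 := by
        gcongr
        nlinarith [sq_nonneg r]
    _ = (1 - r) ^ 3 * (1 - r) := by ring
    _ ≤ (1 - r) ^ 3 * 1 := by gcongr; linarith
    _ = _ := mul_one _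

theorem densWeight_mul_le (h0 : 0 < r) (h1 : r < 1 / 2) :
    densWeight r * r ≤ 1 - 2 * r := by
  have h2 : 0 < 1 - r := by linarith
  have h3 : 0 < 1 - 2 * r := by linarith
  unfold densWeight
  rw [div_mul_eq_mul_div, div_le_iff₀ (by positivity)]
  have h4 : (1 - 2 * r) * r ≤ (1 - r) ^ 3 := by
    nlinarith [mul_pos h0 h3, mul_pos (mul_pos h0 h3) h2, mul_pos h2 h2, sq_nonneg (1 - 3 * r)]
  nlinarith

theorem maxLoss_nonneg_of (hε : 0 ≤ ε) (h0 : 0 < r) (h1 : r < 1 / 2) :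
    0 ≤ maxLoss r (pathLoss ε r) (rootLoss ε r) := by
  have h2 : 0 < 1 - r := by linarith
  have h3 : 0 < 1 - 2 * r := by linarith
  have := (rootCorr_mem r).1
  unfold maxLoss pathLoss rootLoss
  positivity

/-- `gainPot` is `densWeight` times 1-2r times the bound of `maxLoss_le_poly` at ε = 1/10. -/
theorem densWeight_mul_maxLoss_le (hε : 0 ≤ ε) (hε' : ε ≤ 1 / 10) (h0 : 0 < r) (h1 : r < 1 / 2) :
    densWeight r * ((1 - 2 * r) * maxLoss r (pathLoss ε r) (rootLoss ε r)) ≤ gainPot r := by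
  have h2 : 0 < 1 - r := by linarith
  have h3 : 0 < 1 - 2 * r := by linarith
  have hw := (densWeight_le_one h0 h1).1
  calc densWeight r * ((1 - 2 * r) * maxLoss r (pathLoss ε r) (rootLoss ε r))
      ≤ densWeight r * ((1 - 2 * r) *
        (1 / 10 * (r ^ 2 * (1 - 2 * r) ^ 2 * (2.21 + 7.27 * r)) / (1 - r) ^ 2)) := by
        gcongr
        exact (maxLoss_le_poly hε h0 h1).trans (by gcongr)
    _ = gainPot r := by
        unfold densWeight gainPot
        field_simp
        ring

/-- Without losses and at infinite height ρ would equal r, because (1-r)² `limUncut r` = 1-2r. The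
losses lower ρ by at most (1-2r) times `maxLoss`, the finite height by at most 2(2r)^K. -/
theorem earlyProb_bounds (hε : 0 ≤ ε) (hε' : ε ≤ 1 / 10) (h0 : 0 < r) (h1 : r < 1 / 2) {K : ℕ}
    (hK : 1 ≤ K) {ρ : ℝ} (hρ : ρ = (1 - r) * (1 - (1 - r) * nomUncut r K *
      (1 + maxLoss r (pathLoss ε r) (rootLoss ε r)))) :
    0 ≤ ρ ∧ r - ρ ≤ (1 - 2 * r) * maxLoss r (pathLoss ε r) (rootLoss ε r) + 2 * (2 * r) ^ K := by
  have h2 : 0 < 1 - r := by linarith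
  have h3 : 0 < 1 - 2 * r := by linarith
  set m := maxLoss r (pathLoss ε r) (rootLoss ε r) with hm
  have hm0 : 0 ≤ m := maxLoss_nonneg_of hε h0 h1
  have hm1 : m ≤ 0.4 * r ^ 2 := maxLoss_le_sq hε hε' h0 h1
  have hU := nomUncut_sub_le h0.le h1.le K
  have hU0 := (nomUncut_mem h0.le (by linarith : r ≤ 1) K).1
  have hU1 := nomUncut_one_le h0.le (by linarith : r ≤ 1) hK
  have hp : 0 ≤ (2 * r) ^ K := by positivity
  constructor
  · rw [hρ]
    refine mul_nonneg h2.le (sub_nonneg.2 ?_)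
    have h4 : nomUncut r K * (1 + m) ≤ 1 := by
      calc nomUncut r K * (1 + m) ≤ (1 - r ^ 2) * (1 + 0.4 * r ^ 2) :=
            mul_le_mul hU1 (by linarith) (by linarith) (by nlinarith)
        _ ≤ 1 := by nlinarith [sq_nonneg r, sq_nonneg (r ^ 2)]
    rw [mul_assoc]
    exact mul_le_one₀ (by linarith) (by positivity) h4
  · have e : (1 - r) ^ 2 * limUncut r = 1 - 2 * r := by
      unfold limUncut
      field_simp
    have h4 : (1 - r) ^ 2 * (nomUncut r K * (1 + m)) ≤
        (1 - r) ^ 2 * ((limUncut r + (2 * r) ^ K) * (1 + m)) := by gcongr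
    have h5 : (1 - r) ^ 2 * ((2 * r) ^ K * (1 + m)) ≤ 1 * ((2 * r) ^ K * 2) := by
      gcongr
      · nlinarith
      · nlinarith
    rw [hρ]
    calc _ = r - (1 - r) + (1 - r) ^ 2 * (nomUncut r K * (1 + m)) := by ring
      _ ≤ r - (1 - r) + (1 - r) ^ 2 * ((limUncut r + (2 * r) ^ K) * (1 + m)) := by linarith
      _ = r - (1 - r) + (1 - r) ^ 2 * limUncut r * (1 + m) +
          (1 - r) ^ 2 * ((2 * r) ^ K * (1 + m)) := by ring
      _ ≤ _ := by rw [e]; linarith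

/-- Bernoulli gives ρ^(d+1) ≥ r^(d+1) - (d+1) r^d (r-ρ), with a factor d+1 that cannot be bounded
pointwise by a fraction of the main term. It is absorbed by the derivative of `gainPot r * r^(d+2)`,
whose integral is 0. What remains is the derivative of the potential, which costs at most a tenth of
`densWeight`. -/
theorem gain_term_le (hε : 0 ≤ ε) (hε' : ε ≤ 1 / 10) (h0 : 0 < r) (h1 : r < 1 / 2) {K : ℕ}
    (hK : 1 ≤ K) {ρ : ℝ} (hρ : ρ = (1 - r) * (1 - (1 - r) * nomUncut r K *
      (1 + maxLoss r (pathLoss ε r) (rootLoss ε r)))) (d : ℕ) :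
    0.9 * (densWeight r * r * r ^ (d + 1)) -
        (gainPotDeriv r * r ^ (d + 2) + gainPot r * ((d + 2) * r ^ (d + 1))) -
        2 * (d + 1) * r ^ (d + 1) * (2 * r) ^ K ≤
      densWeight r * r * ρ ^ (d + 1) := by
  obtain ⟨hρ0, hρ1⟩ := earlyProb_bounds hε hε' h0 h1 hK hρ
  set m := maxLoss r (pathLoss ε r) (rootLoss ε r) with hm
  obtain ⟨hw0, hw1⟩ := densWeight_le_one h0 h1
  have hb := one_add_mul_le_pow (a := ρ / r - 1) (by
    have : 0 ≤ ρ / r := by positivity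
    linarith) (d + 1)
  have hb2 : r ^ (d + 1) - (d + 1) * r ^ d * (r - ρ) ≤ ρ ^ (d + 1) := by
    have := mul_le_mul_of_nonneg_left hb (by positivity : 0 ≤ r ^ (d + 1))
    rw [← mul_pow, show r * (1 + (ρ / r - 1)) = ρ by field_simp; ring] at this
    refine le_trans (le_of_eq ?_) this
    push_cast
    field_simp
    ring
  have hb3 := mul_le_mul_of_nonneg_left hb2 (by positivity : 0 ≤ densWeight r * r)
  refine le_trans ?_ hb3
  have h4 : densWeight r * (r - ρ) ≤ gainPot r + 2 * (2 * r) ^ K := by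
    have h5 := mul_le_mul_of_nonneg_left hρ1 hw0
    have h6 := densWeight_mul_maxLoss_le hε hε' h0 h1
    have h7 : densWeight r * (2 * (2 * r) ^ K) ≤ 1 * (2 * (2 * r) ^ K) := by gcongr
    rw [mul_add] at h5
    linarith
  have h8 := mul_le_mul_of_nonneg_left h4 (by positivity : 0 ≤ (d + 1) * r ^ (d + 1))
  have h9 := mul_nonneg (densWeight_add_gainPotDeriv_nonneg h0 h1)
    (by positivity : 0 ≤ r ^ (d + 2))
  have h10 : 0 ≤ gainPot r * r ^ (d + 1) := mul_nonneg (gainPot_nonneg h0 h1) (by positivity)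
  have e1 : r ^ (d + 2) = r ^ d * r ^ 2 := pow_add _ _ _
  have e2 : r ^ (d + 1) = r ^ d * r := pow_succ _ _
  rw [e1] at h9 ⊢
  rw [e2] at h8 h10 ⊢
  linarith

end Gain

/-! ### The lower bound for a fixed position r of the root label. -/

section Pointwise

variable {V : Type} [Fintype V] [DecidableEq V] {F : Finset (Clause V)} {canon : V → Clause V}
  {sel : List V → Clause V} {G : SimpleGraph V} {x y z : V} {ε r : ℝ}

/-- The lower bound for the gain. -/
theorem gain_le (hF : IsUnique3CNF F) (hs : IsClauseLabelling F canon sel) (two : Finset V)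
    (hε : 0 ≤ ε) (hε' : ε ≤ 1 / 10) (h0 : 0 < r) (h1 : r < 1 / 2) {K : ℕ}
    (hK : 1 ≤ K) {ρ : ℝ} (hρ : ρ = (1 - r) * (1 - (1 - r) * nomUncut r K *
      (1 + maxLoss r (pathLoss ε r) (rootLoss ε r)))) (H : ℕ) (y z : V) :
    0.9 * (densWeight r * r * canonSum canon sel two r z H [y]) -
        ∑ d ∈ Finset.range H, (canonCount canon sel two z (d + 1) [y] : ℝ) *
          (gainPotDeriv r * r ^ (d + 2) + gainPot r * ((d + 2) * r ^ (d + 1))) -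
        2 * H ^ 2 * (2 * r) ^ K ≤
      densWeight r * r * ∑ d ∈ Finset.range H,
        (canonCount canon sel two z (d + 1) [y] : ℝ) * ρ ^ (d + 1) := by
  have hterm : ∀ d ∈ Finset.range H, (canonCount canon sel two z (d + 1) [y] : ℝ) *
      (0.9 * (densWeight r * r * r ^ (d + 1)) -
        (gainPotDeriv r * r ^ (d + 2) + gainPot r * ((d + 2) * r ^ (d + 1)))) -
        2 * H * (2 * r) ^ K ≤ (canonCount canon sel two z (d + 1) [y] : ℝ) *
          (densWeight r * r * ρ ^ (d + 1)) := by
    intro d hd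
    have h2 := mul_le_mul_of_nonneg_left (gain_term_le hε hε' h0 h1 hK hρ d)
      (Nat.cast_nonneg (canonCount canon sel two z (d + 1) [y]))
    have h3 := canonCount_le_two_pow hF hs two z (d + 1) (p := [y]) (by simp)
    -- The number of nodes is at most 2^(d+1), and (2r)^(d+1) ≤ 1.
    have h4 : (canonCount canon sel two z (d + 1) [y] : ℝ) *
        (2 * (d + 1) * r ^ (d + 1) * (2 * r) ^ K) ≤ 2 * H * (2 * r) ^ K := by
      have h5 : ((d + 1 : ℕ) : ℝ) ≤ H := by exact_mod_cast Finset.mem_range.1 hd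
      push_cast at h5
      calc _ ≤ 2 ^ (d + 1) * (2 * (d + 1) * r ^ (d + 1) * (2 * r) ^ K) := by gcongr
        _ = 2 * (d + 1) * (2 * r) ^ K * (2 * r) ^ (d + 1) := by rw [mul_pow 2 r (d + 1)]; ring
        _ ≤ 2 * H * (2 * r) ^ K * 1 := by
            gcongr
            exact pow_le_one₀ (by positivity) (by linarith)
        _ = _ := mul_one _
    linarith
  have hsum := Finset.sum_le_sum hterm
  rw [Finset.sum_sub_distrib, Finset.sum_const, Finset.card_range, nsmul_eq_mul] at hsum
  rw [canonSum, Finset.mul_sum, Finset.mul_sum, Finset.mul_sum, ← Finset.sum_sub_distrib]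
  calc _ = ∑ d ∈ Finset.range H, (canonCount canon sel two z (d + 1) [y] : ℝ) *
      (0.9 * (densWeight r * r * r ^ (d + 1)) -
        (gainPotDeriv r * r ^ (d + 2) + gainPot r * ((d + 2) * r ^ (d + 1)))) -
        H * (2 * H * (2 * r) ^ K) := by
        congr 1
        · exact Finset.sum_congr rfl fun d _ => by ring
        · ring
    _ ≤ _ := hsum
    _ = _ := Finset.sum_congr rfl fun d _ => by ring

/-- The tail beyond depth H is at most a geometric series in 2r, whose sum is cancelled by
`densWeight r * r ≤ 1 - 2r`. Thus densities in trees of height H suffice, although T_x is much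
higher. -/
theorem densWeight_mul_canonSum_le (hF : IsUnique3CNF F) (hs : IsClauseLabelling F canon sel)
    (two : Finset V) (h0 : 0 < r) (h1 : r < 1 / 2) {H n : ℕ} (hn : H ≤ n) (b u : V) :
    densWeight r * r * canonSum canon sel two r b n [u] ≤
      densWeight r * r * canonSum canon sel two r b H [u] + (2 * r) ^ (H + 1) := by
  obtain ⟨j, rfl⟩ := Nat.exists_eq_add_of_le hn
  have hw := (densWeight_le_one h0 h1).1
  have hw' := densWeight_mul_le h0 h1
  have h3 : 0 < 1 - 2 * r := by linarith
  rw [canonSum, Finset.sum_range_add, mul_add]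
  refine add_le_add le_rfl ?_
  calc densWeight r * r * ∑ d ∈ Finset.range j,
        (canonCount canon sel two b (H + d + 1) [u] : ℝ) * r ^ (H + d + 1)
      ≤ (1 - 2 * r) * ∑ d ∈ Finset.range j, (2 * r) ^ (H + 1) * (2 * r) ^ d := by
        refine mul_le_mul hw' (Finset.sum_le_sum fun d _ => ?_)
          (Finset.sum_nonneg fun d _ => by positivity) h3.le
        have h5 := canonCount_le_two_pow hF hs two b (H + d + 1) (p := [u]) (by simp)
        calc _ ≤ (2 : ℝ) ^ (H + d + 1) * r ^ (H + d + 1) := by gcongr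
          _ = _ := by rw [← mul_pow, ← pow_add]; congr 1; ring
    _ = (2 * r) ^ (H + 1) * ((1 - 2 * r) * ∑ d ∈ Finset.range j, (2 * r) ^ d) := by
        rw [← Finset.mul_sum]
        ring
    _ = (2 * r) ^ (H + 1) * (1 - (2 * r) ^ j) := by rw [mul_neg_geom_sum]
    _ ≤ (2 * r) ^ (H + 1) * 1 := by
        gcongr
        have : 0 ≤ (2 * r) ^ j := by positivity
        linarith
    _ = _ := mul_one _

/-- The conditional probability of the cut if the root label is at `r < 1/2`. -/
theorem IsCorrelation.root_le_avg
    (S : ∀ ζ, 0 ≤ ζ → ζ ≤ 1 → IsCorrelation ε G (twoCC F) x z r ζ) (h2 : r < 1 / 2)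
    (hF : IsUnique3CNF F) (hc : IsCanonicalChoice F canon) (hs : IsClauseLabelling F canon sel)
    (hdeg : ∀ a, (nbrs G a).card ≤ 2) (hcx : canon x = critClause x y z) (hyz : y ≠ z)
    (hy : y ∉ twoCC F) {K : ℕ} (hK : 1 ≤ K) (H : ℕ) {ρ : ℝ} (hρ : ρ = (1 - r) *
      (1 - (1 - r) * nomUncut r K * (1 + maxLoss r (pathLoss ε r) (rootLoss ε r)))) :
    1 - nomUncut r (K + H + 1) * (1 + lossSum canon sel (twoCC F) r
        (nodeLoss (nbrs G) x (pathLoss ε r) (rootLoss ε r)) (K + H + 1) [x]) +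
      densWeight r * r * ∑ d ∈ Finset.range H,
        (canonCount canon sel (twoCC F) z (d + 1) [y] : ℝ) * ρ ^ (d + 1) ≤
    ((edgeChoices G).card : ℝ)⁻¹ * ∑ M ∈ edgeChoices G,
      bitCutProb ε (twoCC F) M sel x (K + H + 1) r := by
  have S0 := S 0 le_rfl zero_le_one
  have S1 := S 1 zero_le_one le_rfl
  have h0 := S0.pos
  have h1 : 0 < 1 - r := by linarith
  have T := isLossyTree S h2 hF hc hs hdeg
  have h := T.root_le S0.ne_root.symm hyz hcx S0.root_not_two hy K H (K + H) hK le_rfl rfl hρ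
  have t0 := mul_le_mul_of_nonneg_left (S0.treeVal_le_avg hs (K + H + 1)) h0.le
  have t1 := mul_le_mul_of_nonneg_left (S1.treeVal_le_avg hs (K + H + 1)) h1.le
  refine h.trans ?_
  simp only [if_true, Bool.false_eq_true, if_false]
  refine (add_le_add t0 t1).trans (le_of_eq ?_)
  rw [mul_left_comm r, mul_left_comm (1 - r), ← mul_add, Finset.mul_sum, Finset.mul_sum,
    ← Finset.sum_add_distrib]
  congr 1
  refine Finset.sum_congr rfl fun M _ => ?_
  rw [bitCutProb_eq S0.not_two S0.ne_root, bitCutProbAt_eq_add (ζ := 1 - r)]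
  ring

/-- The lower bound for the conditional probability in terms of label densities. -/
theorem IsCorrelation.lower_le_avg
    (S : ∀ ζ, 0 ≤ ζ → ζ ≤ 1 → IsCorrelation ε G (twoCC F) x z r ζ) (h2 : r < 1 / 2)
    (hF : IsUnique3CNF F) (hc : IsCanonicalChoice F canon) (hs : IsClauseLabelling F canon sel)
    (hdeg : ∀ a, (nbrs G a).card ≤ 2) (hcx : canon x = critClause x y z) (hyz : y ≠ z)
    (hy : y ∉ twoCC F) {K : ℕ} (hK : 1 ≤ K) (H : ℕ) {w : V → V → ℝ} (hw0 : ∀ u b, 0 ≤ w u b)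
    (hw1 : ∑ u, ∑ b ∈ nbrs G u, w u b ≤ 1.0302 * ε)
    (hw : limUncut r * lossSum canon sel (twoCC F) r
        (nodeLoss (nbrs G) x (pathLoss ε r) (rootLoss ε r)) (K + H + 1) [x] ≤
      ∑ u, ∑ b ∈ nbrs G u, w u b *
        (densWeight r * r * canonSum canon sel (twoCC F) r b (K + H + 1) [u])) :
    (r / (1 - r)) ^ 2 - (∑ u, ∑ b ∈ nbrs G u, w u b *
        (densWeight r * r * canonSum canon sel (twoCC F) r b H [u])) +
      0.9 * (densWeight r * r * canonSum canon sel (twoCC F) r z H [y]) -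
      (∑ d ∈ Finset.range H, (canonCount canon sel (twoCC F) z (d + 1) [y] : ℝ) *
          (gainPotDeriv r * r ^ (d + 2) + gainPot r * ((d + 2) * r ^ (d + 1)))) -
      ((2 * r) ^ (H + 1) + (2 * H ^ 2 + 2) * (2 * r) ^ K) ≤
    ((edgeChoices G).card : ℝ)⁻¹ * ∑ M ∈ edgeChoices G,
      bitCutProb ε (twoCC F) M sel x (K + H + 1) r := by
  have S0 := S 0 le_rfl zero_le_one
  have hε := S0.eps_nonneg
  have hε' := S0.eps_le
  have h0 := S0.pos
  have h1 : 0 < 1 - r := by linarith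
  refine le_trans ?_ (root_le_avg S h2 hF hc hs hdeg hcx hyz hy hK H rfl)
  have hg := gain_le (canon := canon) hF hs (twoCC F) hε hε' h0 h2 hK rfl H y z
  have T := isLossyTree S h2 hF hc hs hdeg
  have hm := T.maxLoss_small
  set Λ := lossSum canon sel (twoCC F) r
    (nodeLoss (nbrs G) x (pathLoss ε r) (rootLoss ε r)) (K + H + 1) [x] with hΛ
  obtain ⟨hΛ0, hΛ1⟩ : 0 ≤ Λ ∧ Λ ≤ 1 := by
    have h3 := T.lossSum_mem (twoCC F) (K + H + 1) [x]
    exact ⟨h3.1, h3.2.trans ((T.crudeLoss_le [x]).trans (hm.trans (by norm_num)))⟩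
  have hpow : (2 * r) ^ (K + H + 1) ≤ (2 * r) ^ K :=
    pow_le_pow_of_le_one (by positivity) (by linarith) (by omega)
  have hp0 : 0 ≤ (2 * r) ^ K := by positivity
  have hU : nomUncut r (K + H + 1) * (1 + Λ) ≤ limUncut r + limUncut r * Λ + 2 * (2 * r) ^ K := by
    have h3 := nomUncut_sub_le h0.le h2.le (K + H + 1)
    calc _ ≤ (limUncut r + (2 * r) ^ K) * (1 + Λ) := by gcongr; linarith
      _ = limUncut r + limUncut r * Λ + (2 * r) ^ K * (1 + Λ) := by ring
      _ ≤ limUncut r + limUncut r * Λ + (2 * r) ^ K * 2 := by gcongr; linarith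
      _ = _ := by ring
  have hsum : ∑ u, ∑ b ∈ nbrs G u, w u b *
        (densWeight r * r * canonSum canon sel (twoCC F) r b (K + H + 1) [u]) ≤
      (∑ u, ∑ b ∈ nbrs G u, w u b *
        (densWeight r * r * canonSum canon sel (twoCC F) r b H [u])) + (2 * r) ^ (H + 1) := by
    calc _ ≤ ∑ u, ∑ b ∈ nbrs G u, (w u b *
          (densWeight r * r * canonSum canon sel (twoCC F) r b H [u]) +
            w u b * (2 * r) ^ (H + 1)) := by
          refine Finset.sum_le_sum fun u _ => Finset.sum_le_sum fun b _ => ?_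
          rw [← mul_add]
          exact mul_le_mul_of_nonneg_left
            (densWeight_mul_canonSum_le hF hs (twoCC F) h0 h2 (by omega) b u) (hw0 u b)
      _ = (∑ u, ∑ b ∈ nbrs G u, w u b *
          (densWeight r * r * canonSum canon sel (twoCC F) r b H [u])) +
            (∑ u, ∑ b ∈ nbrs G u, w u b) * (2 * r) ^ (H + 1) := by
          simp only [Finset.sum_add_distrib, Finset.sum_mul]
      _ ≤ _ := by
          refine add_le_add le_rfl (mul_le_of_le_one_left (by positivity) ?_)
          linarith
  have e : (r / (1 - r)) ^ 2 = 1 - limUncut r := by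
    unfold limUncut
    field_simp
    ring
  rw [e]
  linarith

end Pointwise

/-! ### Integration over the position of the root label -/

section Integrals

theorem continuousOn_densWeight : ContinuousOn densWeight (uIcc 0 (1 / 2)) := by
  unfold densWeight
  refine ContinuousOn.div (by fun_prop) (by fun_prop) fun r hr => ?_
  rw [uIcc_of_le (by norm_num)] at hr
  exact pow_ne_zero 3 (by linarith [hr.2])

theorem continuousOn_gainPot : ContinuousOn gainPot (uIcc 0 (1 / 2)) := by
  unfold gainPot
  refine ContinuousOn.div (by fun_prop) (by fun_prop) fun r hr => ?_
  rw [uIcc_of_le (by norm_num)] at hr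
  exact pow_ne_zero 5 (by linarith [hr.2])

theorem continuousOn_gainPotDeriv : ContinuousOn gainPotDeriv (uIcc 0 (1 / 2)) := by
  unfold gainPotDeriv
  refine ContinuousOn.mul (ContinuousOn.div (by fun_prop) (by fun_prop) fun r hr => ?_)
    (by fun_prop)
  rw [uIcc_of_le (by norm_num)] at hr
  exact pow_ne_zero 6 (by linarith [hr.2])

theorem continuousOn_div_sq : ContinuousOn (fun r : ℝ => (r / (1 - r)) ^ 2) (uIcc 0 (1 / 2)) := by
  refine (ContinuousOn.div (by fun_prop) (by fun_prop) fun r hr => ?_).pow 2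
  rw [uIcc_of_le (by norm_num)] at hr
  linarith [hr.2]

theorem intervalIntegrable_sum {ι : Type} (s : Finset ι) {f : ι → ℝ → ℝ} {a b : ℝ}
    (h : ∀ i ∈ s, IntervalIntegrable (f i) volume a b) :
    IntervalIntegrable (fun r => ∑ i ∈ s, f i r) volume a b := by
  have := IntervalIntegrable.sum s h
  rwa [show ∑ i ∈ s, f i = fun r => ∑ i ∈ s, f i r by ext; simp] at this

theorem intervalIntegrable_gainPot (d : ℕ) : IntervalIntegrable (fun r : ℝ =>
    gainPotDeriv r * r ^ (d + 2) + gainPot r * ((d + 2) * r ^ (d + 1))) volume 0 (1 / 2) :=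
  ((continuousOn_gainPotDeriv.mul (by fun_prop)).add
    (continuousOn_gainPot.mul (by fun_prop))).intervalIntegrable

/-- The potential vanishes at 1/2 and the power of r at 0, so there are no boundary terms. -/
theorem integral_gainPot (d : ℕ) : ∫ r in (0 : ℝ)..(1 / 2),
    (gainPotDeriv r * r ^ (d + 2) + gainPot r * ((d + 2) * r ^ (d + 1))) = 0 := by
  have h : ∀ r ∈ uIcc (0 : ℝ) (1 / 2), HasDerivAt (fun s => gainPot s * s ^ (d + 2))
      (gainPotDeriv r * r ^ (d + 2) + gainPot r * ((d + 2) * r ^ (d + 1))) r := by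
    intro r hr
    rw [uIcc_of_le (by norm_num)] at hr
    exact hasDerivAt_gainPot_mul_pow (by linarith [hr.2]) d
  rw [intervalIntegral.integral_eq_sub_of_hasDerivAt h (intervalIntegrable_gainPot d)]
  simp [gainPot]

theorem integral_two_mul_pow (n : ℕ) :
    ∫ r in (0 : ℝ)..(1 / 2), (2 * r) ^ n = 1 / (2 * (n + 1)) := by
  rw [intervalIntegral.integral_comp_mul_left (fun x : ℝ => x ^ n) two_ne_zero, integral_pow]
  norm_num
  field_simp

theorem s3_eq : s3 = (∫ r in (0 : ℝ)..(1 / 2), (r / (1 - r)) ^ 2) + 1 / 2 := by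
  have h1 : EqOn cutProbInf (fun r : ℝ => (r / (1 - r)) ^ 2) (uIoo 0 (1 / 2)) := by
    intro r hr
    rw [uIoo_of_le (by norm_num)] at hr
    exact if_pos hr.2
  have h2 : EqOn cutProbInf (fun _ => 1) (uIcc (1 / 2) 1) := by
    intro r hr
    rw [uIcc_of_le (by norm_num)] at hr
    exact if_neg (not_lt.2 hr.1)
  have i1 : IntervalIntegrable cutProbInf volume 0 (1 / 2) :=
    (continuousOn_div_sq.intervalIntegrable).congr_uIoo h1.symm
  have i2 : IntervalIntegrable cutProbInf volume (1 / 2) 1 :=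
    (intervalIntegrable_const (c := (1 : ℝ))).congr fun r hr => (h2 (uIoc_subset_uIcc hr)).symm
  rw [s3, ← intervalIntegral.integral_add_adjacent_intervals i1 i2,
    intervalIntegral.integral_congr_uIoo h1, intervalIntegral.integral_congr h2]
  norm_num

variable {V : Type} [Fintype V] [DecidableEq V] {canon : V → Clause V}
  {sel : List V → Clause V} {two : Finset V}

theorem intervalIntegrable_density (b u : V) (n : ℕ) : IntervalIntegrable
    (fun r => densWeight r * r * canonSum canon sel two r b n [u]) volume 0 (1 / 2) := by
  refine ((continuousOn_densWeight.mul continuousOn_id).mul ?_).intervalIntegrable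
  unfold canonSum
  fun_prop

theorem labelDensity_eq {b u : V} (hu : u ∉ two) (hub : u ≠ b) (n : ℕ) :
    labelDensity canon sel two n u b =
      ∫ r in (0 : ℝ)..(1 / 2), densWeight r * r * canonSum canon sel two r b n [u] := by
  unfold labelDensity
  refine intervalIntegral.integral_congr fun r _ => ?_
  rw [labelDensityAt_eq n hu, Finset.sum_range_succ', canonSum, densWeight, mul_assoc,
    Finset.mul_sum]
  congr 1
  simp only [canonCount, List.head?_cons, Option.some.injEq, if_neg hub, Nat.cast_zero, zero_mul,
    add_zero]
  exact Finset.sum_congr rfl fun d _ => by ring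

end Integrals

theorem integral_unitMeasure_ite {A : ℝ → ℝ} (hA : IntervalIntegrable A volume 0 (1 / 2)) (c : ℝ) :
    Integrable (fun r => if r < 1 / 2 then A r else c) unitMeasure ∧
    ∫ r, (if r < 1 / 2 then A r else c) ∂unitMeasure =
      (∫ r in (0 : ℝ)..(1 / 2), A r) + c / 2 := by
  set L : ℝ → ℝ := fun r => if r < 1 / 2 then A r else c with hL
  have h1 : EqOn L A (uIoo 0 (1 / 2)) := by
    intro r hr
    rw [uIoo_of_le (by norm_num)] at hr
    exact if_pos hr.2
  have h2 : EqOn L (fun _ => c) (uIcc (1 / 2) 1) := by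
    intro r hr
    rw [uIcc_of_le (by norm_num)] at hr
    exact if_neg (not_lt.2 hr.1)
  have i1 : IntervalIntegrable L volume 0 (1 / 2) := hA.congr_uIoo h1.symm
  have i2 : IntervalIntegrable L volume (1 / 2) 1 :=
    (intervalIntegrable_const (c := c)).congr fun r hr => (h2 (uIoc_subset_uIcc hr)).symm
  have i3 := i1.trans i2
  constructor
  · rw [intervalIntegrable_iff_integrableOn_Icc_of_le zero_le_one] at i3
    exact i3
  · rw [unitMeasure, integral_Icc_eq_integral_Ioc, ← intervalIntegral.integral_of_le zero_le_one,
      ← intervalIntegral.integral_add_adjacent_intervals i1 i2,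
      intervalIntegral.integral_congr_uIoo h1, intervalIntegral.integral_congr h2]
    norm_num
    ring

/-! ### Integration of the lower bound over r. -/

section Bound

variable {V : Type} [Fintype V] [DecidableEq V] {F : Finset (Clause V)} {canon : V → Clause V}
  {sel : List V → Clause V} {G : SimpleGraph V} {x y z : V} {ε Thr : ℝ}

/-- The lower bound for the probability of the cut if `z` is isolated and has label density at
least `Thr` in `T_y`. -/
theorem le_distD_cut (hF : IsUnique3CNF F) (hc : IsCanonicalChoice F canon)
    (hs : IsClauseLabelling F canon sel) (hε : 0 ≤ ε) (hε' : ε ≤ 1 / 10) (hThr : 0 ≤ Thr)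
    (hG : ∀ a b, G.Adj a b → a ∉ twoCC F) (hcard : ∀ C : G.ConnectedComponent,
      (componentEdges C).card ≤ 22) (hdeg : ∀ a, (nbrs G a).card ≤ 2) (H K : ℕ) (hK : 1 ≤ K)
    (hlow : ∀ a b, G.Adj a b → labelDensity canon sel (twoCC F) H a b ≤ Thr)
    (hx : x ∉ twoCC F) (hy : y ∉ twoCC F) (hz : z ∉ twoCC F) (hcx : canon x = critClause x y z)
    (hyz : y ≠ z) (hzx : z ≠ x) (hiso : ∀ a, ¬ G.Adj z a)
    (hhigh : Thr ≤ labelDensity canon sel (twoCC F) H y z) :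
    s3 - 1.0302 * ε * Thr + 0.9 * Thr - (1 / (2 * (H + 2)) + (H ^ 2 + 1) / (K + 1) +
        2 / (K + H + 5)) ≤ (distD ε G (twoCC F)).real (cut sel x (K + H + 1)) := by
  have hS : ∀ r, 0 < r → r < 1 → ∀ ζ, 0 ≤ ζ → ζ ≤ 1 → IsCorrelation ε G (twoCC F) x z r ζ :=
    fun r h0 h1 ζ hζ0 hζ1 => ⟨hε, hε', h0, h1, hζ0, hζ1, hG, hiso, hx, hz, hzx, hcard⟩
  have hN : ∀ a b, b ∈ nbrs G a → a ∈ nbrs G b := fun a b h => mem_nbrs.2 (mem_nbrs.1 h).symm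
  obtain ⟨w, hw0, hw1, hw2⟩ := exists_lossSum_weights (two := twoCC F) hF hs hc hN hdeg hε x
    (K + H + 1)
  set E : ℝ → ℝ := fun r => ∑ u, ∑ b ∈ nbrs G u, w u b *
        (densWeight r * r * canonSum canon sel (twoCC F) r b H [u]) with hE
  set D : ℝ → ℝ := fun r => densWeight r * r * canonSum canon sel (twoCC F) r z H [y] with hD
  set P : ℝ → ℝ := fun r => ∑ d ∈ Finset.range H,
    (canonCount canon sel (twoCC F) z (d + 1) [y] : ℝ) *
          (gainPotDeriv r * r ^ (d + 2) + gainPot r * ((d + 2) * r ^ (d + 1))) with hP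
  set Q : ℝ → ℝ := fun r => (2 * r) ^ (H + 1) + (2 * H ^ 2 + 2) * (2 * r) ^ K with hQ
  have iR := continuousOn_div_sq.intervalIntegrable (μ := volume)
  have iE : IntervalIntegrable E volume 0 (1 / 2) :=
    intervalIntegrable_sum _ fun u _ => intervalIntegrable_sum _ fun b _ =>
      (intervalIntegrable_density b u H).const_mul _
  have iD : IntervalIntegrable D volume 0 (1 / 2) := intervalIntegrable_density z y H
  have iP : IntervalIntegrable P volume 0 (1 / 2) :=
    intervalIntegrable_sum _ fun d _ => (intervalIntegrable_gainPot d).const_mul _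
  have iQ1 : ∀ n, IntervalIntegrable (fun r : ℝ => (2 * r) ^ n) volume 0 (1 / 2) :=
    fun n => (by fun_prop : Continuous fun r : ℝ => (2 * r) ^ n).intervalIntegrable _ _
  have iQ : IntervalIntegrable Q volume 0 (1 / 2) := (iQ1 _).add ((iQ1 _).const_mul _)
  have vE : ∫ r in (0 : ℝ)..(1 / 2), E r ≤ 1.0302 * ε * Thr := by
    have e : ∫ r in (0 : ℝ)..(1 / 2), E r = ∑ u, ∑ b ∈ nbrs G u, w u b *
        ∫ r in (0 : ℝ)..(1 / 2), densWeight r * r * canonSum canon sel (twoCC F) r b H [u] := by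
      rw [hE, intervalIntegral.integral_finsetSum fun u _ => intervalIntegrable_sum _ fun b _ =>
        (intervalIntegrable_density b u H).const_mul _]
      refine Finset.sum_congr rfl fun u _ => ?_
      rw [intervalIntegral.integral_finsetSum fun b _ =>
        (intervalIntegrable_density b u H).const_mul _]
      exact Finset.sum_congr rfl fun b _ => intervalIntegral.integral_const_mul _ _
    rw [e]
    calc _ ≤ ∑ u, ∑ b ∈ nbrs G u, w u b * Thr := by
          refine Finset.sum_le_sum fun u _ => Finset.sum_le_sum fun b hb => ?_
          have hub := mem_nbrs.1 hb
          rw [← labelDensity_eq (hG u b hub) hub.ne]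
          exact mul_le_mul_of_nonneg_left (hlow u b hub) (hw0 u b)
      _ = (∑ u, ∑ b ∈ nbrs G u, w u b) * Thr := by simp only [Finset.sum_mul]
      _ ≤ _ := mul_le_mul_of_nonneg_right hw1 hThr
  have vD : Thr ≤ ∫ r in (0 : ℝ)..(1 / 2), D r := by
    rwa [hD, ← labelDensity_eq hy hyz]
  have vP : ∫ r in (0 : ℝ)..(1 / 2), P r = 0 := by
    rw [hP, intervalIntegral.integral_finsetSum fun d _ =>
      (intervalIntegrable_gainPot d).const_mul _]
    refine Finset.sum_eq_zero fun d _ => ?_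
    rw [intervalIntegral.integral_const_mul, integral_gainPot, mul_zero]
  have vQ : ∫ r in (0 : ℝ)..(1 / 2), Q r = 1 / (2 * (H + 2)) + (H ^ 2 + 1) / (K + 1) := by
    rw [hQ, intervalIntegral.integral_add (iQ1 _) ((iQ1 _).const_mul _),
      intervalIntegral.integral_const_mul, integral_two_mul_pow, integral_two_mul_pow]
    push_cast
    field_simp
    ring
  have iA := (((iR.sub iE).add (iD.const_mul 0.9)).sub iP).sub iQ
  -- For r ≥ 1/2 the tree has height K+H+1 and is uncut with probability at most 4/(K+H+5),
  -- uniformly in r.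
  obtain ⟨hint, heq⟩ := integral_unitMeasure_ite iA (1 - 4 / ((K + H + 1 : ℕ) + 4))
  have key := integral_le_distD_cut ε hG hx sel (K + H + 1) hint (by
    intro r h0 h1
    split_ifs with h2
    · exact IsCorrelation.lower_le_avg (hS r h0 h1) h2 hF hc hs hdeg hcx hyz hy hK H hw0 hw1
        (hw2 r h0 h2)
    · have h3 := nomUncut_le_of_half_le (not_lt.1 h2) h1.le (K + H + 1)
      refine le_trans ?_ ((hS r h0 h1 (1 - r) (by linarith) (by linarith)).one_sub_nomUncut_le
        (not_lt.1 h2) hF hs (K + H + 1))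
      linarith)
  rw [heq] at key
  refine le_trans ?_ key
  rw [intervalIntegral.integral_sub (((iR.sub iE).add (iD.const_mul 0.9)).sub iP) iQ,
    intervalIntegral.integral_sub ((iR.sub iE).add (iD.const_mul 0.9)) iP,
    intervalIntegral.integral_add (iR.sub iE) (iD.const_mul 0.9),
    intervalIntegral.integral_sub iR iE, intervalIntegral.integral_const_mul, vP, vQ, s3_eq]
  have e : (1 - 4 / ((K + H + 1 : ℕ) + 4 : ℝ)) / 2 = 1 / 2 - 2 / (K + H + 5) := by
    push_cast
    rw [show (K + H + 1 + 4 : ℝ) = K + H + 5 by ring]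
    ring
  rw [e]
  linarith

end Bound

/-! ### The separation of edges and the choice of the heights -/

theorem Separates.le {V : Type} {Hfree low high : SimpleGraph V} {dens : V → V → ℝ} {Thr : ℝ}
    (h : Separates Hfree dens Thr low high) : low ≤ Hfree := by
  induction h with
  | start => exact le_rfl
  | step low high y z _ _ _ ih => exact (SimpleGraph.deleteEdges_le _).trans ih

/-- Every edge of the second graph has high density towards an end that is isolated in the first
graph. -/
theorem Separates.adj_high {V : Type} {Hfree low high : SimpleGraph V} {dens : V → V → ℝ}
    {Thr : ℝ} (h : Separates Hfree dens Thr low high) {a b : V} (hab : high.Adj a b) :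
    Hfree.Adj a b ∧ ((Thr ≤ dens a b ∧ ∀ c, ¬ low.Adj b c) ∨
      (Thr ≤ dens b a ∧ ∀ c, ¬ low.Adj a c)) := by
  induction h with
  | start => exact absurd hab (by simp)
  | step low high y z _ hyz hd ih =>
    have hz : ∀ c, ¬ (low.deleteEdges (low.incidenceSet z)).Adj z c := by
      intro c hc
      rw [SimpleGraph.deleteEdges_adj] at hc
      exact hc.2 ⟨hc.1, Sym2.mem_mk_left z c⟩
    rw [SimpleGraph.sup_adj, SimpleGraph.fromEdgeSet_adj, mem_singleton_iff, Sym2.eq_iff] at hab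
    rcases hab with hab | ⟨⟨rfl, rfl⟩ | ⟨rfl, rfl⟩, -⟩
    · obtain ⟨h1, h2 | h2⟩ := ih hab
      · exact ⟨h1, Or.inl ⟨h2.1, fun c hc => h2.2 c (SimpleGraph.deleteEdges_le _ hc)⟩⟩
      · exact ⟨h1, Or.inr ⟨h2.1, fun c hc => h2.2 c (SimpleGraph.deleteEdges_le _ hc)⟩⟩
    · exact ⟨hyz, Or.inl ⟨hd, hz⟩⟩
    · exact ⟨hyz.symm, Or.inr ⟨hd, hz⟩⟩

theorem s3_le_one : s3 ≤ 1 := by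
  have h : ∫ r in (0 : ℝ)..(1 / 2), (r / (1 - r)) ^ 2 ≤ ∫ _ in (0 : ℝ)..(1 / 2), (1 : ℝ) := by
    refine intervalIntegral.integral_mono_on (by norm_num) continuousOn_div_sq.intervalIntegrable
      intervalIntegrable_const fun r hr => ?_
    have h1 : 0 < 1 - r := by linarith [hr.2]
    refine pow_le_one₀ (div_nonneg hr.1 h1.le) ?_
    rw [div_le_one h1]
    linarith [hr.2]
  rw [intervalIntegral.integral_const] at h
  rw [s3_eq]
  norm_num at h ⊢
  linarith

/-- The cube is needed for the middle term: H² + 1 divided by K must be of order 1/H. -/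
theorem error_le (H K : ℕ) (hK : (H + 1) ^ 3 ≤ K) :
    1 / (2 * ((H : ℝ) + 2)) + ((H : ℝ) ^ 2 + 1) / (K + 1) + 2 / (K + H + 5) ≤ 4 / ((H : ℝ) + 1) := by
  have hK' : ((H : ℝ) + 1) ^ 3 ≤ K := by exact_mod_cast hK
  have hH : (0 : ℝ) < (H : ℝ) + 1 := by positivity
  have hk0 : (0 : ℝ) ≤ K := by positivity
  have h1 : 1 / (2 * ((H : ℝ) + 2)) ≤ 1 / ((H : ℝ) + 1) :=
    one_div_le_one_div_of_le hH (by linarith)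
  have h2 : ((H : ℝ) ^ 2 + 1) / (K + 1) ≤ 1 / ((H : ℝ) + 1) := by
    rw [div_le_div_iff₀ (by positivity) hH]
    nlinarith
  have h3 : 2 / ((K : ℝ) + H + 5) ≤ 2 / ((H : ℝ) + 1) :=
    div_le_div_of_nonneg_left (by norm_num) hH (by linarith)
  calc _ ≤ 1 / ((H : ℝ) + 1) + 1 / ((H : ℝ) + 1) + 2 / ((H : ℝ) + 1) := by gcongr
    _ = _ := by ring

/-- The lower bound for the probability of the cut if `{y, z}` is an edge of `HHigh`. -/
theorem le_distD_cut_of_high {V : Type} [Fintype V] [DecidableEq V] {F : Finset (Clause V)}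
    {canon : V → Clause V} {sel : List V → Clause V} {H HLow HHigh : SimpleGraph V} {x y z : V}
    {ε Thr : ℝ} (hε : 0 ≤ ε) (hε' : ε ≤ 1 / 10) (hThr : 0 ≤ Thr) {h k : ℕ}
    (hk : (h + 1) ^ 3 + h + 1 ≤ k) (hF : IsUnique3CNF F) (hc : IsCanonicalChoice F canon)
    (hs : IsClauseLabelling F canon sel) (hdeg : ∀ v, (H.neighborSet v).ncard ≤ 2)
    (hlh : IsLowHigh (freeGraph canon (twoCC F) H) (labelDensity canon sel (twoCC F) h) Thr HLow
      HHigh)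
    (hx : x ∉ twoCC F) (hcx : canon x = critClause x y z) (hyz : HHigh.Adj y z) :
    s3 - 4 / ((h : ℝ) + 1) - 1.0302 * ε * Thr + 0.9 * Thr ≤
      (distD ε HLow (twoCC F)).real (cut sel x k) := by
  obtain ⟨low, hsep, hdens, hle, hcard⟩ := hlh
  obtain ⟨hfree, hor⟩ := hsep.adj_high hyz
  have hlow : HLow ≤ freeGraph canon (twoCC F) H := hle.trans hsep.le
  -- The clause and the edge are symmetric in `y` and `z`; let `z` be the end that the process
  -- isolated.
  wlog hcase : Thr ≤ labelDensity canon sel (twoCC F) h y z ∧ ∀ c, ¬ low.Adj z c generalizing y z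
  · exact this (hcx.trans (critClause_comm x y z)) hyz.symm hfree.symm hor.symm
      (hor.resolve_left hcase)
  obtain ⟨K, rfl⟩ : ∃ K, k = K + h + 1 := ⟨k - (h + 1), by omega⟩
  have hK : (h + 1) ^ 3 ≤ K := by omega
  have hK1 : 1 ≤ K := (Nat.one_le_pow 3 (h + 1) (by omega)).trans hK
  have hzx : z ≠ x := by
    refine ((hc x).2.2 (z, false) ?_ (by simp)).2
    rw [hcx]
    simp [critClause]
  have hN : ∀ a, (nbrs HLow a).card ≤ 2 := by
    intro a
    refine le_trans ?_ (hdeg a)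
    rw [← Set.ncard_coe_finset]
    exact Set.ncard_le_ncard (fun b hb => (hlow (mem_nbrs.1 hb)).1) (Set.toFinite _)
  have h1 := le_distD_cut hF hc hs hε hε' hThr (fun a b hab => (hlow hab).2.1) hcard hN h K hK1
    (fun a b hab => hdens a b (hle hab)) hx hfree.2.1 hfree.2.2.1 hcx hfree.ne hzx
    (fun c hzc => hcase.2 c (hle hzc)) hcase.1
  have h2 := error_le h K hK
  linarith

end PPSZ
theorem mainTheorem2 (ε Thr : ℝ) (hε₀ : 0 ≤ ε) (hε : ε ≤ 1 / 10)
    (hThr₀ : 0 < Thr) (hThr : Thr ≤ 1 / 1131) :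
    ∃ g : ℕ → ℕ, ∀ h h' : ℕ → ℕ, Tendsto h atTop atTop → (∀ᶠ n in atTop, g (h n) ≤ h' n) →
      ∃ err : ℕ → ℝ, Tendsto err atTop (𝓝 0) ∧
        ∀ (n : ℕ) (F : Finset (PPSZ.Clause (Fin n))) (canon : Fin n → PPSZ.Clause (Fin n))
          (sel : List (Fin n) → PPSZ.Clause (Fin n)) (H HLow HHigh : SimpleGraph (Fin n)),
          PPSZ.IsUnique3CNF F →
          PPSZ.IsCanonicalChoice F canon →
          PPSZ.IsClauseLabelling F canon sel →
          H ≤ PPSZ.critGraph canon →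
          (∀ v, (H.neighborSet v).ncard ≤ 2) →
          PPSZ.IsLowHigh (PPSZ.freeGraph canon (PPSZ.twoCC F) H)
            (PPSZ.labelDensity canon sel (PPSZ.twoCC F) (h n)) Thr HLow HHigh →
          ∀ x y z : Fin n, x ∉ PPSZ.twoCC F →
            canon x = PPSZ.critClause x y z →
            HHigh.Adj y z →
            PPSZ.s3 - err n - 1.0302 * ε * Thr + 0.9 * Thr ≤
              (PPSZ.distD ε HLow (PPSZ.twoCC F)).real (PPSZ.cut sel x (h' n)) := by
  refine ⟨fun h => (h + 1) ^ 3 + h + 1, fun h h' hh hh' =>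
    -- Where h' is still too small, which happens for finitely many n, the error 2 makes the bound
    -- negative because s₃ ≤ 1.
    ⟨fun n => if (h n + 1) ^ 3 + h n + 1 ≤ h' n then 4 / ((h n : ℝ) + 1) else 2, ?_, ?_⟩⟩
  · have hlim : Tendsto (fun n => 4 / ((h n : ℝ) + 1)) atTop (𝓝 0) :=
      tendsto_const_nhds.div_atTop
        (tendsto_atTop_add_const_right _ _ (tendsto_natCast_atTop_atTop.comp hh))
    refine hlim.congr' ?_
    filter_upwards [hh'] with n hn
    exact (if_pos hn).symm
  · intro n F canon sel H HLow HHigh hF hc hs _ hdeg hlh x y z hx hcx hyz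
    dsimp only
    split_ifs with hn
    · exact PPSZ.le_distD_cut_of_high hε₀ hε hThr₀.le hn hF hc hs hdeg hlh hx hcx hyz
    · have h1 := PPSZ.s3_le_one
      have h2 : 0 ≤ 1.0302 * ε * Thr := by positivity
      refine le_trans ?_ measureReal_nonneg
      linarith
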